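/- **Theorem (Flatness theorem for $(2,3,5)$-manifolds).** Let $(M,E,g)$ be a smooth sub-Riemannian manifold, that is, $E$ is a smooth subbundle of $TM$ and $g$ is a smooth metric tensor on $E$. Let $E^{-k}\subseteq TM$ be spanned by the values of the iterated brackets $[V_1,[V_2,\cdots[V_{j-1},V_j]\cdots]]$ of $j\le k$ smooth sections of $E$, and assume that $E$ has growth vector $(2,3,5)$: at every point $E=E^{-1}$, $E^{-2}$, $E^{-3}$ have rank $2,3,5$, and $E^{-3}=TM$ (so $\dim M=5$). Let $X_1,X_2$ be any smooth orthonormal basis of $E$ defined on an open set $U\subseteq M$. Put $X_3=[X_1,X_2]$, $X_4=[X_1,X_3]$, $X_5=[X_2,X_3]$. Then $X_1,\dots,X_5$ is a smooth frame of $TM$ on $U$; write $[X_i,X_j]=\sum_{k=1}^5 c_{ij}^kX_k$, $a_1=c_{14}^4+c_{15}^5$, $a_2=c_{24}^4+c_{25}^5$, and define \begin{align*} Z&=X_3+(c_{23}^3+c_{24}^4+c_{25}^5)X_1-(c_{13}^3+c_{14}^4+c_{15}^5)X_2,\\ Y_1&=X_4-a_1Z+\bigl(c_{24}^3-X_2(a_1)+c_{24}^4a_1+c_{24}^5a_2\bigr)X_1-\bigl(c_{14}^3-X_1(a_1)+c_{14}^4a_1+c_{14}^5a_2\bigr)X_2,\\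 Y_2&=X_5-a_2Z+\bigl(c_{25}^3-X_2(a_2)+c_{25}^4a_1+c_{25}^5a_2\bigr)X_1-\bigl(c_{15}^3-X_1(a_2)+c_{15}^4a_1+c_{15}^5a_2\bigr)X_2. \end{align*} Then $X_1,X_2,Z,Y_1,Y_2$ is a smooth frame of $TM$ on $U$. Let $\bar g$ be the Riemannian metric on $U$ making it orthonormal, with Levi-Civita connection $\nabla^{\bar g}$, and let $(TM)_{-2}=\operatorname{span}\{Z\}$, $(TM)_{-3}=\operatorname{span}\{Y_1,Y_2\}$. (a) $\bar g$, $(TM)_{-2}$ and $(TM)_{-3}$ are independent of the choice of basis: if $X_1',X_2'$ is another smooth orthonormal basis of $E$, on an open set $U'$, then the objects defined from the two bases coincide on $U\cap U'$. (b) There is exactly one affine connection $\nabla$ on $U$ for which $E$, $(TM)_{-2}$ and $(TM)_{-3}$ are parallel, $\nabla Z=0$, and for all $i,j,k\in\{1,2\}$ \begin{align*} \langle\nabla_{X_i}X_j,X_k\rangle_{\bar g}&=\langle\nabla_{X_i}Y_j,Y_k\rangle_{\bar g}=\langle\nabla^{\bar g}_{X_i}X_j,X_k\rangle_{\bar g},\\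 \langle\nabla_{Z}X_j,X_k\rangle_{\bar g}&=\langle\nabla_{Z}Y_j,Y_k\rangle_{\bar g}=\langle[Z,X_j],X_k\rangle_{\bar g}+\tfrac12(\mathcal L_Z\bar g)(X_j,X_k),\\ \langle\nabla_{Y_i}X_j,X_k\rangle_{\bar g}&=\langle\nabla_{Y_i}Y_j,Y_k\rangle_{\bar g}=\langle[Y_i,X_j],X_k\rangle_{\bar g}+\tfrac12(\mathcal L_{Y_i}\bar g)(X_j,X_k). \end{align*} (c) Let $G$ be the Carnot group with growth vector $(2,3,5)$, i.e. the simply connected Lie group whose Lie algebra has a basis $A_1,A_2,B,C_1,C_2$ with only non-zero brackets $[A_1,A_2]=B$, $[A_j,B]=C_j$ (up to skew-symmetry), with the left-invariant sub-Riemannian structure for which $A_1,A_2$ is an orthonormal basis of the horizontal bundle. Then $U$ is locally isometric to $G$ (every point of $U$ has an open neighbourhood in $U$ with a diffeomorphism onto an open subset of $G$ whose differential maps the horizontal bundle onto that of $G$, isometrically on each fibre) if and only if the curvature $R$ of $\nabla$ vanishes on $U$ and the only non-zero parts of its torsion $T(V,W)=\nabla_VW-\nabla_WV-[V,W]$ are,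 up to skew-symmetry, $$T(X_2,X_1)=Z,\qquad T(Z,X_j)=Y_j\quad(j=1,2).$$ That is, moreover, $T(X_i,Y_j)=T(Z,Y_j)=T(Y_1,Y_2)=0$ for $i,j\in\{1,2\}$. -/

import Mathlib

open scoped Manifold ContDiff Bundle
open VectorField

noncomputable section

namespace SubRiem

/-- Vector fields on a smooth `n`-manifold (without boundary), with no regularity imposed. -/
abbrev VField (n : ℕ) (M : Type*) [TopologicalSpace M]
    [ChartedSpace (EuclideanSpace ℝ (Fin n)) M] : Type _ :=
  Π x : M, TangentSpace (𝓡 n) x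

section General

variable {n : ℕ} {M : Type*} [TopologicalSpace M] [ChartedSpace (EuclideanSpace ℝ (Fin n)) M]
  [IsManifold (𝓡 n) ∞ M]

/-- The vector field `X` is smooth on the set `U`. -/
def SmoothOn (X : VField n M) (U : Set M) : Prop :=
  ContMDiffOn (𝓡 n) (𝓡 n).tangent ∞
    (fun x => (⟨x, X x⟩ : TangentBundle (𝓡 n) M)) U

/-- Lie bracket of vector fields. -/
abbrev lie (X Y : VField n M) : VField n M := mlieBracket (𝓡 n) X Y

/-- The derivative `X(f)` of a function along a vector field. -/
def dir (X : VField n M) (f : M → ℝ) (x : M) : ℝ := mvfderiv (𝓡 n) f x (X x)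

variable (n M) in
/-- A sub-Riemannian structure: a smooth subbundle `E` of the tangent bundle together with a
smooth positive definite metric tensor on `E`. -/
structure SubRiemannianStructure where
  /-- the horizontal bundle -/
  E : ∀ x : M, Submodule ℝ (TangentSpace (𝓡 n) x)
  /-- the metric tensor -/
  g : ∀ x : M, E x →ₗ[ℝ] E x →ₗ[ℝ] ℝ
  /-- around every point `E` has a smooth local frame -/
  subbundle : ∀ x₀ : M, ∃ (U : Set M) (k : ℕ) (s : Fin k → VField n M), IsOpen U ∧ x₀ ∈ U ∧
    (∀ i, SmoothOn (s i) U) ∧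
    ∀ x ∈ U, LinearIndependent ℝ (fun i => s i x) ∧
      Submodule.span ℝ (Set.range fun i => s i x) = E x
  symm : ∀ x (u v : E x), g x u v = g x v u
  pos : ∀ x (u : E x), u ≠ 0 → 0 < g x u u
  smooth : ∀ (U : Set M), IsOpen U → ∀ X Y : (∀ x, E x),
    SmoothOn (fun x => (X x : TangentSpace (𝓡 n) x)) U →
    SmoothOn (fun x => (Y x : TangentSpace (𝓡 n) x)) U →
    ContMDiffOn (𝓡 n) 𝓘(ℝ, ℝ) ∞ (fun x => g x (X x) (Y x)) U

namespace SubRiemannianStructure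

variable (S : SubRiemannianStructure n M)

/-- The smooth sections `Γ(E)`. -/
def sections : Set (VField n M) := {X | SmoothOn X Set.univ ∧ ∀ x, X x ∈ S.E x}

/-- The iterated brackets `[X₁, [X₂, ⋯ [X_{j-1}, X_j]]]` of `j` sections of `E`
(`0` for `j = 0` and `X₁` for `j = 1`). -/
def brackets : ℕ → Set (VField n M)
  | 0 => {0}
  | 1 => S.sections
  | j + 2 => {V | ∃ X ∈ S.sections, ∃ W ∈ brackets (j + 1), V = lie X W}

/-- The flag `E^{-k}`: the span of the iterated brackets of at most `k` sections. -/
def flag (k : ℕ) (x : M) : Submodule ℝ (TangentSpace (𝓡 n) x) :=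
  Submodule.span ℝ {v | ∃ j ≤ k, ∃ W ∈ S.brackets j, v = W x}

/-- `E` is bracket-generating and equiregular with growth vector `r = (r₁, …, r_s)`:
`E^{-k}` has constant rank `r_k`, and `s` is the least integer with `E^{-s} = TM`. -/
def HasGrowthVector (r : List ℕ) : Prop :=
  ∀ x : M, (∀ (k : ℕ) (hk : k < r.length), Module.finrank ℝ (S.flag (k + 1) x) = r[k]) ∧
    S.flag r.length x = ⊤ ∧ ∀ k < r.length, S.flag k x ≠ ⊤

/-- `X₁, …, X_k` is a smooth orthonormal basis of `E` on `U`. -/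
structure IsOrthonormalFrameOn {k : ℕ} (X : Fin k → VField n M) (U : Set M) : Prop where
  smooth : ∀ i, SmoothOn (X i) U
  span_eq : ∀ x ∈ U, Submodule.span ℝ (Set.range fun i => X i x) = S.E x
  orthonormal : ∀ x ∈ U, ∀ (i j : Fin k) (u v : S.E x),
    (u : TangentSpace (𝓡 n) x) = X i x → (v : TangentSpace (𝓡 n) x) = X j x →
      S.g x u v = if i = j then 1 else 0

/-- The open subset `U` of `(M, E, g)` is locally isometric to `(N, E', g')`: every point of `U` has
an open neighbourhood in `U` and a diffeomorphism `Φ` of it onto an open subset of `N` such that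
`Φ_*` maps `E` onto `E'`, isometrically on each fibre. -/
def LocallyIsometricOn {N : Type*} [TopologicalSpace N]
    [ChartedSpace (EuclideanSpace ℝ (Fin n)) N] [IsManifold (𝓡 n) ∞ N]
    (U : Set M) (S' : SubRiemannianStructure n N) : Prop :=
  ∀ x₀ ∈ U, ∃ Φ : OpenPartialHomeomorph M N, x₀ ∈ Φ.source ∧ Φ.source ⊆ U ∧
    ContMDiffOn (𝓡 n) (𝓡 n) ∞ Φ Φ.source ∧ ContMDiffOn (𝓡 n) (𝓡 n) ∞ Φ.symm Φ.target ∧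
    ∀ x ∈ Φ.source,
      (S.E x).map (mfderiv (𝓡 n) (𝓡 n) Φ x).toLinearMap = S'.E (Φ x) ∧
      ∀ (u v : S.E x) (u' v' : S'.E (Φ x)),
        (u' : TangentSpace (𝓡 n) (Φ x)) = mfderiv (𝓡 n) (𝓡 n) Φ x u →
        (v' : TangentSpace (𝓡 n) (Φ x)) = mfderiv (𝓡 n) (𝓡 n) Φ x v →
          S'.g (Φ x) u' v' = S.g x u v

end SubRiemannianStructure

/-! ### Frames, metrics and connections -/

open Classical in
/-- The `k`-th coefficient of the tangent vector `v` at `x` in the frame `F` (junk value `0` at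
points where `F` is not a basis of the tangent space). -/
def coeff {ι : Type*} (F : ι → VField n M) (x : M) (v : TangentSpace (𝓡 n) x) (k : ι) : ℝ :=
  if h : LinearIndependent ℝ (fun i => F i x) ∧
      ⊤ ≤ Submodule.span ℝ (Set.range fun i => F i x) then
    (Module.Basis.mk h.1 h.2).repr v k
  else 0

/-- The structure constants `c_{ij}^k` of a frame: `[F_i, F_j] = ∑ k, c_{ij}^k F_k`. -/
def structConst {ι : Type*} (F : ι → VField n M) (i j k : ι) (x : M) : ℝ :=
  coeff F x (lie (F i) (F j) x) k

/-- A field of bilinear forms on the tangent spaces, given by its values on pairs of vectors. -/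
abbrev FormField (n : ℕ) (M : Type*) [TopologicalSpace M]
    [ChartedSpace (EuclideanSpace ℝ (Fin n)) M] : Type _ :=
  ∀ x : M, TangentSpace (𝓡 n) x → TangentSpace (𝓡 n) x → ℝ

/-- The Riemannian metric that makes the frame `F` orthonormal. -/
def frameMetric {ι : Type*} [Fintype ι] (F : ι → VField n M) : FormField n M :=
  fun x u v => ∑ k, coeff F x u k * coeff F x v k

/-- The Lie derivative `(ℒ_Z h)(X, Y)` of a field of bilinear forms. -/
def lieDerivForm (h : FormField n M) (Z X Y : VField n M) (x : M) : ℝ :=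
  dir Z (fun y => h y (X y) (Y y)) x - h x (lie Z X x) (Y x) - h x (X x) (lie Z Y x)

/-- Candidates for affine connections; `D Y x (X x)` is `∇_X Y` at `x`. That such a map is a
connection on `U` is `IsCovariantDerivativeOn _ D U`. -/
abbrev Conn (n : ℕ) (M : Type*) [TopologicalSpace M]
    [ChartedSpace (EuclideanSpace ℝ (Fin n)) M] : Type _ :=
  VField n M → Π x : M, TangentSpace (𝓡 n) x →L[ℝ] TangentSpace (𝓡 n) x

/-- `∇_X Y`. -/
def nabla (D : Conn n M) (X Y : VField n M) : VField n M := fun x => D Y x (X x)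

/-- `T(X, Y) = ∇_X Y - ∇_Y X - [X, Y]`. -/
def torsion (D : Conn n M) (X Y : VField n M) : VField n M :=
  fun x => nabla D X Y x - nabla D Y X x - lie X Y x

/-- `R(X, Y) W = ∇_X ∇_Y W - ∇_Y ∇_X W - ∇_{[X, Y]} W`. -/
def curvature (D : Conn n M) (X Y W : VField n M) : VField n M :=
  fun x => nabla D X (nabla D Y W) x - nabla D Y (nabla D X W) x - nabla D (lie X Y) W x

/-- The curvature vanishes on `U`. -/
def CurvatureVanishesOn (D : Conn n M) (U : Set M) : Prop :=
  ∀ X Y W : VField n M, SmoothOn X U → SmoothOn Y U → SmoothOn W U →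
    ∀ x ∈ U, curvature D X Y W x = 0

/-- `D` is the Levi-Civita connection of `h` on `U`: a torsion-free connection with
`X h(Y, W) = h(∇_X Y, W) + h(Y, ∇_X W)`. -/
structure IsLeviCivitaOn (h : FormField n M) (U : Set M) (D : Conn n M) : Prop where
  isConnection : IsCovariantDerivativeOn (EuclideanSpace ℝ (Fin n)) D U
  torsion_free : ∀ X Y : VField n M, SmoothOn X U → SmoothOn Y U →
    ∀ x ∈ U, torsion D X Y x = 0
  metric : ∀ X Y W : VField n M, SmoothOn X U → SmoothOn Y U → SmoothOn W U → ∀ x ∈ U,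
    dir X (fun y => h y (Y y) (W y)) x = h x (nabla D X Y x) (W x) + h x (Y x) (nabla D X W x)

/-- The family of subspaces `V` is parallel on `U`: covariant derivatives of smooth sections of
`V` are sections of `V`. -/
def IsParallelOn (D : Conn n M) (V : ∀ x : M, Submodule ℝ (TangentSpace (𝓡 n) x))
    (U : Set M) : Prop :=
  ∀ X Y : VField n M, SmoothOn X U → SmoothOn Y U → (∀ x ∈ U, Y x ∈ V x) →
    ∀ x ∈ U, nabla D X Y x ∈ V x

end General

/-! ### The canonical frame of a sub-Riemannian `(2,3,5)`-manifold

Indices start at `0`: the fields `X₁, …, X₅` are `bracketFrame X 0, …, bracketFrame X 4`, and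
`c_{ij}^k` is `structConst (bracketFrame X) (i-1) (j-1) (k-1)`. -/

section TwoThreeFive

variable {M : Type*} [TopologicalSpace M] [ChartedSpace (EuclideanSpace ℝ (Fin 5)) M]
  [IsManifold (𝓡 5) ∞ M]

/-- `X₁, X₂, X₃ = [X₁, X₂], X₄ = [X₁, X₃], X₅ = [X₂, X₃]`. -/
def bracketFrame (X : Fin 2 → VField 5 M) : Fin 5 → VField 5 M :=
  ![X 0, X 1, lie (X 0) (X 1), lie (X 0) (lie (X 0) (X 1)), lie (X 1) (lie (X 0) (X 1))]

/-- `a₁ = c_{14}^4 + c_{15}^5` and `a₂ = c_{24}^4 + c_{25}^5`. -/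
def traceCoeff (X : Fin 2 → VField 5 M) (j : Fin 2) (x : M) : ℝ :=
  let c := structConst (bracketFrame X)
  ![c 0 3 3 x + c 0 4 4 x, c 1 3 3 x + c 1 4 4 x] j

/-- `Z = X₃ + (c_{23}^3 + c_{24}^4 + c_{25}^5) X₁ - (c_{13}^3 + c_{14}^4 + c_{15}^5) X₂`. -/
def fieldZ (X : Fin 2 → VField 5 M) : VField 5 M := fun x =>
  let c := structConst (bracketFrame X)
  bracketFrame X 2 x + (c 1 2 2 x + c 1 3 3 x + c 1 4 4 x) • X 0 x
    - (c 0 2 2 x + c 0 3 3 x + c 0 4 4 x) • X 1 x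

/-- With `a₁ = c_{14}^4 + c_{15}^5` and `a₂ = c_{24}^4 + c_{25}^5`,
`Y₁ = X₄ - a₁ Z + (c_{24}^3 - X₂(a₁) + c_{24}^4 a₁ + c_{24}^5 a₂) X₁
        - (c_{14}^3 - X₁(a₁) + c_{14}^4 a₁ + c_{14}^5 a₂) X₂`,
`Y₂ = X₅ - a₂ Z + (c_{25}^3 - X₂(a₂) + c_{25}^4 a₁ + c_{25}^5 a₂) X₁
        - (c_{15}^3 - X₁(a₂) + c_{15}^4 a₁ + c_{15}^5 a₂) X₂`. -/
def fieldY (X : Fin 2 → VField 5 M) : Fin 2 → VField 5 M :=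
  let c := structConst (bracketFrame X)
  let a := traceCoeff X
  ![fun x => bracketFrame X 3 x - a 0 x • fieldZ X x
      + (c 1 3 2 x - dir (X 1) (a 0) x + c 1 3 3 x * a 0 x + c 1 3 4 x * a 1 x) • X 0 x
      - (c 0 3 2 x - dir (X 0) (a 0) x + c 0 3 3 x * a 0 x + c 0 3 4 x * a 1 x) • X 1 x,
    fun x => bracketFrame X 4 x - a 1 x • fieldZ X x
      + (c 1 4 2 x - dir (X 1) (a 1) x + c 1 4 3 x * a 0 x + c 1 4 4 x * a 1 x) • X 0 x
      - (c 0 4 2 x - dir (X 0) (a 1) x + c 0 4 3 x * a 0 x + c 0 4 4 x * a 1 x) • X 1 x]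

/-- The frame `X₁, X₂, Z, Y₁, Y₂`. -/
def adaptedFrame (X : Fin 2 → VField 5 M) : Fin 5 → VField 5 M :=
  ![X 0, X 1, fieldZ X, fieldY X 0, fieldY X 1]

/-- The metric `ḡ` that makes `X₁, X₂, Z, Y₁, Y₂` orthonormal. -/
def gbar (X : Fin 2 → VField 5 M) : FormField 5 M := frameMetric (adaptedFrame X)

/-- `(TM)_{-2} = span {Z}`. -/
def TMm2 (X : Fin 2 → VField 5 M) (x : M) : Submodule ℝ (TangentSpace (𝓡 5) x) :=
  Submodule.span ℝ {fieldZ X x}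

/-- `(TM)_{-3} = span {Y₁, Y₂}`. -/
def TMm3 (X : Fin 2 → VField 5 M) (x : M) : Submodule ℝ (TangentSpace (𝓡 5) x) :=
  Submodule.span ℝ (Set.range fun j => fieldY X j x)

/-- The rules that determine the connection `∇` on `U`, where `D` is the Levi-Civita connection
of `ḡ`. -/
structure IsCanonicalConnectionOn (S : SubRiemannianStructure 5 M) (X : Fin 2 → VField 5 M)
    (U : Set M) (D nab : Conn 5 M) : Prop where
  isConnection : IsCovariantDerivativeOn (EuclideanSpace ℝ (Fin 5)) nab U
  parallel_E : IsParallelOn nab S.E U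
  parallel_m2 : IsParallelOn nab (TMm2 X) U
  parallel_m3 : IsParallelOn nab (TMm3 X) U
  nabla_Z : ∀ V : VField 5 M, SmoothOn V U → ∀ x ∈ U, nabla nab V (fieldZ X) x = 0
  nabla_X_X : ∀ i j k : Fin 2, ∀ x ∈ U,
    gbar X x (nabla nab (X i) (X j) x) (X k x) = gbar X x (nabla D (X i) (X j) x) (X k x)
  nabla_X_Y : ∀ i j k : Fin 2, ∀ x ∈ U,
    gbar X x (nabla nab (X i) (fieldY X j) x) (fieldY X k x) =
      gbar X x (nabla D (X i) (X j) x) (X k x)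
  nabla_Z_X : ∀ j k : Fin 2, ∀ x ∈ U,
    gbar X x (nabla nab (fieldZ X) (X j) x) (X k x) =
      gbar X x (lie (fieldZ X) (X j) x) (X k x)
        + 1 / 2 * lieDerivForm (gbar X) (fieldZ X) (X j) (X k) x
  nabla_Z_Y : ∀ j k : Fin 2, ∀ x ∈ U,
    gbar X x (nabla nab (fieldZ X) (fieldY X j) x) (fieldY X k x) =
      gbar X x (lie (fieldZ X) (X j) x) (X k x)
        + 1 / 2 * lieDerivForm (gbar X) (fieldZ X) (X j) (X k) x
  nabla_Y_X : ∀ i j k : Fin 2, ∀ x ∈ U,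
    gbar X x (nabla nab (fieldY X i) (X j) x) (X k x) =
      gbar X x (lie (fieldY X i) (X j) x) (X k x)
        + 1 / 2 * lieDerivForm (gbar X) (fieldY X i) (X j) (X k) x
  nabla_Y_Y : ∀ i j k : Fin 2, ∀ x ∈ U,
    gbar X x (nabla nab (fieldY X i) (fieldY X j) x) (fieldY X k x) =
      gbar X x (lie (fieldY X i) (X j) x) (X k x)
        + 1 / 2 * lieDerivForm (gbar X) (fieldY X i) (X j) (X k) x

/-- The only non-zero parts of the torsion on `U` are `T(X₂, X₁) = Z` and `T(Z, X_j) = Y_j`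
(and those that follow by skew-symmetry). -/
structure HasModelTorsionOn (X : Fin 2 → VField 5 M) (U : Set M) (nab : Conn 5 M) : Prop where
  X_X : ∀ x ∈ U, torsion nab (X 1) (X 0) x = fieldZ X x
  Z_X : ∀ j : Fin 2, ∀ x ∈ U, torsion nab (fieldZ X) (X j) x = fieldY X j x
  X_Y : ∀ i j : Fin 2, ∀ x ∈ U, torsion nab (X i) (fieldY X j) x = 0
  Z_Y : ∀ j : Fin 2, ∀ x ∈ U, torsion nab (fieldZ X) (fieldY X j) x = 0
  Y_Y : ∀ x ∈ U, torsion nab (fieldY X 0) (fieldY X 1) x = 0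

end TwoThreeFive

/-! ### The Carnot group with growth vector `(2,3,5)`

The simply connected Lie group with Lie algebra `span {A₁, A₂} ⊕ span {B} ⊕ span {C₁, C₂}`, the only
non-zero brackets being `[A₁, A₂] = B` and `[A_j, B] = C_j`, realised on `ℝ⁵` in coordinates in
which `A₁, A₂, B, C₁, C₂` are the coordinate vectors at the identity `0`. -/

/-- The group law on `ℝ⁵`. -/
def cartanMul (x y : EuclideanSpace ℝ (Fin 5)) : EuclideanSpace ℝ (Fin 5) :=
  !₂[x 0 + y 0, x 1 + y 1, x 2 + y 2 + x 0 * y 1,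
    x 3 + y 3 + x 0 * y 2 + x 0 ^ 2 * y 1 / 2,
    x 4 + y 4 + x 1 * y 2 + x 0 * x 1 * y 1 + x 0 * y 1 ^ 2 / 2]

/-- The inverse for `cartanMul`. -/
def cartanInv (x : EuclideanSpace ℝ (Fin 5)) : EuclideanSpace ℝ (Fin 5) :=
  !₂[-x 0, -x 1, -x 2 + x 0 * x 1, -x 3 + x 0 * x 2 - x 0 ^ 2 * x 1 / 2,
    -x 4 + x 1 * x 2 - x 0 * x 1 ^ 2 / 2]

/-- The underlying manifold `ℝ⁵` of the Carnot group. -/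
def CartanGroup : Type := EuclideanSpace ℝ (Fin 5)

namespace CartanGroup

instance : TopologicalSpace CartanGroup :=
  inferInstanceAs (TopologicalSpace (EuclideanSpace ℝ (Fin 5)))

instance : ChartedSpace (EuclideanSpace ℝ (Fin 5)) CartanGroup :=
  inferInstanceAs (ChartedSpace (EuclideanSpace ℝ (Fin 5)) (EuclideanSpace ℝ (Fin 5)))

instance : IsManifold (𝓡 5) ∞ CartanGroup :=
  inferInstanceAs (IsManifold (𝓡 5) ∞ (EuclideanSpace ℝ (Fin 5)))

instance : Group CartanGroup where
  mul := cartanMul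
  one := (0 : EuclideanSpace ℝ (Fin 5))
  inv := cartanInv
  mul_assoc x y z := by
    change cartanMul (cartanMul x y) z = cartanMul x (cartanMul y z)
    ext i
    fin_cases i <;> simp [cartanMul] <;> ring
  one_mul x := by
    change cartanMul 0 x = x
    ext i
    fin_cases i <;> simp [cartanMul]
  mul_one x := by
    change cartanMul x 0 = x
    ext i
    fin_cases i <;> simp [cartanMul]
  inv_mul_cancel x := by
    change cartanMul (cartanInv x) x = 0
    ext i
    fin_cases i <;> simp [cartanMul, cartanInv] <;> ring

theorem contDiff_cartanMul :
    ContDiff ℝ ∞ (fun p : EuclideanSpace ℝ (Fin 5) × EuclideanSpace ℝ (Fin 5) =>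
      cartanMul p.1 p.2) := by
  rw [contDiff_euclidean]
  intro i
  fin_cases i <;> simp [cartanMul] <;> fun_prop

theorem contDiff_cartanInv : ContDiff ℝ ∞ cartanInv := by
  rw [contDiff_euclidean]
  intro i
  fin_cases i <;> simp [cartanInv] <;> fun_prop

instance : LieGroup (𝓡 5) ∞ CartanGroup where
  contMDiff_mul := by
    have h := contDiff_cartanMul.contMDiff
    rw [modelWithCornersSelf_prod, ← chartedSpaceSelf_prod] at h
    exact h
  contMDiff_inv := contDiff_cartanInv.contMDiff

/-- The differential at `y` of the left translation by `x`, in coordinates. -/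
def dLeft (x y v : EuclideanSpace ℝ (Fin 5)) : EuclideanSpace ℝ (Fin 5) :=
  !₂[v 0, v 1, v 2 + x 0 * v 1, v 3 + x 0 * v 2 + x 0 ^ 2 / 2 * v 1,
    v 4 + x 1 * v 2 + x 0 * x 1 * v 1 + x 0 * y 1 * v 1]

theorem fderiv_of_quadratic {f : EuclideanSpace ℝ (Fin 5) → EuclideanSpace ℝ (Fin 5)}
    (hf : ContDiff ℝ ∞ f) {x v w q : EuclideanSpace ℝ (Fin 5)}
    (h : ∀ t : ℝ, f (x + t • v) = f x + t • w + t ^ 2 • q) : fderiv ℝ f x v = w := by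
  rw [← ((hf.differentiable (by simp)) x).lineDeriv_eq_fderiv]
  apply HasLineDerivAt.lineDeriv
  unfold HasLineDerivAt
  have hf : (fun t : ℝ => f (x + t • v)) =
      (fun t : ℝ => f x + t • w) + fun t : ℝ => t ^ 2 • q := funext h
  rw [hf]
  have h1 := ((hasDerivAt_id (0 : ℝ)).smul_const w).const_add (f x)
  have h2 := ((hasDerivAt_id (0 : ℝ)).pow 2).smul_const q
  simpa using h1.add h2

theorem fderiv_cartanMul (x y v : EuclideanSpace ℝ (Fin 5)) :
    fderiv ℝ (cartanMul x) y v = dLeft x y v := by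
  apply fderiv_of_quadratic (q := !₂[0, 0, 0, 0, x 0 * v 1 ^ 2 / 2])
    (contDiff_cartanMul.comp (contDiff_const (c := x) |>.prodMk contDiff_id))
  intro t
  ext i
  fin_cases i <;> simp [cartanMul, dLeft] <;> ring

theorem mfderiv_mul_left (x y : CartanGroup) (v : EuclideanSpace ℝ (Fin 5)) :
    (mfderiv (𝓡 5) (𝓡 5) (fun z : CartanGroup => x * z) y v : EuclideanSpace ℝ (Fin 5)) =
      dLeft x y v :=
  (congrArg (fun L : EuclideanSpace ℝ (Fin 5) →L[ℝ] EuclideanSpace ℝ (Fin 5) => L v)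
    (mfderiv_eq_fderiv (f := cartanMul x) (x := y))).trans (fderiv_cartanMul x y v)

/-- The left-invariant vector fields `A₁, A₂, B, C₁, C₂`. -/
def leftField (i : Fin 5) : VField 5 CartanGroup :=
  mulInvariantVectorField (I := 𝓡 5) (G := CartanGroup)
    (EuclideanSpace.single i (1 : ℝ) : EuclideanSpace ℝ (Fin 5))

theorem leftField_eq (i : Fin 5) (x : EuclideanSpace ℝ (Fin 5)) :
    (leftField i x : EuclideanSpace ℝ (Fin 5)) = dLeft x 0 (EuclideanSpace.single i 1) :=
  mfderiv_mul_left x 1 _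

/-- A vector field on the group as a map `ℝ⁵ → ℝ⁵`. -/
def toMap (X : VField 5 CartanGroup) : EuclideanSpace ℝ (Fin 5) → EuclideanSpace ℝ (Fin 5) := X

theorem toMap_leftField (i : Fin 5) : toMap (leftField i) =
    (![fun _ => !₂[1, 0, 0, 0, 0], fun x => !₂[0, 1, x 0, x 0 ^ 2 / 2, x 0 * x 1],
      fun x => !₂[0, 0, 1, x 0, x 1], fun _ => !₂[0, 0, 0, 1, 0], fun _ => !₂[0, 0, 0, 0, 1]] :
      Fin 5 → EuclideanSpace ℝ (Fin 5) → EuclideanSpace ℝ (Fin 5)) i := by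
  funext x
  have h : toMap (leftField i) x = dLeft x 0 (EuclideanSpace.single i 1) := leftField_eq i x
  rw [h]
  ext j
  fin_cases i <;> fin_cases j <;> simp [dLeft]

theorem smoothOn_iff {X : VField 5 CartanGroup} {U : Set (EuclideanSpace ℝ (Fin 5))} :
    SmoothOn (M := CartanGroup) X U ↔ ContDiffOn ℝ ∞ (toMap X) U :=
  contMDiffOn_vectorSpace_iff_contDiffOn (E := EuclideanSpace ℝ (Fin 5))

theorem contDiff_leftField (i : Fin 5) : ContDiff ℝ ∞ (toMap (leftField i)) := by
  rw [toMap_leftField, contDiff_euclidean]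
  intro j
  fin_cases i <;> fin_cases j <;> simp <;> fun_prop

theorem lie_eq (X Y : VField 5 CartanGroup) :
    toMap (lie X Y) = lieBracket ℝ (toMap X) (toMap Y) := by
  have h := mlieBracketWithin_eq_lieBracketWithin (𝕜 := ℝ) (E := EuclideanSpace ℝ (Fin 5))
    (V := toMap X) (W := toMap Y) (s := Set.univ)
  rw [lieBracketWithin_univ] at h
  exact (mlieBracketWithin_univ (I := 𝓡 5) (V := X) (W := Y)).symm.trans h

/-- The horizontal space at `x`: the left translate of `span {A₁, A₂}`. -/
def horizontal (x : CartanGroup) : Submodule ℝ (TangentSpace (𝓡 5) x) :=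
  Submodule.span ℝ (Set.range fun i : Fin 2 => leftField (![0, 1] i) x)

/-- The inner product on `span {A₁, A₂}` with orthonormal basis `A₁, A₂`. -/
def inner₀ : EuclideanSpace ℝ (Fin 5) →ₗ[ℝ] EuclideanSpace ℝ (Fin 5) →ₗ[ℝ] ℝ :=
  LinearMap.mk₂ ℝ (fun u v => u 0 * v 0 + u 1 * v 1)
    (fun u v w => by simp; ring) (fun c u v => by simp; ring)
    (fun u v w => by simp; ring) (fun c u v => by simp; ring)

/-- Left translation of a tangent vector at `x` to the identity. -/
def toIdentity (x : CartanGroup) : TangentSpace (𝓡 5) x →ₗ[ℝ] EuclideanSpace ℝ (Fin 5) :=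
  (mfderiv (𝓡 5) (𝓡 5) (fun z : CartanGroup => x⁻¹ * z) x).toLinearMap

/-- The left-invariant metric on the horizontal bundle. -/
def metric (x : CartanGroup) : horizontal x →ₗ[ℝ] horizontal x →ₗ[ℝ] ℝ :=
  (inner₀.compl₁₂ (toIdentity x) (toIdentity x)).domRestrict₁₂ (horizontal x) (horizontal x)

theorem metric_apply (x : CartanGroup) (u v : horizontal x) :
    metric x u v = inner₀ u.1 v.1 := by
  have h : ∀ u : TangentSpace (𝓡 5) x, toIdentity x u = dLeft (x⁻¹ : CartanGroup) x u :=
    mfderiv_mul_left x⁻¹ x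
  have h' : metric x u v = inner₀ (toIdentity x u.1) (toIdentity x v.1) := rfl
  rw [h', h, h]
  rfl

theorem mem_horizontal {x : CartanGroup} {u : TangentSpace (𝓡 5) x} (hu : u ∈ horizontal x) :
    ∃ a b : ℝ, u = a • leftField 0 x + b • leftField 1 x := by
  obtain ⟨c, hc⟩ := (Submodule.mem_span_range_iff_exists_fun ℝ).1 hu
  exact ⟨c 0, c 1, by simpa [Fin.sum_univ_two] using hc.symm⟩

theorem inner₀_leftField (x : CartanGroup) (i j : Fin 2) :
    inner₀ (leftField (![0, 1] i) x) (leftField (![0, 1] j) x) = if i = j then 1 else 0 := by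
  have h : ∀ k, leftField k x = toMap (leftField k) x := fun _ => rfl
  rw [h, h, toMap_leftField, toMap_leftField]
  fin_cases i <;> fin_cases j <;> simp [inner₀]

/-- The left-invariant sub-Riemannian structure of the Carnot group. -/
def structure₀ : SubRiemannianStructure 5 CartanGroup where
  E := horizontal
  g := metric
  subbundle x₀ := by
    refine ⟨Set.univ, 2, fun i => leftField (![0, 1] i), isOpen_univ, trivial,
      fun i => smoothOn_iff.2 (contDiff_leftField _).contDiffOn, fun x _ => ⟨?_, rfl⟩⟩
    rw [Fintype.linearIndependent_iff]
    intro c hc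
    have hc' : c 0 • toMap (leftField 0) x + c 1 • toMap (leftField 1) x = 0 :=
      (Fin.sum_univ_two _).symm.trans hc
    rw [toMap_leftField, toMap_leftField] at hc'
    have h0 := congrArg (fun w : EuclideanSpace ℝ (Fin 5) => w 0) hc'
    have h1 := congrArg (fun w : EuclideanSpace ℝ (Fin 5) => w 1) hc'
    intro k
    fin_cases k
    · simpa using h0
    · simpa using h1
  symm x u v := by
    rw [metric_apply, metric_apply]
    change (_ * _ + _ * _ : ℝ) = _ * _ + _ * _
    ring
  pos x u hu := by
    obtain ⟨a, b, hab⟩ := mem_horizontal u.2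
    rw [metric_apply]
    have h : (u.1 : EuclideanSpace ℝ (Fin 5)) =
        a • toMap (leftField 0) x + b • toMap (leftField 1) x := hab
    have hab0 : a ≠ 0 ∨ b ≠ 0 := by
      by_contra! hn
      apply hu
      apply Subtype.ext
      rw [hab, hn.1, hn.2, zero_smul, zero_smul, add_zero]
      rfl
    rw [h, toMap_leftField, toMap_leftField]
    have : 0 < a ^ 2 + b ^ 2 := by
      rcases hab0 with h | h <;> positivity
    simpa [inner₀, sq] using this
  smooth U hU X Y hX hY := by
    have hX' := contDiffOn_euclidean.1 (smoothOn_iff.1 hX)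
    have hY' := contDiffOn_euclidean.1 (smoothOn_iff.1 hY)
    have h : ContDiffOn ℝ ∞ (fun x => toMap (fun x => (X x).1) x 0 * toMap (fun x => (Y x).1) x 0 +
        toMap (fun x => (X x).1) x 1 * toMap (fun x => (Y x).1) x 1) U :=
      ((hX' 0).mul (hY' 0)).add ((hX' 1).mul (hY' 1))
    refine ContMDiffOn.congr (f := fun x => inner₀ (X x).1 (Y x).1) ?_
      fun x _ => metric_apply x _ _
    exact h.contMDiffOn

/-- The left-invariant fields satisfy `[A₁, A₂] = B`, `[A₁, B] = C₁`, `[A₂, B] = C₂`, and `C₁`, `C₂`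
are central. -/
theorem lie_leftField :
    lie (leftField 0) (leftField 1) = leftField 2 ∧
    lie (leftField 0) (leftField 2) = leftField 3 ∧
    lie (leftField 1) (leftField 2) = leftField 4 ∧
    ∀ i, lie (leftField i) (leftField 3) = 0 ∧ lie (leftField i) (leftField 4) = 0 := by
  have d0 : ∀ x v, fderiv ℝ (toMap (leftField 0)) x v = 0 := fun x v =>
    fderiv_of_quadratic (q := 0) (contDiff_leftField 0) fun t => by
      rw [toMap_leftField]; simp
  have d3 : ∀ x v, fderiv ℝ (toMap (leftField 3)) x v = 0 := fun x v =>
    fderiv_of_quadratic (q := 0) (contDiff_leftField 3) fun t => by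
      rw [toMap_leftField]; simp
  have d4 : ∀ x v, fderiv ℝ (toMap (leftField 4)) x v = 0 := fun x v =>
    fderiv_of_quadratic (q := 0) (contDiff_leftField 4) fun t => by
      rw [toMap_leftField]; simp
  have d2 : ∀ x v, fderiv ℝ (toMap (leftField 2)) x v = !₂[0, 0, 0, v 0, v 1] := fun x v =>
    fderiv_of_quadratic (q := 0) (contDiff_leftField 2) fun t => by
      rw [toMap_leftField]
      ext i
      fin_cases i <;> simp
  have d1 : ∀ x v, fderiv ℝ (toMap (leftField 1)) x v =
      !₂[0, 0, v 0, x 0 * v 0, x 0 * v 1 + x 1 * v 0] := fun x v =>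
    fderiv_of_quadratic (q := !₂[0, 0, 0, v 0 ^ 2 / 2, v 0 * v 1]) (contDiff_leftField 1)
      fun t => by
        rw [toMap_leftField]
        ext i
        fin_cases i <;> simp <;> ring
  have key : ∀ X Y W : VField 5 CartanGroup,
      (∀ x, fderiv ℝ (toMap Y) x (toMap X x) - fderiv ℝ (toMap X) x (toMap Y x) = toMap W x) →
      lie X Y = W := fun X Y W h => (lie_eq X Y).trans (funext h)
  refine ⟨key _ _ _ fun x => ?_, key _ _ _ fun x => ?_, key _ _ _ fun x => ?_, fun i =>
    ⟨key _ _ _ fun x => ?_, key _ _ _ fun x => ?_⟩⟩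
  · rw [d0, d1]
    simp only [toMap_leftField]
    ext i
    fin_cases i <;> simp
  · rw [d0, d2]
    simp only [toMap_leftField]
    ext i
    fin_cases i <;> simp
  · rw [d1, d2]
    simp only [toMap_leftField]
    ext i
    fin_cases i <;> simp
  · rw [d3, zero_sub]
    refine neg_eq_zero.2 ?_
    fin_cases i <;> simp only [Fin.mk_zero, Fin.mk_one, Fin.reduceFinMk, d0, d1, d2, d3, d4] <;>
      rw [toMap_leftField] <;> ext i <;> fin_cases i <;> simp
  · rw [d4, zero_sub]
    refine neg_eq_zero.2 ?_
    fin_cases i <;> simp only [Fin.mk_zero, Fin.mk_one, Fin.reduceFinMk, d0, d1, d2, d3, d4] <;>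
      rw [toMap_leftField] <;> ext i <;> fin_cases i <;> simp

end CartanGroup

end SubRiem

end

/-! The fields `Z`, `Y₁`, `Y₂` are characterised by brackets modulo `E`, as recorded in
`IsAdaptedOn`: `[X₁, X₂] = Z`, `[X_i, Z] = Y_i`, while `[X_i, Y_j]` has no `Z`-component and `Y ↦
[X_i, Y]` has trace zero. The traces `a_i` and the long coefficients in the definition of `Y_j` are
exactly what enforces the last two conditions (`isAdaptedOn_fieldZ_fieldY`). The conditions leave no
freedom once `X₁, X₂` are given (`IsAdaptedOn.unique`). Under a change `X' = O X` with `O`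
orthogonal they are met by `det O · Z` and `det O · O Y` (`IsAdaptedOn.rotate`). The adapted frame
therefore changes by an orthogonal block matrix, which gives the independence in (a).

For (b), parallelism and `∇Z = 0` make every Christoffel matrix block diagonal, and the remaining
rules put one and the same skew `2 × 2` matrix on `E` and on `span {Y₁, Y₂}`. The connection is thus
encoded by a single one-form `ω` (`connForm`), with `∇X₁ = ω X₂`, `∇X₂ = -ω X₁`, and likewise for
`Y₁, Y₂`. Existence and uniqueness are then a comparison of Christoffel symbols.

For (c), suppose that `∇` is flat with the model torsion. Rotations of the plane commute, so the
curvature is `dω`; hence locally `ω = dθ`, and rotating the adapted frame by `θ` makes it parallel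
(`nabla_rotFrame`). In a parallel frame the bracket is minus the torsion, so the rotated frame has
the constant bracket relations of the Carnot group. Such a frame is locally the left-invariant one.
The equations that say so form a triangular system for the five coordinates, solved by repeated use
of the Poincaré lemma (`IsCartanOn.exists_coordinates`), and the inverse function theorem turns the
coordinates into a diffeomorphism (`IsCartanOn.exists_isDiffeo`). It maps an orthonormal frame of
`E` to an orthonormal frame, so it is an isometry.

Conversely, an isometry pulls the left-invariant frame back to a frame that satisfies the Carnot
relations, hence is adapted, hence by uniqueness is the adapted frame rotated by some `O`
(`exists_isCartanOn_rotFrame`). Computing `ω` from the structure constants shows that `O` solves the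
equation of parallel transport (`dir_eq_connFormOn_mul`). The pulled-back frame is therefore
parallel, which forces zero curvature, and its torsion is minus its brackets. -/

noncomputable section

namespace SubRiem

open Filter Topology

set_option linter.unusedSectionVars false

/-! ### Instances on the manifold and its tangent spaces -/

section Instances

variable {M : Type*} [TopologicalSpace M] [ChartedSpace (EuclideanSpace ℝ (Fin 5)) M]

/-- Bracket lemmas express their regularity through `minSmoothness`, which over `ℝ` is the order
itself. As local instances, this fact and the next ones are found by inference. -/
theorem isManifold_minSmoothness_two [IsManifold (𝓡 5) ∞ M] :
    IsManifold (𝓡 5) (minSmoothness ℝ 2) M := by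
  simpa using (inferInstance : IsManifold (𝓡 5) 2 M)

theorem isManifold_minSmoothness_three [IsManifold (𝓡 5) ∞ M] :
    IsManifold (𝓡 5) (minSmoothness ℝ 3) M := by
  simpa using (inferInstance : IsManifold (𝓡 5) 3 M)

theorem finiteDimensional_tangentSpace (x : M) : FiniteDimensional ℝ (TangentSpace (𝓡 5) x) :=
  inferInstanceAs (FiniteDimensional ℝ (EuclideanSpace ℝ (Fin 5)))

theorem t2Space_tangentSpace (x : M) : T2Space (TangentSpace (𝓡 5) x) :=
  inferInstanceAs (T2Space (EuclideanSpace ℝ (Fin 5)))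

end Instances

attribute [local instance] isManifold_minSmoothness_two isManifold_minSmoothness_three
  finiteDimensional_tangentSpace t2Space_tangentSpace

/-! ### Calculus of smooth functions, vector fields and Lie brackets -/

section Calculus

variable {M : Type*} [TopologicalSpace M] [ChartedSpace (EuclideanSpace ℝ (Fin 5)) M]
  [IsManifold (𝓡 5) ∞ M]

/-- The function `f` is smooth on `U`. -/
abbrev SmoothFun (f : M → ℝ) (U : Set M) : Prop := ContMDiffOn (𝓡 5) 𝓘(ℝ, ℝ) ∞ f U

variable {X Y W X' Y' : VField 5 M} {f g : M → ℝ} {U V : Set M} {x : M}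

namespace SmoothFun

theorem contMDiffAt (hf : SmoothFun f U) (hU : IsOpen U) (hx : x ∈ U) :
    ContMDiffAt (𝓡 5) 𝓘(ℝ, ℝ) ∞ f x :=
  ContMDiffOn.contMDiffAt hf (hU.mem_nhds hx)

theorem mdiffAt (hf : SmoothFun f U) (hU : IsOpen U) (hx : x ∈ U) :
    MDifferentiableAt (𝓡 5) 𝓘(ℝ, ℝ) f x :=
  (hf.contMDiffAt hU hx).mdifferentiableAt (by simp)

theorem add (hf : SmoothFun f U) (hg : SmoothFun g U) : SmoothFun (fun y => f y + g y) U :=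
  ContMDiffOn.add hf hg

theorem sub (hf : SmoothFun f U) (hg : SmoothFun g U) : SmoothFun (fun y => f y - g y) U :=
  ContMDiffOn.sub hf hg

theorem neg (hf : SmoothFun f U) : SmoothFun (fun y => - f y) U :=
  ContMDiffOn.neg hf

theorem mul (hf : SmoothFun f U) (hg : SmoothFun g U) : SmoothFun (fun y => f y * g y) U :=
  ContMDiffOn.mul hf hg

theorem const (c : ℝ) : SmoothFun (fun _ : M => c) U := contMDiffOn_const

theorem sum {ι : Type*} {s : Finset ι} {F : ι → M → ℝ} (h : ∀ i, SmoothFun (F i) U) :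
    SmoothFun (fun y => ∑ i ∈ s, F i y) U :=
  contMDiffOn_finsetSum fun i _ => h i

end SmoothFun

namespace SmoothOn

theorem contMDiffAt (hX : SmoothOn X U) (hU : IsOpen U) (hx : x ∈ U) :
    ContMDiffAt (𝓡 5) (𝓡 5).tangent ∞ (fun x => (⟨x, X x⟩ : TangentBundle (𝓡 5) M)) x :=
  ContMDiffOn.contMDiffAt hX (hU.mem_nhds hx)

theorem mdiffAt (hX : SmoothOn X U) (hU : IsOpen U) (hx : x ∈ U) :
    MDifferentiableAt (𝓡 5) (𝓡 5).tangent (fun x => (⟨x, X x⟩ : TangentBundle (𝓡 5) M)) x :=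
  (hX.contMDiffAt hU hx).mdifferentiableAt (by simp)

theorem mono (hX : SmoothOn X U) (h : V ⊆ U) : SmoothOn X V := ContMDiffOn.mono hX h

theorem congr (hX : SmoothOn X U) (h : ∀ y ∈ U, Y y = X y) : SmoothOn Y U :=
  ContMDiffOn.congr hX fun y hy => by rw [h y hy]

theorem add (hX : SmoothOn X U) (hY : SmoothOn Y U) : SmoothOn (X + Y) U :=
  ContMDiffOn.add_section hX hY

theorem sub (hX : SmoothOn X U) (hY : SmoothOn Y U) : SmoothOn (X - Y) U :=
  ContMDiffOn.sub_section hX hY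

theorem smul (hf : SmoothFun f U) (hX : SmoothOn X U) : SmoothOn (f • X) U :=
  ContMDiffOn.smul_section hf hX

theorem sum {ι : Type*} {s : Finset ι} {F : ι → VField 5 M} (h : ∀ i, SmoothOn (F i) U) :
    SmoothOn (fun y => ∑ i ∈ s, F i y) U :=
  ContMDiffOn.sum_section fun i _ => h i

theorem lie (hU : IsOpen U) (hX : SmoothOn X U) (hY : SmoothOn Y U) : SmoothOn (lie X Y) U :=
  fun x hx =>
    haveI : IsManifold (𝓡 5) (((⊤ : ℕ∞) : WithTop ℕ∞) + 1) M := by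
      simpa using (inferInstance : IsManifold (𝓡 5) ∞ M)
    (ContMDiffAt.mlieBracket_vectorField (n := ⊤) (m := ⊤) (hX.contMDiffAt hU hx)
      (hY.contMDiffAt hU hx) (by simp)).contMDiffWithinAt

end SmoothOn

theorem SmoothFun.dir (hU : IsOpen U) (hX : SmoothOn X U) (hf : SmoothFun f U) :
    SmoothFun (dir X f) U := by
  intro x hx
  -- The derivative along the field is the fibre component of the tangent map of `f` composed with
  -- the section `X`.
  have h1 := ContMDiffOn.contMDiffOn_tangentMapWithin (m := ∞) hf (by simp) hU.uniqueMDiffOn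
  have h2 : ContMDiffOn (𝓡 5) 𝓘(ℝ, ℝ).tangent ∞
      (fun x => tangentMapWithin (𝓡 5) 𝓘(ℝ, ℝ) f U ⟨x, X x⟩) U :=
    h1.comp hX fun y hy => hy
  have h3 := (contMDiff_snd_tangentBundle_modelSpace (n := ∞) ℝ 𝓘(ℝ, ℝ)).comp_contMDiffOn h2
  refine (h3.congr fun y hy => ?_) x hx
  change _ = mfderivWithin (𝓡 5) 𝓘(ℝ, ℝ) f U y (X y)
  rw [mfderivWithin_of_isOpen hU hy]
  rfl

section Dir

theorem dir_add (hf : MDifferentiableAt (𝓡 5) 𝓘(ℝ, ℝ) f x)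
    (hg : MDifferentiableAt (𝓡 5) 𝓘(ℝ, ℝ) g x) :
    dir X (fun y => f y + g y) x = dir X f x + dir X g x := by
  have h := mvfderiv_add hf hg
  exact congrArg (fun L => L (X x)) h

theorem dir_neg : dir X (fun y => - f y) x = - dir X f x := by
  have h := mvfderiv_neg (I := 𝓡 5) (g := f) (x := x)
  exact congrArg (fun L => L (X x)) h

theorem dir_mul (hf : MDifferentiableAt (𝓡 5) 𝓘(ℝ, ℝ) f x)
    (hg : MDifferentiableAt (𝓡 5) 𝓘(ℝ, ℝ) g x) :
    dir X (fun y => f y * g y) x = f x * dir X g x + dir X f x * g x := by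
  have h := congrArg (fun L => L (X x)) (mvfderiv_mul hf hg)
  refine h.trans ?_
  simp [dir]
  ring

theorem dir_const (c : ℝ) : dir X (fun _ => c) x = 0 := by
  have h := congrArg (fun L => L (X x)) (mvfderiv_const (I := 𝓡 5) c (x := x))
  exact h

theorem dir_sum {ι : Type*} {s : Finset ι} {F : ι → M → ℝ}
    (h : ∀ i, MDifferentiableAt (𝓡 5) 𝓘(ℝ, ℝ) (F i) x) :
    dir X (fun y => ∑ i ∈ s, F i y) x = ∑ i ∈ s, dir X (F i) x := by
  classical
  have key : MDifferentiableAt (𝓡 5) 𝓘(ℝ, ℝ) (fun y => ∑ i ∈ s, F i y) x ∧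
      dir X (fun y => ∑ i ∈ s, F i y) x = ∑ i ∈ s, dir X (F i) x := by
    induction s using Finset.induction_on with
    | empty => simpa using ⟨mdifferentiableAt_const, dir_const 0⟩
    | insert a s ha ih =>
      simp only [Finset.sum_insert ha]
      exact ⟨(h a).add ih.1, by rw [dir_add (h a) ih.1, ih.2]⟩
  exact key.2

theorem dir_congr (h : f =ᶠ[𝓝 x] g) : dir X f x = dir X g x := by
  have : mfderiv (𝓡 5) 𝓘(ℝ, ℝ) f x = mfderiv (𝓡 5) 𝓘(ℝ, ℝ) g x := h.mfderiv_eq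
  unfold dir mvfderiv
  rw [this]
  rw [h.eq_of_nhds]

theorem dir_congr_of_eqOn (hU : IsOpen U) (hx : x ∈ U) (h : ∀ y ∈ U, f y = g y) :
    dir X f x = dir X g x :=
  dir_congr (eventually_of_mem (hU.mem_nhds hx) h)

theorem dir_eq_zero_of_eqOn_const (hU : IsOpen U) (hx : x ∈ U) {c : ℝ} (h : ∀ y ∈ U, f y = c) :
    dir X f x = 0 :=
  (dir_congr_of_eqOn hU hx h).trans (dir_const c)

theorem dir_field_congr (h : X x = Y x) : dir X f x = dir Y f x := by simp [dir, h]

end Dir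

section Lie

theorem lie_congr (hX : X =ᶠ[𝓝 x] X') (hY : Y =ᶠ[𝓝 x] Y') : lie X Y x = lie X' Y' x :=
  hX.mlieBracket_vectorField_eq hY

theorem lie_congr_of_eqOn (hU : IsOpen U) (hx : x ∈ U) (hX : ∀ y ∈ U, X y = X' y)
    (hY : ∀ y ∈ U, Y y = Y' y) : lie X Y x = lie X' Y' x :=
  lie_congr (eventually_of_mem (hU.mem_nhds hx) hX) (eventually_of_mem (hU.mem_nhds hx) hY)

theorem lie_smul_right (hf : MDifferentiableAt (𝓡 5) 𝓘(ℝ, ℝ) f x)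
    (hY : MDifferentiableAt (𝓡 5) (𝓡 5).tangent
      (fun x => (⟨x, Y x⟩ : TangentBundle (𝓡 5) M)) x) :
    lie X (f • Y) x = dir X f x • Y x + f x • lie X Y x :=
  mlieBracket_smul_right hf hY

theorem lie_swap : lie X Y x = - lie Y X x := mlieBracket_swap_apply

theorem lie_add_right (hY : SmoothOn Y U) (hW : SmoothOn W U) (hU : IsOpen U) (hx : x ∈ U) :
    lie X (Y + W) x = lie X Y x + lie X W x :=
  mlieBracket_add_right (hY.mdiffAt hU hx) (hW.mdiffAt hU hx)

theorem lie_sum_right {ι : Type*} {s : Finset ι} {F : ι → VField 5 M} (hU : IsOpen U) (hx : x ∈ U)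
    (h : ∀ i, SmoothOn (F i) U) :
    lie X (fun y => ∑ i ∈ s, F i y) x = ∑ i ∈ s, lie X (F i) x := by
  classical
  induction s using Finset.induction_on with
  | empty =>
    have : (fun y => ∑ i ∈ (∅ : Finset ι), F i y) = (0 : VField 5 M) := by ext y; simp
    rw [this]
    simp [lie]
  | insert a s ha ih =>
    have : (fun y => ∑ i ∈ insert a s, F i y) = F a + fun y => ∑ i ∈ s, F i y := by
      ext y
      simp [Finset.sum_insert ha]
    rw [this, lie_add_right (h a) (SmoothOn.sum h) hU hx, ih, Finset.sum_insert ha]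

/-- `[X, ∑ b_j G_j] = ∑ (X(b_j) G_j + b_j [X, G_j])`. -/
theorem lie_comb_right {ι : Type*} {s : Finset ι} {G : ι → VField 5 M} {b : ι → M → ℝ}
    (hU : IsOpen U) (hx : x ∈ U) (hb : ∀ j, SmoothFun (b j) U) (hG : ∀ j, SmoothOn (G j) U) :
    lie X (fun y => ∑ j ∈ s, b j y • G j y) x =
      ∑ j ∈ s, (dir X (b j) x • G j x + b j x • lie X (G j) x) := by
  refine (lie_sum_right (F := fun j => b j • G j) hU hx fun j => (hG j).smul (hb j)).trans ?_
  exact Finset.sum_congr rfl fun j _ => lie_smul_right ((hb j).mdiffAt hU hx) ((hG j).mdiffAt hU hx)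

/-- `[∑ a_i F_i, Y] = ∑ (a_i [F_i, Y] - Y(a_i) F_i)`. -/
theorem lie_comb_left {ι : Type*} {s : Finset ι} {F : ι → VField 5 M} {a : ι → M → ℝ}
    (hU : IsOpen U) (hx : x ∈ U) (ha : ∀ j, SmoothFun (a j) U) (hF : ∀ j, SmoothOn (F j) U) :
    lie (fun y => ∑ j ∈ s, a j y • F j y) Y x =
      ∑ j ∈ s, (a j x • lie (F j) Y x - dir Y (a j) x • F j x) := by
  rw [lie_swap, lie_comb_right hU hx ha hF, ← Finset.sum_neg_distrib]
  refine Finset.sum_congr rfl fun j _ => ?_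
  rw [lie_swap (X := Y)]
  module

/-- Follows from the Jacobi identity for `X`, `Y`, `f • W`. Expanding by the Leibniz rule and
removing `f` times the identity for `W`, the mixed terms cancel and only a multiple of `W` remains.
Its coefficient must vanish wherever `W` does not, so `W` is only a test field. -/
theorem dir_lie (hU : IsOpen U) (hx : x ∈ U) (hX : SmoothOn X U) (hY : SmoothOn Y U)
    (hW : SmoothOn W U) (hW0 : W x ≠ 0) (hf : SmoothFun f U) :
    dir (lie X Y) f x = dir X (dir Y f) x - dir Y (dir X f) x := by
  have e : ∀ {A : VField 5 M}, SmoothOn A U → ContMDiffAt (𝓡 5) (𝓡 5).tangent (minSmoothness ℝ 2)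
      (fun x => (⟨x, A x⟩ : TangentBundle (𝓡 5) M)) x := fun hA =>
    (hA.contMDiffAt hU hx).of_le (by simpa using ENat.LEInfty.out)
  have sm : ∀ {A B : VField 5 M}, SmoothOn A U → SmoothOn B U →
      SmoothOn (mlieBracket (𝓡 5) A B) U := fun hA hB => SmoothOn.lie hU hA hB
  have jac := leibniz_identity_mlieBracket_apply (e hX) (e hY) (e (hW.smul hf))
  have jac0 := leibniz_identity_mlieBracket_apply (e hX) (e hY) (e hW)
  have h1 : ∀ {A : VField 5 M}, ∀ y ∈ U,
      lie A (f • W) y = (dir A f • W + f • lie A W) y := fun y hy =>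
    lie_smul_right (hf.mdiffAt hU hy) (hW.mdiffAt hU hy)
  have h2 : ∀ {A B : VField 5 M}, SmoothOn A U → SmoothOn B U → lie A (lie B (f • W)) x =
      dir A (dir B f) x • W x + dir B f x • lie A W x +
        (dir A f x • lie B W x + f x • lie A (lie B W) x) := by
    intro A B hA hB
    rw [lie_congr_of_eqOn hU hx (fun _ _ => rfl) h1,
      lie_add_right (hW.smul (SmoothFun.dir hU hB hf)) ((sm hB hW).smul hf) hU hx,
      lie_smul_right ((SmoothFun.dir hU hB hf).mdiffAt hU hx) (hW.mdiffAt hU hx),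
      lie_smul_right (hf.mdiffAt hU hx) ((sm hB hW).mdiffAt hU hx)]
  have h3 := h1 (A := lie X Y) x hx
  simp only [Pi.add_apply, Pi.smul_apply'] at h3
  change lie X (lie Y (f • W)) x = lie (lie X Y) (f • W) x + lie Y (lie X (f • W)) x at jac
  change lie X (lie Y W) x = lie (lie X Y) W x + lie Y (lie X W) x at jac0
  rw [h2 hX hY, h2 hY hX, h3, jac0] at jac
  have : (dir (lie X Y) f x - (dir X (dir Y f) x - dir Y (dir X f) x)) • W x = 0 := by
    rw [← sub_eq_zero] at jac
    rw [← neg_eq_zero, ← jac]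
    module
  exact sub_eq_zero.1 ((smul_eq_zero.1 this).resolve_right hW0)

end Lie

end Calculus

/-! ### Coefficients and brackets in a smooth frame -/

section Frames

variable {M : Type*} [TopologicalSpace M] [ChartedSpace (EuclideanSpace ℝ (Fin 5)) M]
  [IsManifold (𝓡 5) ∞ M]

section CoeffLinear

variable {ι : Type*} (F : ι → VField 5 M) (x : M) (u v : TangentSpace (𝓡 5) x) (k : ι)

/-- Linearity needs no frame hypothesis: where `F` is not a basis, the default value is the zero
functional. -/
theorem coeff_add : coeff F x (u + v) k = coeff F x u k + coeff F x v k := by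
  unfold coeff; split_ifs <;> simp only [map_add, Finsupp.add_apply, add_zero]

theorem coeff_smul (c : ℝ) : coeff F x (c • u) k = c * coeff F x u k := by
  unfold coeff; split_ifs <;> simp

theorem coeff_neg : coeff F x (-u) k = - coeff F x u k := by
  unfold coeff; split_ifs <;> simp only [map_neg, Finsupp.neg_apply, neg_zero]

theorem coeff_sub : coeff F x (u - v) k = coeff F x u k - coeff F x v k := by
  unfold coeff; split_ifs <;> simp only [map_sub, Finsupp.sub_apply, sub_zero]

theorem coeff_zero : coeff F x 0 k = 0 := by
  unfold coeff; split_ifs <;> simp only [map_zero, Finsupp.zero_apply]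

theorem coeff_sum {κ : Type*} (s : Finset κ) (w : κ → TangentSpace (𝓡 5) x) :
    coeff F x (∑ i ∈ s, w i) k = ∑ i ∈ s, coeff F x (w i) k := by
  unfold coeff; split_ifs <;> simp [map_sum]

/-- `coeff` as a linear functional. -/
def coeffHom : TangentSpace (𝓡 5) x →L[ℝ] ℝ :=
  LinearMap.toContinuousLinearMap
  { toFun := fun u => coeff F x u k
    map_add' := fun u v => coeff_add F x u v k
    map_smul' := fun c u => coeff_smul F x u k c }

@[simp] theorem coeffHom_apply : coeffHom F x k u = coeff F x u k := rfl

end CoeffLinear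

/-- A smooth frame of the tangent bundle on `U`. -/
abbrev SmoothFrame (F : Fin 5 → VField 5 M) (U : Set M) : Prop :=
  IsLocalFrameOn (𝓡 5) (EuclideanSpace ℝ (Fin 5)) ∞ F U

variable {F : Fin 5 → VField 5 M} {V W : VField 5 M} {U : Set M} {x : M}

namespace SmoothFrame

theorem smooth (hF : SmoothFrame F U) (i : Fin 5) : SmoothOn (F i) U := hF.contMDiffOn i

theorem of_linearIndependent (hs : ∀ i, SmoothOn (F i) U)
    (hl : ∀ x ∈ U, LinearIndependent ℝ (fun i => F i x)) : SmoothFrame F U where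
  linearIndependent hx := hl _ hx
  generating {x} hx := by
    have h : Module.finrank ℝ (TangentSpace (𝓡 5) x) = 5 :=
      finrank_euclideanSpace_fin (𝕜 := ℝ) (n := 5)
    exact ((hl x hx).span_eq_top_of_card_eq_finrank' (by rw [h]; rfl)).ge
  contMDiffOn := hs

theorem of_span (hs : ∀ i, SmoothOn (F i) U)
    (hl : ∀ x ∈ U, ⊤ ≤ Submodule.span ℝ (Set.range fun i => F i x)) : SmoothFrame F U where
  linearIndependent {x} hx := by
    have h : Module.finrank ℝ (TangentSpace (𝓡 5) x) = 5 :=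
      finrank_euclideanSpace_fin (𝕜 := ℝ) (n := 5)
    exact linearIndependent_of_top_le_span_of_card_eq_finrank (hl x hx) (by rw [h]; rfl)
  generating {x} hx := hl x hx
  contMDiffOn := hs

theorem coeff_eq (hF : SmoothFrame F U) (hx : x ∈ U) (v : TangentSpace (𝓡 5) x) (k : Fin 5) :
    coeff F x v k = (hF.toBasisAt hx).repr v k := by
  unfold coeff
  rw [dif_pos ⟨hF.linearIndependent hx, hF.generating hx⟩]
  rfl

theorem coeff_frame (hF : SmoothFrame F U) (hx : x ∈ U) (i k : Fin 5) :
    coeff F x (F i x) k = if i = k then 1 else 0 := by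
  rw [coeff_eq hF hx]
  have : F i x = hF.toBasisAt hx i := by simp
  rw [this, Module.Basis.repr_self, Finsupp.single_apply]

theorem sum_coeff (hF : SmoothFrame F U) (hx : x ∈ U) (v : TangentSpace (𝓡 5) x) :
    ∑ k, coeff F x v k • F k x = v := by
  have := (hF.toBasisAt hx).sum_repr v
  simpa [coeff_eq hF hx] using this

theorem coeff_comb (hF : SmoothFrame F U) (hx : x ∈ U) (c : Fin 5 → ℝ) (k : Fin 5) :
    coeff F x (∑ i, c i • F i x) k = c k := by
  rw [coeff_sum]
  simp [coeff_smul, coeff_frame hF hx]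

theorem ext_coeff (hF : SmoothFrame F U) (hx : x ∈ U) {u v : TangentSpace (𝓡 5) x}
    (h : ∀ k, coeff F x u k = coeff F x v k) : u = v := by
  rw [← sum_coeff hF hx u, ← sum_coeff hF hx v]
  simp [h]

theorem ne_zero (hF : SmoothFrame F U) (hx : x ∈ U) (i : Fin 5) : F i x ≠ 0 :=
  (hF.linearIndependent hx).ne_zero i

/-- In a trivialization, the coefficients in a smooth frame are given by a smooth family of linear
functionals. -/
theorem exists_contMDiffAt_coeff (hF : SmoothFrame F U) (hU : IsOpen U) (hx : x ∈ U) :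
    ∃ ℓ : M → EuclideanSpace ℝ (Fin 5) →L[ℝ] (Fin 5 → ℝ),
      ContMDiffAt (𝓡 5) 𝓘(ℝ, EuclideanSpace ℝ (Fin 5) →L[ℝ] (Fin 5 → ℝ)) ∞ ℓ x ∧
      ∀ᶠ y in 𝓝 x, ∀ v : TangentSpace (𝓡 5) y, ∀ k, coeff F y v k =
        ℓ y (trivializationAt (EuclideanSpace ℝ (Fin 5)) (TangentSpace (𝓡 5) (M := M)) x
          ⟨y, v⟩).2 k := by
  set e := trivializationAt (EuclideanSpace ℝ (Fin 5)) (TangentSpace (𝓡 5) (M := M)) x with he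
  -- `L y` is the frame at `y` read in the trivialization, as the map sending coefficients to the
  -- vector. Its inverse gives the coefficient functionals.
  let L : M → (Fin 5 → ℝ) →L[ℝ] EuclideanSpace ℝ (Fin 5) := fun y =>
    ∑ i, (ContinuousLinearMap.proj (R := ℝ) (φ := fun _ : Fin 5 => ℝ) i).smulRight
      (e ⟨y, F i y⟩).2
  have hL : ContMDiffAt (𝓡 5) 𝓘(ℝ, (Fin 5 → ℝ) →L[ℝ] EuclideanSpace ℝ (Fin 5)) ∞ L x := by
    refine contMDiffAt_finsetSum fun i _ => ?_
    have h := (Bundle.contMDiffAt_section x).1 ((hF.smooth i).contMDiffAt hU hx)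
    exact (((ContinuousLinearMap.smulRightL ℝ (Fin 5 → ℝ) (EuclideanSpace ℝ (Fin 5)))
      (ContinuousLinearMap.proj (R := ℝ) (φ := fun _ : Fin 5 => ℝ) i)).contMDiff).contMDiffAt.comp
        x h
  have hbase : ∀ᶠ y in 𝓝 x, y ∈ e.baseSet :=
    e.open_baseSet.mem_nhds (FiberBundle.mem_baseSet_trivializationAt' x)
  have key : ∀ y ∈ U, y ∈ e.baseSet → ∃ A : (Fin 5 → ℝ) ≃L[ℝ] EuclideanSpace ℝ (Fin 5),
      (A : (Fin 5 → ℝ) →L[ℝ] EuclideanSpace ℝ (Fin 5)) = L y ∧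
      ∀ v : TangentSpace (𝓡 5) y, ∀ k, coeff F y v k = A.symm (e ⟨y, v⟩).2 k := by
    intro y hy hye
    let A : (Fin 5 → ℝ) ≃ₗ[ℝ] EuclideanSpace ℝ (Fin 5) :=
      (hF.toBasisAt hy).equivFun.symm.trans (e.linearEquivAt ℝ y hye)
    refine ⟨A.toContinuousLinearEquiv, ?_, ?_⟩
    · ext1 c
      have : A c = L y c := by
        simp only [A, L, LinearEquiv.trans_apply, Module.Basis.equivFun_symm_apply, map_sum,
          map_smul, _root_.sum_apply, ContinuousLinearMap.smulRight_apply,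
          ContinuousLinearMap.proj_apply]
        simp
      exact this
    · intro v k
      have : A.symm (e ⟨y, v⟩).2 = (hF.toBasisAt hy).equivFun v := by
        rw [LinearEquiv.symm_apply_eq, LinearEquiv.trans_apply, LinearEquiv.symm_apply_apply]
        rfl
      rw [coeff_eq hF hy]
      exact (congrFun this k).symm
  -- Inversion of operators is smooth at an invertible one, so `ℓ` is smooth at `x`. Near `x` the
  -- operator `L y` is invertible and the default value of `inverse` plays no role.
  refine ⟨fun y => (L y).inverse, ?_, ?_⟩
  · obtain ⟨A, hA, -⟩ := key x hx (FiberBundle.mem_baseSet_trivializationAt' x)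
    have h : ContDiffAt ℝ ∞ ContinuousLinearMap.inverse (L x) := by
      rw [← hA]
      exact contDiffAt_map_inverse A
    exact h.contMDiffAt.comp x hL
  · filter_upwards [hbase, hU.mem_nhds hx] with y hye hy v k
    obtain ⟨A, hA, h⟩ := key y hy hye
    rw [h, ← hA, ContinuousLinearMap.inverse_equiv]
    rfl

theorem smoothFun_coeff (hF : SmoothFrame F U) (hU : IsOpen U) (hV : SmoothOn V U) (k : Fin 5) :
    SmoothFun (fun y => coeff F y (V y) k) U := by
  intro x hx
  obtain ⟨ℓ, hℓ, h⟩ := exists_contMDiffAt_coeff hF hU hx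
  have h1 := (Bundle.contMDiffAt_section x).1 (hV.contMDiffAt hU hx)
  have h2 := contMDiffAt_pi_space.1 (hℓ.clm_apply h1) k
  refine (h2.congr_of_eventuallyEq ?_).contMDiffWithinAt
  filter_upwards [h] with y hy using hy _ _

/-- The axioms of a covariant derivative quantify over sections that are merely differentiable at
one point, so the smooth version above does not suffice for `isConn_frameConn`. -/
theorem mdiffAt_coeff (hF : SmoothFrame F U) (hU : IsOpen U) (hx : x ∈ U)
    (hV : MDifferentiableAt (𝓡 5) (𝓡 5).tangent (fun x => (⟨x, V x⟩ : TangentBundle (𝓡 5) M)) x)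
    (k : Fin 5) : MDifferentiableAt (𝓡 5) 𝓘(ℝ, ℝ) (fun y => coeff F y (V y) k) x := by
  obtain ⟨ℓ, hℓ, h⟩ := exists_contMDiffAt_coeff hF hU hx
  have h1 := (mdifferentiableAt_section (𝓡 5) V).1 hV
  have h2 := (hℓ.mdifferentiableAt (by simp)).clm_apply h1
  have h3 := ((ContinuousLinearMap.proj (R := ℝ) (φ := fun _ : Fin 5 => ℝ) k).mdifferentiableAt
    ).comp x h2
  refine MDifferentiableAt.congr_of_eventuallyEq h3 ?_
  filter_upwards [h] with y hy using hy _ _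

theorem smoothFun_structConst (hF : SmoothFrame F U) (hU : IsOpen U) (i j k : Fin 5) :
    SmoothFun (structConst F i j k) U :=
  smoothFun_coeff hF hU ((hF.smooth i).lie hU (hF.smooth j)) k

theorem lie_eq_sum (hF : SmoothFrame F U) (hx : x ∈ U) (i j : Fin 5) :
    lie (F i) (F j) x = ∑ k, structConst F i j k x • F k x :=
  (sum_coeff hF hx _).symm

theorem structConst_swap (F : Fin 5 → VField 5 M) (i j k : Fin 5) (x : M) :
    structConst F i j k x = - structConst F j i k x := by
  unfold structConst
  rw [lie_swap, coeff_neg]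

theorem structConst_self (F : Fin 5 → VField 5 M) (i k : Fin 5) (x : M) :
    structConst F i i k x = 0 := by
  have := structConst_swap F i i k x
  linarith

/-- The Lie bracket in a frame. -/
theorem coeff_lie (hF : SmoothFrame F U) (hU : IsOpen U) (hx : x ∈ U) (hV : SmoothOn V U)
    (hW : SmoothOn W U) (k : Fin 5) :
    coeff F x (lie V W x) k = dir V (fun y => coeff F y (W y) k) x
      - dir W (fun y => coeff F y (V y) k) x
      + ∑ i, ∑ j, coeff F x (V x) i * coeff F x (W x) j * structConst F i j k x := by
  have hb := smoothFun_coeff hF hU hW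
  have ha := smoothFun_coeff hF hU hV
  -- The bracket is local, so `W`, and then `V`, may be replaced by its expansion in the frame on
  -- `U`. The derivatives of the two families of coefficients give the first two terms.
  have h1 : lie V W x = ∑ j, (dir V (fun y => coeff F y (W y) j) x • F j x
      + coeff F x (W x) j • lie V (F j) x) := by
    rw [← lie_comb_right hU hx hb hF.smooth]
    exact lie_congr_of_eqOn hU hx (fun _ _ => rfl) fun y hy => (sum_coeff hF hy _).symm
  have h2 : ∀ j, lie V (F j) x = ∑ i, (coeff F x (V x) i • lie (F i) (F j) x
      - dir (F j) (fun y => coeff F y (V y) i) x • F i x) := by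
    intro j
    rw [← lie_comb_left hU hx ha hF.smooth]
    exact lie_congr_of_eqOn hU hx (fun y hy => (sum_coeff hF hy _).symm) fun _ _ => rfl
  have h3 : dir W (fun y => coeff F y (V y) k) x =
      ∑ j, coeff F x (W x) j * dir (F j) (fun y => coeff F y (V y) k) x := by
    rw [dir_field_congr (Y := fun y => ∑ j, coeff F y (W y) j • F j y) (sum_coeff hF hx _).symm]
    simp [dir]
  have h4 : coeff F x (∑ j, dir V (fun y => coeff F y (W y) j) x • F j x) k =
      dir V (fun y => coeff F y (W y) k) x := coeff_comb hF hx _ k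
  have h5 : ∀ j, coeff F x (lie V (F j) x) k =
      ∑ i, coeff F x (V x) i * structConst F i j k x
        - dir (F j) (fun y => coeff F y (V y) k) x := by
    intro j
    rw [h2, Finset.sum_sub_distrib, coeff_sub,
      coeff_comb hF hx (fun i => dir (F j) (fun y => coeff F y (V y) i) x) k, coeff_sum]
    simp [coeff_smul, structConst]
  rw [h1, Finset.sum_add_distrib, coeff_add, h4, coeff_sum]
  simp only [coeff_smul, h5]
  rw [h3, Finset.sum_comm (f := fun i j => coeff F x (V x) i * coeff F x (W x) j * _)]
  simp only [mul_sub, Finset.sum_sub_distrib, Finset.mul_sum]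
  have : ∀ i j, coeff F x (W x) j * (coeff F x (V x) i * structConst F i j k x) =
    coeff F x (V x) i * coeff F x (W x) j * structConst F i j k x := fun i j => by ring
  simp only [this]
  ring

end SmoothFrame

end Frames

/-! ### The bracket frame and the adapted conditions -/

section Frames235

variable {M : Type*} [TopologicalSpace M] [ChartedSpace (EuclideanSpace ℝ (Fin 5)) M]
  [IsManifold (𝓡 5) ∞ M]

variable {S : SubRiemannianStructure 5 M} {X : Fin 2 → VField 5 M} {U : Set M} {x : M}

namespace SubRiemannianStructure

namespace IsOrthonormalFrameOn

theorem mem (hX : S.IsOrthonormalFrameOn X U) (hx : x ∈ U) (i : Fin 2) : X i x ∈ S.E x := by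
  rw [← hX.span_eq x hx]
  exact Submodule.subset_span ⟨i, rfl⟩

/-- Smooth sections of `E` are smooth combinations of the orthonormal frame, the coefficients being
the inner products with the frame. -/
theorem exists_smooth_coeff (hX : S.IsOrthonormalFrameOn X U) (hU : IsOpen U) {V : VField 5 M}
    (hV : SmoothOn V U) (hVE : ∀ y ∈ U, V y ∈ S.E y) :
    ∃ a : Fin 2 → M → ℝ, (∀ i, SmoothFun (a i) U) ∧ (∀ y ∈ U, V y = ∑ i, a i y • X i y) := by
  classical
  have hm := fun y (hy : y ∈ U) i => hX.mem hy i
  -- The smoothness axiom for the metric takes families of elements of `E` over all of `M`, smooth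
  -- on `U`. Extension by zero outside `U` supplies them.
  let Xt : Fin 2 → ∀ y, S.E y := fun i y => if h : y ∈ U then ⟨X i y, hm y h i⟩ else 0
  let Vt : ∀ y, S.E y := fun y => if h : y ∈ U then ⟨V y, hVE y h⟩ else 0
  have hXt : ∀ i, ∀ y ∈ U, ((Xt i y : S.E y) : TangentSpace (𝓡 5) y) = X i y := by
    intro i y hy
    simp [Xt, hy]
  have hVt : ∀ y ∈ U, ((Vt y : S.E y) : TangentSpace (𝓡 5) y) = V y := by
    intro y hy
    simp [Vt, hy]
  have hcomb : ∀ y ∈ U, Vt y = ∑ i, S.g y (Vt y) (Xt i y) • Xt i y := by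
    intro y hy
    have h1 := hVE y hy
    rw [← hX.span_eq y hy] at h1
    obtain ⟨c, hc⟩ := (Submodule.mem_span_range_iff_exists_fun ℝ).1 h1
    have h2 : Vt y = ∑ i, c i • Xt i y := by
      apply Subtype.ext
      rw [hVt y hy, ← hc]
      simp [hXt _ y hy]
    have h3 : ∀ i, S.g y (Vt y) (Xt i y) = c i := by
      intro i
      rw [h2]
      simp only [Fin.sum_univ_two, map_add, map_smul, LinearMap.add_apply, LinearMap.smul_apply,
        hX.orthonormal y hy _ _ _ _ (hXt _ y hy) (hXt _ y hy)]
      fin_cases i <;> simp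
    rw [h2]
    refine Finset.sum_congr rfl fun i _ => ?_
    rw [← h2, h3]
  refine ⟨fun i y => S.g y (Vt y) (Xt i y), fun i => ?_, fun y hy => ?_⟩
  · exact S.smooth U hU Vt (Xt i) (hV.congr hVt) ((hX.smooth i).congr (hXt i))
  · have h := congrArg (Subtype.val : S.E y → TangentSpace (𝓡 5) y) (hcomb y hy)
    rw [hVt y hy] at h
    rw [h]
    simp [hXt _ y hy]

/-- The bracket frame generates the tangent space. -/
theorem smoothFrame_bracketFrame (hX : S.IsOrthonormalFrameOn X U) (hU : IsOpen U)
    (hS : S.HasGrowthVector [2, 3, 5]) : SmoothFrame (bracketFrame X) U := by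
  have s2 : SmoothOn (lie (X 0) (X 1)) U := (hX.smooth 0).lie hU (hX.smooth 1)
  have hs : ∀ i, SmoothOn (bracketFrame X i) U := by
    intro i
    fin_cases i
    · exact hX.smooth 0
    · exact hX.smooth 1
    · exact s2
    · exact (hX.smooth 0).lie hU s2
    · exact (hX.smooth 1).lie hU s2
  refine SmoothFrame.of_span hs fun x hx => ?_
  set P := Submodule.span ℝ (Set.range fun i => bracketFrame X i x) with hP
  have hB : ∀ i, bracketFrame X i x ∈ P := fun i => Submodule.subset_span ⟨i, rfl⟩
  have hor : ∀ V ∈ S.sections, ∃ a : Fin 2 → M → ℝ, (∀ i, SmoothFun (a i) U) ∧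
      ∀ y ∈ U, V y = ∑ i, a i y • X i y := by
    intro V hV
    exact hX.exists_smooth_coeff hU (hV.1.mono (Set.subset_univ _)) fun y _ => hV.2 y
  -- The coefficients are kept as smooth functions on `U`, since one more bracket in `three`
  -- differentiates them.
  have two : ∀ V ∈ S.sections, ∀ W ∈ S.sections, ∃ b : Fin 3 → M → ℝ, (∀ i, SmoothFun (b i) U) ∧
      ∀ y ∈ U, lie V W y = ∑ i, b i y • ![X 0, X 1, lie (X 0) (X 1)] i y := by
    intro V hV W hW
    obtain ⟨a, ha, hVa⟩ := hor V hV
    obtain ⟨b, hb, hWb⟩ := hor W hW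
    have sV : SmoothOn V U := hV.1.mono (Set.subset_univ _)
    have sW : SmoothOn W U := hW.1.mono (Set.subset_univ _)
    -- These are the coefficients of `[∑ a_i X_i, ∑ b_j X_j]`; the last is the determinant of the
    -- two coefficient vectors, since only `[X 0, X 1]` is a new direction.
    refine ⟨![fun y => dir V (b 0) y - dir W (a 0) y, fun y => dir V (b 1) y - dir W (a 1) y,
      fun y => a 0 y * b 1 y - a 1 y * b 0 y], ?_, ?_⟩
    · intro i
      fin_cases i
      · exact (SmoothFun.dir hU sV (hb 0)).sub (SmoothFun.dir hU sW (ha 0))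
      · exact (SmoothFun.dir hU sV (hb 1)).sub (SmoothFun.dir hU sW (ha 1))
      · exact ((ha 0).mul (hb 1)).sub ((ha 1).mul (hb 0))
    · intro y hy
      have e1 : lie V W y = ∑ j, (dir V (b j) y • X j y + b j y • lie V (X j) y) := by
        rw [← lie_comb_right hU hy hb hX.smooth]
        exact lie_congr_of_eqOn hU hy (fun _ _ => rfl) hWb
      have e2 : ∀ j, lie V (X j) y = ∑ i, (a i y • lie (X i) (X j) y
          - dir (X j) (a i) y • X i y) := by
        intro j
        rw [← lie_comb_left hU hy ha hX.smooth]
        exact lie_congr_of_eqOn hU hy hVa fun _ _ => rfl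
      have e3 : ∀ i, dir W (a i) y = b 0 y * dir (X 0) (a i) y + b 1 y * dir (X 1) (a i) y := by
        intro i
        have : W y = b 0 y • X 0 y + b 1 y • X 1 y := by simpa using hWb y hy
        simp [dir, this]
      rw [e1]
      simp only [e2, Fin.sum_univ_two, Fin.sum_univ_three]
      have z0 : lie (X 0) (X 0) y = 0 := by simp [lie]
      have z1 : lie (X 1) (X 1) y = 0 := by simp [lie]
      rw [z0, z1, lie_swap (X := X 1) (Y := X 0)]
      simp [e3]
      module
  have three : ∀ V ∈ S.sections, ∀ W : VField 5 M, (∃ b : Fin 3 → M → ℝ,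
      (∀ i, SmoothFun (b i) U) ∧
      ∀ y ∈ U, W y = ∑ i, b i y • ![X 0, X 1, lie (X 0) (X 1)] i y) → lie V W x ∈ P := by
    rintro V hV W ⟨b, hb, hWb⟩
    obtain ⟨a, ha, hVa⟩ := hor V hV
    have sG : ∀ j, SmoothOn (![X 0, X 1, lie (X 0) (X 1)] j) U := by
      intro j
      fin_cases j
      exacts [hX.smooth 0, hX.smooth 1, s2]
    have e1 : lie V W x = ∑ j, (dir V (b j) x • ![X 0, X 1, lie (X 0) (X 1)] j x
        + b j x • lie V (![X 0, X 1, lie (X 0) (X 1)] j) x) := by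
      rw [← lie_comb_right hU hx hb sG]
      exact lie_congr_of_eqOn hU hx (fun _ _ => rfl) hWb
    have e2 : ∀ j, lie V (![X 0, X 1, lie (X 0) (X 1)] j) x =
        ∑ i, (a i x • lie (X i) (![X 0, X 1, lie (X 0) (X 1)] j) x
          - dir (![X 0, X 1, lie (X 0) (X 1)] j) (a i) x • X i x) := by
      intro j
      rw [← lie_comb_left hU hx ha hX.smooth]
      exact lie_congr_of_eqOn hU hx hVa fun _ _ => rfl
    have mX : ∀ i, X i x ∈ P := by
      intro i
      fin_cases i
      exacts [hB 0, hB 1]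
    have mG : ∀ j, ![X 0, X 1, lie (X 0) (X 1)] j x ∈ P := by
      intro j
      fin_cases j
      exacts [hB 0, hB 1, hB 2]
    have mL : ∀ i j, lie (X i) (![X 0, X 1, lie (X 0) (X 1)] j) x ∈ P := by
      intro i j
      fin_cases i <;> fin_cases j
      · simp [lie]
      · exact hB 2
      · exact hB 3
      · change lie (X 1) (X 0) x ∈ P
        rw [lie_swap]
        exact P.neg_mem (hB 2)
      · simp [lie]
      · exact hB 4
    rw [e1]
    refine P.sum_mem fun j _ => P.add_mem (P.smul_mem _ (mG j)) (P.smul_mem _ ?_)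
    rw [e2]
    exact P.sum_mem fun i _ => P.sub_mem (P.smul_mem _ (mL i j)) (P.smul_mem _ (mX i))
  -- From the growth vector only `E^{-3} = TM` is used: every bracket of at most three sections lies
  -- in the span `P` of five vectors, so these span the tangent space and are a basis.
  have htop : S.flag 3 x = ⊤ := (hS x).2.1
  rw [← htop]
  refine Submodule.span_le.2 ?_
  rintro v ⟨j, hj, W, hW, rfl⟩
  interval_cases j
  · obtain rfl : W = 0 := hW
    exact P.zero_mem
  · obtain ⟨a, -, ha⟩ := hor W hW
    have : W x = a 0 x • X 0 x + a 1 x • X 1 x := by simpa using ha x hx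
    rw [this]
    exact P.add_mem (P.smul_mem _ (hB 0)) (P.smul_mem _ (hB 1))
  · obtain ⟨V, hV, W', hW', rfl⟩ := hW
    obtain ⟨b, -, hb⟩ := two V hV W' hW'
    rw [SetLike.mem_coe, hb x hx]
    refine P.sum_mem fun j _ => P.smul_mem _ ?_
    fin_cases j
    exacts [hB 0, hB 1, hB 2]
  · obtain ⟨V, hV, W', ⟨V', hV', W'', hW'', rfl⟩, rfl⟩ := hW
    exact three V hV _ (two V' hV' W'' hW'')

end IsOrthonormalFrameOn

end SubRiemannianStructure

/-- The conditions on a frame `X₁, X₂, Z, Y₁, Y₂`, with `X₁, X₂` spanning `E`, that characterise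
`Z` and `Y₁, Y₂`: modulo `E` one has `[X₁, X₂] = Z`, `[X_i, Z] = Y_i`, while `[X_i, Y_j]` has no
`Z`-component and `Y ↦ [X_i, Y]` is trace-free on `span {Y₁, Y₂}`. -/
structure IsAdaptedOn (E : ∀ x : M, Submodule ℝ (TangentSpace (𝓡 5) x)) (X : Fin 2 → VField 5 M)
    (Z : VField 5 M) (Y : Fin 2 → VField 5 M) (U : Set M) : Prop where
  frame : SmoothFrame ![X 0, X 1, Z, Y 0, Y 1] U
  span_eq : ∀ x ∈ U, Submodule.span ℝ (Set.range fun i => X i x) = E x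
  X_X : ∀ x ∈ U, (E x).mkQ (lie (X 0) (X 1) x) = (E x).mkQ (Z x)
  X_Z : ∀ x ∈ U, ∀ i, (E x).mkQ (lie (X i) Z x) = (E x).mkQ (Y i x)
  X_Y : ∀ x ∈ U, ∀ i, ∃ A : Fin 2 → Fin 2 → ℝ,
    (∀ j, (E x).mkQ (lie (X i) (Y j) x) = A j 0 • (E x).mkQ (Y 0 x) + A j 1 • (E x).mkQ (Y 1 x)) ∧
      A 0 0 + A 1 1 = 0

end Frames235

/-! ### The explicit fields satisfy the adapted conditions -/

section Adapted

variable {M : Type*} [TopologicalSpace M] [ChartedSpace (EuclideanSpace ℝ (Fin 5)) M]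
  [IsManifold (𝓡 5) ∞ M]

variable {E : ∀ x : M, Submodule ℝ (TangentSpace (𝓡 5) x)} {X Y Y' : Fin 2 → VField 5 M}
  {Z Z' : VField 5 M} {U : Set M} {x : M}

theorem mkQ_eq_zero_of_span (h : Submodule.span ℝ (Set.range fun i => X i x) = E x) (i : Fin 2) :
    (E x).mkQ (X i x) = 0 := by
  rw [Submodule.mkQ_apply, Submodule.Quotient.mk_eq_zero, ← h]
  exact Submodule.subset_span ⟨i, rfl⟩

theorem exists_eq_add_of_mkQ_eq (h : Submodule.span ℝ (Set.range fun i => X i x) = E x)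
    {u v : TangentSpace (𝓡 5) x} (huv : (E x).mkQ u = (E x).mkQ v) :
    ∃ p q : ℝ, u = v + (p • X 0 x + q • X 1 x) := by
  have h1 : u - v ∈ E x := (Submodule.Quotient.eq _).1 huv
  rw [← h] at h1
  obtain ⟨c, hc⟩ := (Submodule.mem_span_range_iff_exists_fun ℝ).1 h1
  refine ⟨c 0, c 1, ?_⟩
  rw [← sub_eq_iff_eq_add', ← hc, Fin.sum_univ_two]

namespace IsAdaptedOn

theorem smooth_X (h : IsAdaptedOn E X Z Y U) (i : Fin 2) : SmoothOn (X i) U := by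
  fin_cases i
  exacts [h.frame.smooth 0, h.frame.smooth 1]

theorem smooth_Z (h : IsAdaptedOn E X Z Y U) : SmoothOn Z U := h.frame.smooth 2

theorem smooth_Y (h : IsAdaptedOn E X Z Y U) (i : Fin 2) : SmoothOn (Y i) U := by
  fin_cases i
  exacts [h.frame.smooth 3, h.frame.smooth 4]

theorem mkQ_X (h : IsAdaptedOn E X Z Y U) (hx : x ∈ U) (i : Fin 2) :
    (E x).mkQ (X i x) = 0 :=
  mkQ_eq_zero_of_span (h.span_eq x hx) i

end IsAdaptedOn

/-- The frame built from the bracket frame is adapted. -/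
theorem isAdaptedOn_fieldZ_fieldY (hU : IsOpen U) (hB : SmoothFrame (bracketFrame X) U)
    (hE : ∀ x ∈ U, Submodule.span ℝ (Set.range fun i => X i x) = E x) :
    IsAdaptedOn E X (fieldZ X) (fieldY X) U := by
  set c := structConst (bracketFrame X) with hc
  set B := bracketFrame X with hBdef
  set a := traceCoeff X with ha
  have sX : ∀ i, SmoothOn (X i) U := by
    intro i
    fin_cases i
    exacts [hB.smooth 0, hB.smooth 1]
  have sc : ∀ i j k, SmoothFun (c i j k) U := SmoothFrame.smoothFun_structConst hB hU
  have sa : ∀ j, SmoothFun (a j) U := by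
    intro j
    fin_cases j
    · exact (sc 0 3 3).add (sc 0 4 4)
    · exact (sc 1 3 3).add (sc 1 4 4)
  -- By construction `[X 0, B 2]` and `[X 1, B 2]` are the frame fields `B 3` and `B 4`, so these
  -- two constants vanish and `Z` is `B 2 + a 1 • X 0 - a 0 • X 1`.
  have c022 : ∀ y ∈ U, c 0 2 2 y = 0 := fun y hy =>
    (SmoothFrame.coeff_frame hB hy 3 2).trans (by simp)
  have c122 : ∀ y ∈ U, c 1 2 2 y = 0 := fun y hy =>
    (SmoothFrame.coeff_frame hB hy 4 2).trans (by simp)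
  have hZ : ∀ y ∈ U, fieldZ X y = (B 2 + (a 1 • X 0 - a 0 • X 1)) y := by
    intro y hy
    have e : fieldZ X y = B 2 y + (c 1 2 2 y + c 1 3 3 y + c 1 4 4 y) • X 0 y
      - (c 0 2 2 y + c 0 3 3 y + c 0 4 4 y) • X 1 y := rfl
    have e0 : a 0 y = c 0 3 3 y + c 0 4 4 y := rfl
    have e1 : a 1 y = c 1 3 3 y + c 1 4 4 y := rfl
    simp only [Pi.add_apply, Pi.sub_apply, Pi.smul_apply']
    rw [e, c022 y hy, c122 y hy, e0, e1]
    module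
  have sZ : SmoothOn (fieldZ X) U := by
    refine SmoothOn.congr ?_ hZ
    exact (hB.smooth 2).add (((sX 0).smul (sa 1)).sub ((sX 1).smul (sa 0)))
  let b : Fin 2 → Fin 5 := ![3, 4]
  -- `u i j` is the `Z`-coefficient modulo `E` of `[X i, B (b j) - a j • Z]`. Adding `u 1 j • X 0 -
  -- u 0 j • X 1` cancels it, because the bracket of `X i` with this horizontal field is `-u i j •
  -- Z` modulo `E`.
  let u : Fin 2 → Fin 2 → M → ℝ := fun i j y =>
    c (![0, 1] i) (b j) 2 y - dir (X i) (a j) y + c (![0, 1] i) (b j) 3 y * a 0 y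
      + c (![0, 1] i) (b j) 4 y * a 1 y
  have su : ∀ i j, SmoothFun (u i j) U := fun i j =>
    (((sc _ _ _).sub (SmoothFun.dir hU (sX i) (sa j))).add ((sc _ _ _).mul (sa 0))).add
      ((sc _ _ _).mul (sa 1))
  have hY : ∀ j, fieldY X j = B (b j) - a j • fieldZ X + (u 1 j • X 0 - u 0 j • X 1) := by
    intro j
    ext1 y
    fin_cases j
    · have e : fieldY X 0 y = B 3 y - a 0 y • fieldZ X y + u 1 0 y • X 0 y
        - u 0 0 y • X 1 y := rfl
      refine e.trans ?_
      simp only [Pi.add_apply, Pi.sub_apply, Pi.smul_apply']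
      exact add_sub_assoc _ _ _
    · have e : fieldY X 1 y = B 4 y - a 1 y • fieldZ X y + u 1 1 y • X 0 y
        - u 0 1 y • X 1 y := rfl
      refine e.trans ?_
      simp only [Pi.add_apply, Pi.sub_apply, Pi.smul_apply']
      exact add_sub_assoc _ _ _
  have sY : ∀ j, SmoothOn (fieldY X j) U := by
    intro j
    rw [hY]
    exact ((hB.smooth _).sub (sZ.smul (sa j))).add
      (((sX 0).smul (su 1 j)).sub ((sX 1).smul (su 0 j)))
  have hframe : SmoothFrame ![X 0, X 1, fieldZ X, fieldY X 0, fieldY X 1] U := by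
    refine SmoothFrame.of_span (fun i => ?_) fun y hy => ?_
    · fin_cases i
      exacts [sX 0, sX 1, sZ, sY 0, sY 1]
    · set P := Submodule.span ℝ
        (Set.range fun i => ![X 0, X 1, fieldZ X, fieldY X 0, fieldY X 1] i y)
      have m : ∀ i, ![X 0, X 1, fieldZ X, fieldY X 0, fieldY X 1] i y ∈ P :=
        fun i => Submodule.subset_span ⟨i, rfl⟩
      have m0 : X 0 y ∈ P := m 0
      have m1 : X 1 y ∈ P := m 1
      have mZ : fieldZ X y ∈ P := m 2
      have mY : ∀ j, fieldY X j y ∈ P := by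
        intro j
        fin_cases j
        exacts [m 3, m 4]
      refine (hB.generating hy).trans (Submodule.span_le.2 ?_)
      have mb : ∀ j, B (b j) y ∈ P := by
        intro j
        have e : B (b j) y = fieldY X j y + a j y • fieldZ X y
            - (u 1 j y • X 0 y - u 0 j y • X 1 y) := by
          rw [hY]
          simp only [Pi.add_apply, Pi.sub_apply, Pi.smul_apply']
          module
        rw [e]
        exact P.sub_mem (P.add_mem (mY j) (P.smul_mem _ mZ))
          (P.sub_mem (P.smul_mem _ m0) (P.smul_mem _ m1))
      rintro _ ⟨i, rfl⟩
      fin_cases i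
      · exact m0
      · exact m1
      · have e : B 2 y = fieldZ X y - (a 1 y • X 0 y - a 0 y • X 1 y) := by
          rw [hZ y hy]
          simp only [Pi.add_apply, Pi.sub_apply, Pi.smul_apply']
          module
        change B 2 y ∈ P
        rw [e]
        exact P.sub_mem mZ (P.sub_mem (P.smul_mem _ m0) (P.smul_mem _ m1))
      · exact mb 0
      · exact mb 1
  have zX : ∀ y ∈ U, ∀ i, (E y).mkQ (X i y) = 0 := fun y hy i =>
    mkQ_eq_zero_of_span (hE y hy) i
  have qZ : ∀ y ∈ U, (E y).mkQ (fieldZ X y) = (E y).mkQ (B 2 y) := by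
    intro y hy
    rw [hZ y hy]
    simp [-Submodule.mkQ_apply, zX y hy]
  have qY : ∀ y ∈ U, ∀ j, (E y).mkQ (B (b j) y) =
      (E y).mkQ (fieldY X j y) + a j y • (E y).mkQ (fieldZ X y) := by
    intro y hy j
    rw [hY]
    simp [-Submodule.mkQ_apply, zX y hy]
  have sG : ∀ {f g : M → ℝ}, SmoothFun f U → SmoothFun g U → SmoothOn (f • X 0 - g • X 1) U :=
    fun hf hg => ((sX 0).smul hf).sub ((sX 1).smul hg)
  have lieG : ∀ y ∈ U, ∀ i, ∀ {f g : M → ℝ}, SmoothFun f U → SmoothFun g U →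
      (E y).mkQ (lie (X i) (f • X 0 - g • X 1) y) =
        f y • (E y).mkQ (lie (X i) (X 0) y) - g y • (E y).mkQ (lie (X i) (X 1) y) := by
    intro y hy i f g hf hg
    have e : f • X 0 - g • X 1 = f • X 0 + (fun y => - g y) • X 1 := by
      ext1 y
      simp only [Pi.add_apply, Pi.sub_apply, Pi.smul_apply']
      module
    rw [e, lie_add_right ((sX 0).smul hf) ((sX 1).smul hg.neg) hU hy,
      lie_smul_right (hf.mdiffAt hU hy) ((sX 0).mdiffAt hU hy),
      lie_smul_right (hg.neg.mdiffAt hU hy) ((sX 1).mdiffAt hU hy)]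
    simp only [map_add, map_smul, zX y hy]
    module
  have l00 : ∀ y i, lie (X i) (X i) y = 0 := fun y i => by simp [lie]
  have l01 : ∀ y, lie (X 0) (X 1) y = B 2 y := fun y => rfl
  have l10 : ∀ y, lie (X 1) (X 0) y = - B 2 y := fun y => lie_swap
  have lB : ∀ y i, lie (X i) (B 2) y = B (b i) y := by
    intro y i
    fin_cases i <;> rfl
  have XZ : ∀ y ∈ U, ∀ i, (E y).mkQ (lie (X i) (fieldZ X) y) = (E y).mkQ (fieldY X i y) := by
    intro y hy i
    rw [lie_congr_of_eqOn hU hy (fun _ _ => rfl) hZ,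
      lie_add_right (hB.smooth 2) (sG (sa 1) (sa 0)) hU hy, map_add, lieG y hy i (sa 1) (sa 0),
      lB, qY y hy, qZ y hy]
    fin_cases i
    · simp only [Fin.zero_eta, l00, l01, map_zero]
      module
    · simp only [Fin.mk_one, l00, l10, map_zero, map_neg]
      module
  refine ⟨hframe, hE, fun y hy => (qZ y hy).symm, XZ, ?_⟩
  intro y hy i
  have key : ∀ j, (E y).mkQ (lie (X i) (fieldY X j) y) =
      (E y).mkQ (lie (X i) (B (b j)) y) - dir (X i) (a j) y • (E y).mkQ (fieldZ X y)
        - a j y • (E y).mkQ (fieldY X i y) - u i j y • (E y).mkQ (fieldZ X y) := by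
    intro j
    have e : fieldY X j = B (b j) + ((fun y => - a j y) • fieldZ X
        + (u 1 j • X 0 - u 0 j • X 1)) := by
      rw [hY]
      ext1 y
      simp only [Pi.add_apply, Pi.sub_apply, Pi.smul_apply']
      module
    rw [e, lie_add_right (hB.smooth _) ((sZ.smul (sa j).neg).add (sG (su 1 j) (su 0 j))) hU hy,
      lie_add_right (sZ.smul (sa j).neg) (sG (su 1 j) (su 0 j)) hU hy,
      lie_smul_right ((sa j).neg.mdiffAt hU hy) (sZ.mdiffAt hU hy), dir_neg]
    simp only [map_add, map_smul, lieG y hy i (su 1 j) (su 0 j), XZ y hy]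
    rw [qZ y hy]
    fin_cases i
    · simp only [Fin.zero_eta, l00, l01, map_zero]
      module
    · simp only [Fin.mk_one, l00, l10, map_zero, map_neg]
      module
  have hb : ∀ j, (E y).mkQ (lie (X i) (B (b j)) y) =
      c (![0, 1] i) (b j) 2 y • (E y).mkQ (fieldZ X y)
      + c (![0, 1] i) (b j) 3 y • ((E y).mkQ (fieldY X 0 y) + a 0 y • (E y).mkQ (fieldZ X y))
      + c (![0, 1] i) (b j) 4 y • ((E y).mkQ (fieldY X 1 y) + a 1 y • (E y).mkQ (fieldZ X y)) := by
    intro j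
    have e : lie (X i) (B (b j)) y = lie (B (![0, 1] i)) (B (b j)) y := by
      fin_cases i <;> rfl
    rw [e, SmoothFrame.lie_eq_sum hB hy, Fin.sum_univ_five]
    have e0 : (E y).mkQ (B 0 y) = 0 := zX y hy 0
    have e1 : (E y).mkQ (B 1 y) = 0 := zX y hy 1
    have e3 : (E y).mkQ (B 3 y) = _ := qY y hy 0
    have e4 : (E y).mkQ (B 4 y) = _ := qY y hy 1
    simp only [map_add, map_smul, e0, e1, e3, e4, qZ y hy]
    module
  -- The correction `-a j • Z` in `Y j` contributes `-a j • Y i` to the bracket. It lowers the trace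
  -- by `a i`, which is the trace of the uncorrected matrix.
  refine ⟨fun j k => c (![0, 1] i) (b j) (b k) y - if k = i then a j y else 0, fun j => ?_, ?_⟩
  · rw [key, hb]
    simp only [u]
    fin_cases i
    · simp [-Submodule.mkQ_apply, b]
      module
    · simp [-Submodule.mkQ_apply, b]
      module
  · fin_cases i
    · have e0 : a 0 y = c 0 3 3 y + c 0 4 4 y := rfl
      simp [b, e0]
    · have e1 : a 1 y = c 1 3 3 y + c 1 4 4 y := rfl
      simp [b, e1]

end Adapted

/-! ### Uniqueness of the adapted frame; orthogonal matrices of functions -/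

section AdaptedUnique

variable {M : Type*} [TopologicalSpace M] [ChartedSpace (EuclideanSpace ℝ (Fin 5)) M]
  [IsManifold (𝓡 5) ∞ M]

variable {E : ∀ x : M, Submodule ℝ (TangentSpace (𝓡 5) x)} {X X' Y Y' : Fin 2 → VField 5 M}
  {Z Z' : VField 5 M} {U : Set M} {x : M}

namespace IsAdaptedOn

/-- The adapted frame is determined by `X₁, X₂`. -/
theorem unique (hU : IsOpen U) (h : IsAdaptedOn E X Z Y U) (h' : IsAdaptedOn E X Z' Y' U) :
    ∀ x ∈ U, Z' x = Z x ∧ ∀ i, Y' i x = Y i x := by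
  set F : Fin 5 → VField 5 M := ![X 0, X 1, Z, Y 0, Y 1] with hFdef
  have hF : SmoothFrame F U := h.frame
  have sX := h.smooth_X
  have sZ := h.smooth_Z
  have sY := h.smooth_Y
  have f0 : ∀ y ∈ U, ∀ k, coeff F y (X 0 y) k = if 0 = k then 1 else 0 := fun y hy =>
    SmoothFrame.coeff_frame hF hy 0
  have f1 : ∀ y ∈ U, ∀ k, coeff F y (X 1 y) k = if 1 = k then 1 else 0 := fun y hy =>
    SmoothFrame.coeff_frame hF hy 1
  have f2 : ∀ y ∈ U, ∀ k, coeff F y (Z y) k = if 2 = k then 1 else 0 := fun y hy =>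
    SmoothFrame.coeff_frame hF hy 2
  have f3 : ∀ y ∈ U, ∀ k, coeff F y (Y 0 y) k = if 3 = k then 1 else 0 := fun y hy =>
    SmoothFrame.coeff_frame hF hy 3
  have f4 : ∀ y ∈ U, ∀ k, coeff F y (Y 1 y) k = if 4 = k then 1 else 0 := fun y hy =>
    SmoothFrame.coeff_frame hF hy 4
  have l00 : ∀ y i, lie (X i) (X i) y = 0 := fun y i => by simp [lie]
  have l10 : ∀ y, lie (X 1) (X 0) y = - lie (X 0) (X 1) y := fun y => lie_swap
  -- The first condition gives `Z' = Z + u X 0 + v X 1`. Taking `u`, `v` as frame coefficients makes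
  -- them smooth, so that brackets of `Z'` can be expanded.
  set u : M → ℝ := fun y => coeff F y (Z' y) 0 with hu
  set v : M → ℝ := fun y => coeff F y (Z' y) 1 with hv
  have su : SmoothFun u U := SmoothFrame.smoothFun_coeff hF hU h'.smooth_Z 0
  have sv : SmoothFun v U := SmoothFrame.smoothFun_coeff hF hU h'.smooth_Z 1
  have eZ : ∀ y ∈ U, Z' y = (Z + (u • X 0 + v • X 1)) y := by
    intro y hy
    obtain ⟨p, q, hpq⟩ := exists_eq_add_of_mkQ_eq (h.span_eq y hy)
      ((h'.X_X y hy).symm.trans (h.X_X y hy))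
    have hu' : u y = p := by simp [hu, hpq, coeff_add, coeff_smul, f0 y hy, f1 y hy, f2 y hy]
    have hv' : v y = q := by simp [hv, hpq, coeff_add, coeff_smul, f0 y hy, f1 y hy, f2 y hy]
    rw [hpq, ← hu', ← hv']
    rfl
  have lXX : ∀ y ∈ U, ∃ p q : ℝ, lie (X 0) (X 1) y = Z y + (p • X 0 y + q • X 1 y) :=
    fun y hy => exists_eq_add_of_mkQ_eq (h.span_eq y hy) (h.X_X y hy)
  have lXZ : ∀ y ∈ U, ∀ i, ∃ p q : ℝ, lie (X i) Z y = Y i y + (p • X 0 y + q • X 1 y) :=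
    fun y hy i => exists_eq_add_of_mkQ_eq (h.span_eq y hy) (h.X_Z y hy i)
  have lieG : ∀ y ∈ U, ∀ i, ∀ {f g : M → ℝ}, SmoothFun f U → SmoothFun g U →
      lie (X i) (f • X 0 + g • X 1) y = dir (X i) f y • X 0 y + f y • lie (X i) (X 0) y
        + (dir (X i) g y • X 1 y + g y • lie (X i) (X 1) y) := by
    intro y hy i f g hf hg
    rw [lie_add_right ((sX 0).smul hf) ((sX 1).smul hg) hU hy,
      lie_smul_right (hf.mdiffAt hU hy) ((sX 0).mdiffAt hU hy),
      lie_smul_right (hg.mdiffAt hU hy) ((sX 1).mdiffAt hU hy)]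
  -- `r i` is the `Z`-component of `[X i, u X 0 + v X 1]`: only the bracket with the other
  -- horizontal field contributes, with opposite signs for the two `i`.
  let r : Fin 2 → M → ℝ := ![v, fun y => - u y]
  have sr : ∀ i, SmoothFun (r i) U := by
    intro i
    fin_cases i
    exacts [sv, su.neg]
  let s : Fin 2 → M → ℝ := fun i y => coeff F y (Y' i y) 0
  let t : Fin 2 → M → ℝ := fun i y => coeff F y (Y' i y) 1
  have ss : ∀ i, SmoothFun (s i) U := fun i => SmoothFrame.smoothFun_coeff hF hU (h'.smooth_Y i) 0
  have st : ∀ i, SmoothFun (t i) U := fun i => SmoothFrame.smoothFun_coeff hF hU (h'.smooth_Y i) 1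
  have eY : ∀ i, ∀ y ∈ U, Y' i y = (Y i + (r i • Z + (s i • X 0 + t i • X 1))) y := by
    intro i y hy
    have key : ∃ p q : ℝ, Y' i y = Y i y + r i y • Z y + (p • X 0 y + q • X 1 y) := by
      obtain ⟨p1, q1, h1⟩ := exists_eq_add_of_mkQ_eq (h.span_eq y hy) (h'.X_Z y hy i)
      obtain ⟨p2, q2, h2⟩ := lXX y hy
      obtain ⟨p3, q3, h3⟩ := lXZ y hy i
      rw [lie_congr_of_eqOn hU hy (fun _ _ => rfl) eZ,
        lie_add_right sZ (((sX 0).smul su).add ((sX 1).smul sv)) hU hy, lieG y hy i su sv, h3]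
        at h1
      have h1' := (sub_eq_iff_eq_add.2 h1).symm
      fin_cases i
      · simp only [Fin.zero_eta, l00, h2] at h1'
        refine ⟨p3 + dir (X 0) u y + v y * p2 - p1, q3 + dir (X 0) v y + v y * q2 - q1, ?_⟩
        refine h1'.trans ?_
        simp [r]
        module
      · simp only [Fin.mk_one, l00, l10, h2] at h1'
        refine ⟨p3 + dir (X 1) u y - u y * p2 - p1, q3 + dir (X 1) v y - u y * q2 - q1, ?_⟩
        refine h1'.trans ?_
        simp [r]
        module
    obtain ⟨p, q, hpq⟩ := key
    have fY : coeff F y (Y i y) 0 = 0 ∧ coeff F y (Y i y) 1 = 0 := by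
      fin_cases i <;> simp [f3 y hy, f4 y hy]
    have hs : s i y = p := by
      simp [s, hpq, coeff_add, coeff_smul, f0 y hy, f1 y hy, f2 y hy, fY]
    have ht : t i y = q := by
      simp [t, hpq, coeff_add, coeff_smul, f0 y hy, f1 y hy, f2 y hy, fY]
    rw [hpq, ← hs, ← ht, add_assoc]
    rfl
  have lY : ∀ k i, ∀ y ∈ U, lie (X k) (Y' i) y = lie (X k) (Y i) y
      + (dir (X k) (r i) y • Z y + r i y • lie (X k) Z y
      + (dir (X k) (s i) y • X 0 y + s i y • lie (X k) (X 0) y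
        + (dir (X k) (t i) y • X 1 y + t i y • lie (X k) (X 1) y))) := by
    intro k i y hy
    have sG := ((sX 0).smul (ss i)).add ((sX 1).smul (st i))
    rw [lie_congr_of_eqOn hU hy (fun _ _ => rfl) (eY i),
      lie_add_right (sY i) ((sZ.smul (sr i)).add sG) hU hy,
      lie_add_right (sZ.smul (sr i)) sG hU hy, lieG y hy k (ss i) (st i),
      lie_smul_right ((sr i).mdiffAt hU hy) (sZ.mdiffAt hU hy)]
  -- Passing from `Y` to `Y'` adds `r i • Y k` to `[X k, Y i]` in the `Y`-directions, which changes
  -- the trace by `r k`; as both traces are zero, `r k = 0`. Once `r` vanishes, the `Z`-component of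
  -- `[X k, Y' i]` isolates the remaining horizontal coefficients.
  have coeffs : ∀ k, ∀ y ∈ U, r k y = 0 ∧ ((∀ i, r i y = 0) → ∀ i, dir (X k) (r i) y
      + (![t i y, - s i y] k) = 0) := by
    intro k y hy
    obtain ⟨A, hA, trA⟩ := h.X_Y y hy k
    obtain ⟨A', hA', trA'⟩ := h'.X_Y y hy k
    obtain ⟨p2, q2, h2⟩ := lXX y hy
    obtain ⟨p3, q3, h3⟩ := lXZ y hy k
    have hAe : ∀ i, ∃ p q : ℝ, lie (X k) (Y i) y =
        A i 0 • Y 0 y + A i 1 • Y 1 y + (p • X 0 y + q • X 1 y) := fun i =>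
      exists_eq_add_of_mkQ_eq (h.span_eq y hy) (by simpa [-Submodule.mkQ_apply] using hA i)
    have hAe' : ∀ i, ∃ p q : ℝ, lie (X k) (Y' i) y =
        A' i 0 • Y' 0 y + A' i 1 • Y' 1 y + (p • X 0 y + q • X 1 y) := fun i =>
      exists_eq_add_of_mkQ_eq (h.span_eq y hy) (by simpa [-Submodule.mkQ_apply] using hA' i)
    choose p q hpq using hAe
    choose p' q' hpq' using hAe'
    have main : ∀ i m, coeff F y (lie (X k) (Y' i) y) m = _ := fun i m =>
      congrArg (fun w => coeff F y w m) (lY k i y hy)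
    simp only [hpq, hpq', h3] at main
    have e0 := eY 0 y hy
    have e1 := eY 1 y hy
    simp only [Pi.add_apply, Pi.smul_apply'] at e0 e1
    simp only [e0, e1] at main
    have m03 := main 0 3
    have m14 := main 1 4
    have m2 := fun i => main i 2
    constructor
    · fin_cases k
      · simp [coeff_add, coeff_smul, f0 y hy, f1 y hy, f2 y hy, f3 y hy, f4 y hy,
          l00, h2] at m03 m14
        change r 0 y = 0
        linarith
      · simp [coeff_add, coeff_smul, coeff_neg, f0 y hy, f1 y hy, f2 y hy, f3 y hy,
          f4 y hy, l00, l10, h2] at m03 m14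
        change r 1 y = 0
        linarith
    · intro hr i
      have m2i := m2 i
      fin_cases k <;> fin_cases i
      all_goals
        simp [coeff_add, coeff_smul, coeff_neg, f0 y hy, f1 y hy, f2 y hy, f3 y hy,
          f4 y hy, l00, l10, h2, hr] at m2i
        simp
        linarith
  have hr : ∀ i, ∀ y ∈ U, r i y = 0 := fun i y hy => (coeffs i y hy).1
  -- The vanishing of `r` on the whole open set is needed here, since its derivatives enter the
  -- equations for `s` and `t`.
  have hdr : ∀ k i, ∀ y ∈ U, dir (X k) (r i) y = 0 := fun k i y hy =>
    dir_eq_zero_of_eqOn_const hU hy (hr i)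
  intro x hx
  have hu0 : u x = 0 := by simpa [r] using hr 1 x hx
  have hv0 : v x = 0 := by simpa [r] using hr 0 x hx
  refine ⟨by simp [eZ x hx, hu0, hv0], fun i => ?_⟩
  have ht0 := (coeffs 0 x hx).2 (fun i => hr i x hx) i
  have hs0 := (coeffs 1 x hx).2 (fun i => hr i x hx) i
  rw [hdr _ _ x hx] at ht0 hs0
  have ht1 : t i x = 0 := by simpa using ht0
  have hs1 : s i x = 0 := by simpa using hs0
  simp [eY i x hx, hr i x hx, ht1, hs1]

end IsAdaptedOn

/-- A smooth function on `U` with values in the orthogonal `2 × 2`-matrices. -/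
structure IsOrthogonalOn (O : Fin 2 → Fin 2 → M → ℝ) (U : Set M) : Prop where
  smooth : ∀ i j, SmoothFun (O i j) U
  row : ∀ x ∈ U, ∀ i j, ∑ k, O i k x * O j k x = if i = j then 1 else 0
  col : ∀ x ∈ U, ∀ i j, ∑ k, O k i x * O k j x = if i = j then 1 else 0

/-- The determinant of a `2 × 2`-matrix of functions. -/
def det₂ (O : Fin 2 → Fin 2 → M → ℝ) (x : M) : ℝ := O 0 0 x * O 1 1 x - O 0 1 x * O 1 0 x

namespace IsOrthogonalOn

variable {O : Fin 2 → Fin 2 → M → ℝ}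

/-- A right inverse of a square matrix is also a left inverse. -/
theorem of_row (hs : ∀ i j, SmoothFun (O i j) U)
    (hr : ∀ x ∈ U, ∀ i j, ∑ k, O i k x * O j k x = if i = j then 1 else 0) :
    IsOrthogonalOn O U := by
  refine ⟨hs, hr, fun x hx i j => ?_⟩
  let A : Matrix (Fin 2) (Fin 2) ℝ := Matrix.of fun i j => O i j x
  have h1 : A * A.transpose = 1 := by
    ext i j
    rw [Matrix.mul_apply, Matrix.one_apply]
    exact hr x hx i j
  have h2 : (A.transpose * A) i j = (1 : Matrix (Fin 2) (Fin 2) ℝ) i j := by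
    rw [mul_eq_one_comm.1 h1]
  rw [Matrix.mul_apply, Matrix.one_apply] at h2
  exact h2

theorem smooth_det (h : IsOrthogonalOn O U) : SmoothFun (det₂ O) U :=
  ((h.smooth 0 0).mul (h.smooth 1 1)).sub ((h.smooth 0 1).mul (h.smooth 1 0))

/-- Lagrange's identity: the squared determinant is the product of the squared row norms minus the
square of their inner product. -/
theorem det_mul_self (h : IsOrthogonalOn O U) (hx : x ∈ U) : det₂ O x * det₂ O x = 1 := by
  have h00 := h.row x hx 0 0
  have h01 := h.row x hx 0 1
  have h11 := h.row x hx 1 1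
  simp only [Fin.sum_univ_two, if_true, Fin.zero_eq_one_iff, OfNat.ofNat_ne_one, if_false]
    at h00 h01 h11
  unfold det₂
  linear_combination h00 * (O 1 0 x * O 1 0 x + O 1 1 x * O 1 1 x) + h11
    - h01 * (O 0 0 x * O 1 0 x + O 0 1 x * O 1 1 x)

/-- Differentiate `det² = 1`. This lets the determinant be treated as a constant in all brackets and
covariant derivatives below. -/
theorem dir_det (h : IsOrthogonalOn O U) (hU : IsOpen U) (hx : x ∈ U) (V : VField 5 M) :
    dir V (det₂ O) x = 0 := by
  have h1 : dir V (fun y => det₂ O y * det₂ O y) x = 0 :=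
    dir_eq_zero_of_eqOn_const hU hx fun y hy => h.det_mul_self hy
  have hd := h.smooth_det.mdiffAt hU hx
  rw [dir_mul hd hd] at h1
  have h2 := h.det_mul_self hx
  linear_combination (1 / 2 * det₂ O x) * h1 - dir V (det₂ O) x * h2

theorem dir_row (h : IsOrthogonalOn O U) (hU : IsOpen U) (hx : x ∈ U) (V : VField 5 M)
    (i j : Fin 2) :
    ∑ k, (O i k x * dir V (O j k) x + dir V (O i k) x * O j k x) = 0 := by
  have h1 : dir V (fun y => ∑ k, O i k y * O j k y) x = 0 :=
    dir_eq_zero_of_eqOn_const hU hx fun y hy => h.row y hy i j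
  rw [dir_sum fun k => ((h.smooth i k).mul (h.smooth j k)).mdiffAt hU hx] at h1
  rw [← h1]
  exact Finset.sum_congr rfl fun k _ =>
    (dir_mul ((h.smooth i k).mdiffAt hU hx) ((h.smooth j k).mdiffAt hU hx)).symm

theorem dir_col (h : IsOrthogonalOn O U) (hU : IsOpen U) (hx : x ∈ U) (V : VField 5 M)
    (i j : Fin 2) :
    ∑ k, (O k i x * dir V (O k j) x + dir V (O k i) x * O k j x) = 0 := by
  have h1 : dir V (fun y => ∑ k, O k i y * O k j y) x = 0 :=
    dir_eq_zero_of_eqOn_const hU hx fun y hy => h.col y hy i j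
  rw [dir_sum fun k => ((h.smooth k i).mul (h.smooth k j)).mdiffAt hU hx] at h1
  rw [← h1]
  exact Finset.sum_congr rfl fun k _ =>
    (dir_mul ((h.smooth k i).mdiffAt hU hx) ((h.smooth k j).mdiffAt hU hx)).symm

end IsOrthogonalOn

end AdaptedUnique

/-! ### Change of orthonormal basis and independence of the choice -/

section Rotation

variable {M : Type*} [TopologicalSpace M] [ChartedSpace (EuclideanSpace ℝ (Fin 5)) M]
  [IsManifold (𝓡 5) ∞ M]

variable {E : ∀ x : M, Submodule ℝ (TangentSpace (𝓡 5) x)} {X X' Y Y' : Fin 2 → VField 5 M}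
  {Z Z' : VField 5 M} {U U' : Set M} {x : M} {O : Fin 2 → Fin 2 → M → ℝ}

/-- Change of adapted frame under a rotation of `X₁, X₂` by an orthogonal matrix. -/
theorem IsAdaptedOn.rotate (hU : IsOpen U) (h : IsAdaptedOn E X Z Y U) (hO : IsOrthogonalOn O U)
    (hX' : ∀ i, ∀ y ∈ U, X' i y = ∑ j, O i j y • X j y) :
    IsAdaptedOn E X' (fun y => det₂ O y • Z y)
      (fun i y => ∑ j, (det₂ O y * O i j y) • Y j y) U := by
  have sX := h.smooth_X
  have sZ := h.smooth_Z
  have sY := h.smooth_Y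
  have sO := hO.smooth
  have sd := hO.smooth_det
  have sP : ∀ i j, SmoothFun (fun y => det₂ O y * O i j y) U := fun i j => sd.mul (sO i j)
  have sX' : ∀ i, SmoothOn (X' i) U := fun i =>
    SmoothOn.congr (SmoothOn.sum (F := fun j => O i j • X j) fun j => (sX j).smul (sO i j)) (hX' i)
  have sZ' : SmoothOn (fun y => det₂ O y • Z y) U := sZ.smul sd
  have sY' : ∀ i, SmoothOn (fun y => ∑ j, (det₂ O y * O i j y) • Y j y) U := fun i =>
    SmoothOn.sum (F := fun j => (fun y => det₂ O y * O i j y) • Y j) fun j => (sY j).smul (sP i j)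
  -- The transpose of `O` inverts it, so old fields are combinations of new ones; the factor `det₂
  -- O` on the `Y`-fields is its own inverse.
  have back : ∀ (W : Fin 2 → VField 5 M) (y), y ∈ U → ∀ j,
      W j y = ∑ i, O i j y • ∑ k, O i k y • W k y := by
    intro W y hy j
    have h0 := hO.col y hy j 0
    have h1 := hO.col y hy j 1
    simp only [Fin.sum_univ_two] at h0 h1 ⊢
    have e : O 0 j y • (O 0 0 y • W 0 y + O 0 1 y • W 1 y)
        + O 1 j y • (O 1 0 y • W 0 y + O 1 1 y • W 1 y)
        = (O 0 j y * O 0 0 y + O 1 j y * O 1 0 y) • W 0 y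
        + (O 0 j y * O 0 1 y + O 1 j y * O 1 1 y) • W 1 y := by module
    rw [e, h0, h1]
    fin_cases j <;> simp
  have backX : ∀ y ∈ U, ∀ j, X j y = ∑ i, O i j y • X' i y := by
    intro y hy j
    refine (back X y hy j).trans (Finset.sum_congr rfl fun i _ => ?_)
    rw [hX' i y hy]
  have backY : ∀ y ∈ U, ∀ j, Y j y =
      ∑ i, (det₂ O y * O i j y) • ∑ k, (det₂ O y * O i k y) • Y k y := by
    intro y hy j
    refine (back Y y hy j).trans (Finset.sum_congr rfl fun i _ => ?_)
    have e := hO.det_mul_self hy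
    simp only [Fin.sum_univ_two]
    have e' : (det₂ O y * O i j y) • ((det₂ O y * O i 0 y) • Y 0 y + (det₂ O y * O i 1 y) • Y 1 y)
      = (det₂ O y * det₂ O y) • (O i j y • (O i 0 y • Y 0 y + O i 1 y • Y 1 y)) := by module
    rw [e', e, one_smul]
  have span_eq : ∀ x ∈ U, Submodule.span ℝ (Set.range fun i => X' i x) = E x := by
    intro y hy
    rw [← h.span_eq y hy]
    refine le_antisymm (Submodule.span_le.2 ?_) (Submodule.span_le.2 ?_)
    · rintro _ ⟨i, rfl⟩
      change X' i y ∈ _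
      rw [hX' i y hy]
      exact Submodule.sum_mem _ fun j _ => Submodule.smul_mem _ _ (Submodule.subset_span ⟨j, rfl⟩)
    · rintro _ ⟨i, rfl⟩
      change X i y ∈ _
      rw [backX y hy i]
      exact Submodule.sum_mem _ fun j _ => Submodule.smul_mem _ _ (Submodule.subset_span ⟨j, rfl⟩)
  have zX := fun y (hy : y ∈ U) i => h.mkQ_X hy i
  -- Modulo `E` the bracket is linear over functions in a horizontal argument: derivatives of the
  -- coefficients multiply horizontal fields.
  have lieX' : ∀ (i : Fin 2) (V : VField 5 M), ∀ y ∈ U, (E y).mkQ (lie (X' i) V y) =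
      ∑ k, O i k y • (E y).mkQ (lie (X k) V y) := by
    intro i V y hy
    rw [lie_congr_of_eqOn hU hy (hX' i) (fun _ _ => rfl), lie_comb_left hU hy (sO i) sX, map_sum]
    refine Finset.sum_congr rfl fun k _ => ?_
    rw [map_sub, map_smul, map_smul, zX y hy k, smul_zero, sub_zero]
  refine ⟨SmoothFrame.of_span (fun i => ?_) fun y hy => ?_, span_eq, ?_, ?_, ?_⟩
  · fin_cases i
    exacts [sX' 0, sX' 1, sZ', sY' 0, sY' 1]
  · set P := Submodule.span ℝ (Set.range fun i => ![X' 0, X' 1, fun y => det₂ O y • Z y,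
      fun y => ∑ j, (det₂ O y * O 0 j y) • Y j y,
      fun y => ∑ j, (det₂ O y * O 1 j y) • Y j y] i y) with hP
    have m : ∀ i, ![X' 0, X' 1, fun y => det₂ O y • Z y,
      fun y => ∑ j, (det₂ O y * O 0 j y) • Y j y,
      fun y => ∑ j, (det₂ O y * O 1 j y) • Y j y] i y ∈ P := fun i => Submodule.subset_span ⟨i, rfl⟩
    have mX : ∀ j, X j y ∈ P := by
      intro j
      rw [backX y hy j, Fin.sum_univ_two]
      exact P.add_mem (P.smul_mem _ (m 0)) (P.smul_mem _ (m 1))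
    have mY : ∀ j, Y j y ∈ P := by
      intro j
      rw [backY y hy j, Fin.sum_univ_two]
      exact P.add_mem (P.smul_mem _ (m 3)) (P.smul_mem _ (m 4))
    have mZ : Z y ∈ P := by
      have e : Z y = det₂ O y • (det₂ O y • Z y) := by
        rw [smul_smul, hO.det_mul_self hy, one_smul]
      rw [e]
      exact P.smul_mem _ (m 2)
    refine (h.frame.generating hy).trans (Submodule.span_le.2 ?_)
    rintro _ ⟨i, rfl⟩
    fin_cases i
    exacts [mX 0, mX 1, mZ, mY 0, mY 1]
  · intro y hy
    have l00 : ∀ i, lie (X i) (X i) y = 0 := fun i => by simp [lie]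
    have l10 : lie (X 1) (X 0) y = - lie (X 0) (X 1) y := lie_swap
    have e : ∀ k, (E y).mkQ (lie (X k) (X' 1) y) =
        ∑ j, O 1 j y • (E y).mkQ (lie (X k) (X j) y) := by
      intro k
      rw [lie_congr_of_eqOn hU hy (fun _ _ => rfl) (hX' 1), lie_comb_right hU hy (sO 1) sX, map_sum]
      refine Finset.sum_congr rfl fun j _ => ?_
      rw [map_add, map_smul, map_smul, zX y hy j, smul_zero, zero_add]
    rw [lieX' 0 _ y hy]
    simp only [e, Fin.sum_univ_two, l00, l10, map_zero, map_neg, h.X_X y hy, map_smul, det₂]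
    module
  · intro y hy i
    have e : ∀ k, (E y).mkQ (lie (X k) (fun y => det₂ O y • Z y) y) =
        det₂ O y • (E y).mkQ (Y k y) := by
      intro k
      have := lie_smul_right (X := X k) (sd.mdiffAt hU hy) (sZ.mdiffAt hU hy)
      rw [hO.dir_det hU hy, zero_smul, zero_add] at this
      refine (congrArg (E y).mkQ this).trans ?_
      rw [map_smul, h.X_Z y hy]
    rw [lieX' i _ y hy]
    simp only [e, map_sum, map_smul]
    refine Finset.sum_congr rfl fun k _ => ?_
    module
  · intro y hy i
    choose A hA trA using h.X_Y y hy
    have dP : ∀ k j l, dir (X k) (fun y => det₂ O y * O j l y) y =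
        det₂ O y * dir (X k) (O j l) y := by
      intro k j l
      rw [dir_mul (sd.mdiffAt hU hy) ((sO j l).mdiffAt hU hy), hO.dir_det hU hy, zero_mul, add_zero]
    have e : ∀ k j, (E y).mkQ (lie (X k) (fun y => ∑ l, (det₂ O y * O j l y) • Y l y) y) =
        ∑ l, ((det₂ O y * dir (X k) (O j l) y) • (E y).mkQ (Y l y) + (det₂ O y * O j l y) •
          (A k l 0 • (E y).mkQ (Y 0 y) + A k l 1 • (E y).mkQ (Y 1 y))) := by
      intro k j
      rw [lie_comb_right hU hy (sP j) sY, map_sum]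
      refine Finset.sum_congr rfl fun l _ => ?_
      rw [map_add, map_smul, map_smul, hA, dP]
    have eY : ∀ l, (E y).mkQ (Y l y) = (det₂ O y * O 0 l y) •
        (E y).mkQ (∑ k, (det₂ O y * O 0 k y) • Y k y) + (det₂ O y * O 1 l y) •
        (E y).mkQ (∑ k, (det₂ O y * O 1 k y) • Y k y) := by
      intro l
      conv_lhs => rw [backY y hy l, Fin.sum_univ_two]
      rw [map_add, map_smul, map_smul]
    -- For each `k` the new matrix is `X_k(O) Oᵀ + O A_k Oᵀ`; the two determinant factors multiply
    -- to `1`. The first summand has trace zero because rows have constant length, and the second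
    -- has the trace of `A_k`.
    refine ⟨fun j n => ∑ k, O i k y * ∑ l, (dir (X k) (O j l) y * O n l y + O j l y *
      (A k l 0 * O n 0 y + A k l 1 * O n 1 y)), fun j => ?_, ?_⟩
    · rw [lieX' i _ y hy]
      simp only [e]
      have hd := hO.det_mul_self hy
      have eY0 := eY 0
      have eY1 := eY 1
      generalize (E y).mkQ (∑ k, (det₂ O y * O 0 k y) • Y k y) = y0 at *
      generalize (E y).mkQ (∑ k, (det₂ O y * O 1 k y) • Y k y) = y1 at *
      simp only [Fin.sum_univ_two]
      rw [eY0, eY1]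
      match_scalars
      · linear_combination (O i 0 y * ((dir (X 0) (O j 0) y * O 0 0 y + O j 0 y *
          (A 0 0 0 * O 0 0 y + A 0 0 1 * O 0 1 y)) + (dir (X 0) (O j 1) y * O 0 1 y + O j 1 y *
          (A 0 1 0 * O 0 0 y + A 0 1 1 * O 0 1 y))) +
          O i 1 y * ((dir (X 1) (O j 0) y * O 0 0 y + O j 0 y *
          (A 1 0 0 * O 0 0 y + A 1 0 1 * O 0 1 y)) + (dir (X 1) (O j 1) y * O 0 1 y + O j 1 y *
          (A 1 1 0 * O 0 0 y + A 1 1 1 * O 0 1 y)))) * hd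
      · linear_combination (O i 0 y * ((dir (X 0) (O j 0) y * O 1 0 y + O j 0 y *
          (A 0 0 0 * O 1 0 y + A 0 0 1 * O 1 1 y)) + (dir (X 0) (O j 1) y * O 1 1 y + O j 1 y *
          (A 0 1 0 * O 1 0 y + A 0 1 1 * O 1 1 y))) +
          O i 1 y * ((dir (X 1) (O j 0) y * O 1 0 y + O j 0 y *
          (A 1 0 0 * O 1 0 y + A 1 0 1 * O 1 1 y)) + (dir (X 1) (O j 1) y * O 1 1 y + O j 1 y *
          (A 1 1 0 * O 1 0 y + A 1 1 1 * O 1 1 y)))) * hd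
    · have c00 := hO.col y hy 0 0
      have c01 := hO.col y hy 0 1
      have c11 := hO.col y hy 1 1
      have d0 := fun k => hO.dir_row hU hy (X k) 0 0
      have d1 := fun k => hO.dir_row hU hy (X k) 1 1
      have t0 := trA 0
      have t1 := trA 1
      simp only [Fin.sum_univ_two, if_true, Fin.zero_eq_one_iff, OfNat.ofNat_ne_one, if_false]
        at c00 c01 c11 d0 d1 ⊢
      linear_combination O i 0 y * ((d0 0 + d1 0) / 2 + A 0 0 0 * c00 + (A 0 0 1 + A 0 1 0) * c01
        + A 0 1 1 * c11 + t0) + O i 1 y * ((d0 1 + d1 1) / 2 + A 1 0 0 * c00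
        + (A 1 0 1 + A 1 1 0) * c01 + A 1 1 1 * c11 + t1)

namespace SubRiemannianStructure.IsOrthonormalFrameOn

variable {S : SubRiemannianStructure 5 M}

theorem mono (hX : S.IsOrthonormalFrameOn X U) (h : U' ⊆ U) : S.IsOrthonormalFrameOn X U' :=
  ⟨fun i => (hX.smooth i).mono h, fun x hx => hX.span_eq x (h hx),
    fun x hx => hX.orthonormal x (h hx)⟩

/-- The frame `X₁, X₂, Z, Y₁, Y₂` is adapted. -/
theorem isAdaptedOn (hX : S.IsOrthonormalFrameOn X U) (hU : IsOpen U)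
    (hS : S.HasGrowthVector [2, 3, 5]) : IsAdaptedOn S.E X (fieldZ X) (fieldY X) U :=
  isAdaptedOn_fieldZ_fieldY hU (hX.smoothFrame_bracketFrame hU hS) hX.span_eq

/-- Two orthonormal frames differ by an orthogonal matrix of smooth functions. -/
theorem exists_orthogonal (hX : S.IsOrthonormalFrameOn X U) (hX' : S.IsOrthonormalFrameOn X' U)
    (hU : IsOpen U) : ∃ O, IsOrthogonalOn O U ∧ ∀ i, ∀ y ∈ U, X' i y = ∑ j, O i j y • X j y := by
  choose O hs hO using fun i => hX.exists_smooth_coeff hU (hX'.smooth i) fun y hy => hX'.mem hy i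
  refine ⟨O, IsOrthogonalOn.of_row hs fun x hx i j => ?_, hO⟩
  have key : ∀ i j, S.g x ⟨X' i x, hX'.mem hx i⟩ ⟨X' j x, hX'.mem hx j⟩ =
      ∑ k, O i k x * O j k x := by
    intro i j
    have e : ∀ i, (⟨X' i x, hX'.mem hx i⟩ : S.E x) = ∑ k, O i k x • ⟨X k x, hX.mem hx k⟩ := by
      intro i
      apply Subtype.ext
      refine (hO i x hx).trans ?_
      simp
    rw [e i, e j]
    simp only [Fin.sum_univ_two, map_add, map_smul, LinearMap.add_apply, LinearMap.smul_apply,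
      hX.orthonormal x hx _ _ ⟨X _ x, hX.mem hx _⟩ ⟨X _ x, hX.mem hx _⟩ rfl rfl]
    simp
    ring
  rw [← key]
  exact hX'.orthonormal x hx i j _ _ rfl rfl

/-- Transformation of `Z`, `Y₁`, `Y₂` under a change of the orthonormal frame. -/
theorem exists_orthogonal_adapted (hS : S.HasGrowthVector [2, 3, 5])
    (hX : S.IsOrthonormalFrameOn X U) (hX' : S.IsOrthonormalFrameOn X' U) (hU : IsOpen U) :
    ∃ O, IsOrthogonalOn O U ∧ (∀ i, ∀ y ∈ U, X' i y = ∑ j, O i j y • X j y) ∧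
      (∀ y ∈ U, fieldZ X' y = det₂ O y • fieldZ X y) ∧
      ∀ i, ∀ y ∈ U, fieldY X' i y = ∑ j, (det₂ O y * O i j y) • fieldY X j y := by
  obtain ⟨O, hO, h⟩ := exists_orthogonal hX hX' hU
  -- The rotated fields and the ones defined from `X'` are both adapted to `X'`, so uniqueness
  -- identifies them without transforming the explicit formulas.
  have h1 := (hX.isAdaptedOn hU hS).rotate hU hO h
  have h2 := h1.unique hU (hX'.isAdaptedOn hU hS)
  exact ⟨O, hO, h, fun y hy => (h2 y hy).1, fun i y hy => (h2 y hy).2 i⟩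

theorem smoothFrame_adaptedFrame (hX : S.IsOrthonormalFrameOn X U) (hU : IsOpen U)
    (hS : S.HasGrowthVector [2, 3, 5]) : SmoothFrame (adaptedFrame X) U :=
  (hX.isAdaptedOn hU hS).frame

/-- `ḡ`, `(TM)_{-2}` and `(TM)_{-3}` do not depend on the orthonormal frame. -/
theorem gbar_eq (hS : S.HasGrowthVector [2, 3, 5])
    (hX : S.IsOrthonormalFrameOn X U) (hX' : S.IsOrthonormalFrameOn X' U) (hU : IsOpen U)
    (hx : x ∈ U) : gbar X x = gbar X' x ∧ TMm2 X x = TMm2 X' x ∧ TMm3 X x = TMm3 X' x := by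
  obtain ⟨O, hO, hOX, hOZ, hOY⟩ := exists_orthogonal_adapted hS hX hX' hU
  have hF := smoothFrame_adaptedFrame hX hU hS
  have hF' := smoothFrame_adaptedFrame hX' hU hS
  have hd := hO.det_mul_self hx
  have r00 := hO.row x hx 0 0
  have r01 := hO.row x hx 0 1
  have r11 := hO.row x hx 1 1
  have c00 := hO.col x hx 0 0
  have c01 := hO.col x hx 0 1
  have c11 := hO.col x hx 1 1
  simp only [Fin.sum_univ_two, if_true, Fin.zero_eq_one_iff, OfNat.ofNat_ne_one, if_false]
    at r00 r01 r11 c00 c01 c11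
  refine ⟨?_, ?_, ?_⟩
  -- Coefficient vectors for the two frames are related by an orthogonal block matrix, so the sum of
  -- products defining the metric is the same.
  · have key : ∀ u : TangentSpace (𝓡 5) x, ∀ k, coeff (adaptedFrame X) x u k =
        ![coeff (adaptedFrame X') x u 0 * O 0 0 x + coeff (adaptedFrame X') x u 1 * O 1 0 x,
          coeff (adaptedFrame X') x u 0 * O 0 1 x + coeff (adaptedFrame X') x u 1 * O 1 1 x,
          coeff (adaptedFrame X') x u 2 * det₂ O x,
          det₂ O x * (coeff (adaptedFrame X') x u 3 * O 0 0 x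
            + coeff (adaptedFrame X') x u 4 * O 1 0 x),
          det₂ O x * (coeff (adaptedFrame X') x u 3 * O 0 1 x
            + coeff (adaptedFrame X') x u 4 * O 1 1 x)] k := by
      intro u k
      have hu := SmoothFrame.sum_coeff hF' hx u
      have e := SmoothFrame.coeff_comb hF hx ![coeff (adaptedFrame X') x u 0 * O 0 0 x
            + coeff (adaptedFrame X') x u 1 * O 1 0 x,
          coeff (adaptedFrame X') x u 0 * O 0 1 x + coeff (adaptedFrame X') x u 1 * O 1 1 x,
          coeff (adaptedFrame X') x u 2 * det₂ O x,
          det₂ O x * (coeff (adaptedFrame X') x u 3 * O 0 0 x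
            + coeff (adaptedFrame X') x u 4 * O 1 0 x),
          det₂ O x * (coeff (adaptedFrame X') x u 3 * O 0 1 x
            + coeff (adaptedFrame X') x u 4 * O 1 1 x)] k
      rw [← e]
      congr 1
      conv_lhs => rw [← hu]
      have a0 : adaptedFrame X' 0 x = O 0 0 x • X 0 x + O 0 1 x • X 1 x := by
        exact (hOX 0 x hx).trans (Fin.sum_univ_two _)
      have a1 : adaptedFrame X' 1 x = O 1 0 x • X 0 x + O 1 1 x • X 1 x := by
        exact (hOX 1 x hx).trans (Fin.sum_univ_two _)
      have a2 : adaptedFrame X' 2 x = det₂ O x • fieldZ X x := hOZ x hx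
      have a3 : adaptedFrame X' 3 x = (det₂ O x * O 0 0 x) • fieldY X 0 x
          + (det₂ O x * O 0 1 x) • fieldY X 1 x := by
        exact (hOY 0 x hx).trans (Fin.sum_univ_two _)
      have a4 : adaptedFrame X' 4 x = (det₂ O x * O 1 0 x) • fieldY X 0 x
          + (det₂ O x * O 1 1 x) • fieldY X 1 x := by
        exact (hOY 1 x hx).trans (Fin.sum_univ_two _)
      have b0 : adaptedFrame X 0 x = X 0 x := rfl
      have b1 : adaptedFrame X 1 x = X 1 x := rfl
      have b2 : adaptedFrame X 2 x = fieldZ X x := rfl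
      have b3 : adaptedFrame X 3 x = fieldY X 0 x := rfl
      have b4 : adaptedFrame X 4 x = fieldY X 1 x := rfl
      rw [Fin.sum_univ_five, Fin.sum_univ_five, a0, a1, a2, a3, a4, b0, b1, b2, b3, b4]
      simp only [Matrix.cons_val]
      module
    funext u v
    simp only [gbar, frameMetric, Fin.sum_univ_five, key u, key v]
    simp
    generalize coeff (adaptedFrame X') x u = a
    generalize coeff (adaptedFrame X') x v = b
    linear_combination a 0 * b 0 * r00 + (a 0 * b 1 + a 1 * b 0) * r01 + a 1 * b 1 * r11
      + a 2 * b 2 * hd + det₂ O x * det₂ O x * (a 3 * b 3 * r00 + (a 3 * b 4 + a 4 * b 3) * r01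
      + a 4 * b 4 * r11) + (a 3 * b 3 + a 4 * b 4) * hd
  · unfold TMm2
    rw [hOZ x hx]
    have : IsUnit (det₂ O x) := IsUnit.of_mul_eq_one _ hd
    exact (Submodule.span_singleton_smul_eq this _).symm
  · unfold TMm3
    have y0 := hOY 0 x hx
    have y1 := hOY 1 x hx
    rw [Fin.sum_univ_two] at y0 y1
    refine le_antisymm (Submodule.span_le.2 ?_) (Submodule.span_le.2 ?_)
    · rintro _ ⟨j, rfl⟩
      have e : fieldY X j x = (det₂ O x * O 0 j x) • fieldY X' 0 x
          + (det₂ O x * O 1 j x) • fieldY X' 1 x := by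
        rw [y0, y1]
        fin_cases j
        · simp only [Fin.zero_eta]
          match_scalars
          · linear_combination -hd - det₂ O x * det₂ O x * c00
          · linear_combination - det₂ O x * det₂ O x * c01
        · simp only [Fin.mk_one]
          match_scalars
          · linear_combination -hd - det₂ O x * det₂ O x * c11
          · linear_combination - det₂ O x * det₂ O x * c01
      change fieldY X j x ∈ _
      rw [e]
      exact Submodule.add_mem _ (Submodule.smul_mem _ _ (Submodule.subset_span ⟨0, rfl⟩))
        (Submodule.smul_mem _ _ (Submodule.subset_span ⟨1, rfl⟩))
    · rintro _ ⟨j, rfl⟩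
      change fieldY X' j x ∈ _
      rw [hOY j x hx, Fin.sum_univ_two]
      exact Submodule.add_mem _ (Submodule.smul_mem _ _ (Submodule.subset_span ⟨0, rfl⟩))
        (Submodule.smul_mem _ _ (Submodule.subset_span ⟨1, rfl⟩))

end SubRiemannianStructure.IsOrthonormalFrameOn

end Rotation

/-! ### Connections in a frame and the Levi-Civita connection -/

section Connections

variable {M : Type*} [TopologicalSpace M] [ChartedSpace (EuclideanSpace ℝ (Fin 5)) M]
  [IsManifold (𝓡 5) ∞ M]

variable {F : Fin 5 → VField 5 M} {V W : VField 5 M} {U : Set M} {x : M} {D : Conn 5 M}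
  {Γ : Fin 5 → Fin 5 → Fin 5 → M → ℝ}

/-- `D` is a connection on the tangent bundle over `U`. -/
abbrev IsConn (D : Conn 5 M) (U : Set M) : Prop :=
  IsCovariantDerivativeOn (EuclideanSpace ℝ (Fin 5)) D U

section General

theorem nabla_congr_left (h : V x = W x) {Y : VField 5 M} : nabla D V Y x = nabla D W Y x := by
  simp [nabla, h]

theorem nabla_sum_left {ι : Type*} {s : Finset ι} {c : ι → ℝ} {G : ι → VField 5 M}
    {Y : VField 5 M} (h : V x = ∑ i ∈ s, c i • G i x) :
    nabla D V Y x = ∑ i ∈ s, c i • nabla D (G i) Y x := by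
  simp [nabla, h]

theorem nabla_congr_right (hD : IsConn D U) (hU : IsOpen U) (hx : x ∈ U) {Y Y' : VField 5 M}
    (hY : SmoothOn Y U) (h : ∀ y ∈ U, Y' y = Y y) : nabla D V Y' x = nabla D V Y x := by
  have := hD.congr_of_eqOn ((hY.congr h).mdiffAt hU hx) (hY.mdiffAt hU hx) (hU.mem_nhds hx) h
  simp [nabla, this]

/-- Additivity and the Leibniz rule. This reduces every covariant derivative to derivatives of
coefficients and of frame fields. -/
theorem nabla_comb {ι : Type*} {s : Finset ι} {b : ι → M → ℝ} {G : ι → VField 5 M}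
    (hD : IsConn D U) (hU : IsOpen U) (hx : x ∈ U) (hb : ∀ j, SmoothFun (b j) U)
    (hG : ∀ j, SmoothOn (G j) U) :
    nabla D V (fun y => ∑ j ∈ s, b j y • G j y) x =
      ∑ j ∈ s, (dir V (b j) x • G j x + b j x • nabla D V (G j) x) := by
  classical
  induction s using Finset.induction_on with
  | empty =>
    have : (fun y => ∑ j ∈ (∅ : Finset ι), b j y • G j y) = (0 : VField 5 M) := by ext y; simp
    rw [this]
    simp [nabla, hD.zero hx]
  | insert a s ha ih =>
    have : (fun y => ∑ j ∈ insert a s, b j y • G j y) =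
        b a • G a + fun y => ∑ j ∈ s, b j y • G j y := by
      ext y
      simp [Finset.sum_insert ha]
    have h1 := hD.add (((hG a).smul (hb a)).mdiffAt hU hx)
      ((SmoothOn.sum (s := s) (F := fun j => b j • G j) fun j => (hG j).smul (hb j)).mdiffAt hU hx)
      hx
    have h2 := hD.leibniz ((hG a).mdiffAt hU hx) ((hb a).mdiffAt hU hx) hx
    rw [Finset.sum_insert ha, ← ih, this]
    unfold nabla
    refine (congrArg (fun L => L (V x)) h1).trans ?_
    change D (b a • G a) x (V x) + _ = _
    rw [h2]
    simp only [_root_.add_apply, _root_.smul_apply,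
      ContinuousLinearMap.smulRight_apply]
    rw [add_comm (b a x • _)]
    rfl

/-- A connection in a frame. -/
theorem nabla_eq_sum (hF : SmoothFrame F U) (hD : IsConn D U) (hU : IsOpen U) (hx : x ∈ U)
    (hW : SmoothOn W U) :
    nabla D V W x = ∑ j, (dir V (fun y => coeff F y (W y) j) x • F j x
      + coeff F x (W x) j • ∑ i, coeff F x (V x) i • nabla D (F i) (F j) x) := by
  have e : ∀ j, ∑ i, coeff F x (V x) i • nabla D (F i) (F j) x = nabla D V (F j) x := fun j =>
    (nabla_sum_left (SmoothFrame.sum_coeff hF hx (V x)).symm).symm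
  simp only [e]
  rw [← nabla_comb hD hU hx (SmoothFrame.smoothFun_coeff hF hU hW) hF.smooth]
  exact (nabla_congr_right hD hU hx hW fun y hy => SmoothFrame.sum_coeff hF hy _).symm

theorem frameMetric_frame_right (hF : SmoothFrame F U) (hx : x ∈ U) (u : TangentSpace (𝓡 5) x)
    (k : Fin 5) : frameMetric F x u (F k x) = coeff F x u k := by
  simp [frameMetric, SmoothFrame.coeff_frame hF hx]

theorem frameMetric_comm (u v : TangentSpace (𝓡 5) x) :
    frameMetric F x u v = frameMetric F x v u := by
  simp [frameMetric, mul_comm]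

end General

/-- The connection with `∇_{F_i} F_j = ∑ k, Γ_{ij}^k F_k`. -/
def frameConn (F : Fin 5 → VField 5 M) (Γ : Fin 5 → Fin 5 → Fin 5 → M → ℝ) : Conn 5 M :=
  fun W x => ∑ k, (mvfderiv (𝓡 5) (fun y => coeff F y (W y) k) x
    + ∑ i, ∑ j, (Γ i j k x * coeff F x (W x) j) • coeffHom F x i).smulRight (F k x)

theorem coeff_frameConn (hF : SmoothFrame F U) (hx : x ∈ U) (W : VField 5 M)
    (v : TangentSpace (𝓡 5) x) (k : Fin 5) :
    coeff F x (frameConn F Γ W x v) k = mvfderiv (𝓡 5) (fun y => coeff F y (W y) k) x v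
      + ∑ i, ∑ j, Γ i j k x * coeff F x (W x) j * coeff F x v i := by
  have e : frameConn F Γ W x v = ∑ k, (mvfderiv (𝓡 5) (fun y => coeff F y (W y) k) x v
      + ∑ i, ∑ j, Γ i j k x * coeff F x (W x) j * coeff F x v i) • F k x := by
    simp [frameConn]
  rw [e, SmoothFrame.coeff_comb hF hx]

theorem coeff_nabla_frameConn (hF : SmoothFrame F U) (hx : x ∈ U) (V W : VField 5 M) (k : Fin 5) :
    coeff F x (nabla (frameConn F Γ) V W x) k = dir V (fun y => coeff F y (W y) k) x
      + ∑ i, ∑ j, Γ i j k x * coeff F x (W x) j * coeff F x (V x) i :=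
  coeff_frameConn hF hx W (V x) k

theorem coeff_nabla_frameConn_frame (hF : SmoothFrame F U) (hU : IsOpen U) (hx : x ∈ U)
    (i j k : Fin 5) :
    coeff F x (nabla (frameConn F Γ) (F i) (F j) x) k = Γ i j k x := by
  rw [coeff_nabla_frameConn hF hx,
    dir_eq_zero_of_eqOn_const hU hx fun y hy => SmoothFrame.coeff_frame hF hy j k]
  simp [SmoothFrame.coeff_frame hF hx]

/-- Differentiating coefficients satisfies the Leibniz rule and the `Γ`-term is linear over
functions. No regularity of `Γ` is involved. -/
theorem isConn_frameConn (hF : SmoothFrame F U) (hU : IsOpen U) : IsConn (frameConn F Γ) U where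
  add {σ σ' x} hσ hσ' hx := by
    ext1 v
    refine SmoothFrame.ext_coeff hF hx fun k => ?_
    rw [_root_.add_apply, coeff_add, coeff_frameConn hF hx, coeff_frameConn hF hx,
      coeff_frameConn hF hx]
    have e : (fun y => coeff F y ((σ + σ') y) k) =
        (fun y => coeff F y (σ y) k) + fun y => coeff F y (σ' y) k := by
      ext y
      exact coeff_add F y _ _ k
    rw [e, mvfderiv_add (SmoothFrame.mdiffAt_coeff hF hU hx hσ k)
      (SmoothFrame.mdiffAt_coeff hF hU hx hσ' k)]
    simp only [Pi.add_apply, coeff_add, mul_add, add_mul, Finset.sum_add_distrib,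
      _root_.add_apply]
    ring
  leibniz {σ g x} hσ hg hx := by
    ext1 v
    refine SmoothFrame.ext_coeff hF hx fun k => ?_
    have e : (fun y => coeff F y ((g • σ) y) k) = g * fun y => coeff F y (σ y) k := by
      ext y
      exact coeff_smul F y _ k _
    rw [coeff_frameConn hF hx, e, mvfderiv_mul hg (SmoothFrame.mdiffAt_coeff hF hU hx hσ k)]
    simp only [_root_.add_apply, _root_.smul_apply,
      ContinuousLinearMap.smulRight_apply, coeff_add, coeff_smul, coeff_frameConn hF hx,
      Pi.smul_apply', smul_eq_mul, mul_add, Finset.mul_sum]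
    have e2 : ∀ i j, Γ i j k x * (g x * coeff F x (σ x) j) * coeff F x v i =
        g x * (Γ i j k x * coeff F x (σ x) j * coeff F x v i) := fun i j => by ring
    simp only [e2]
    ring

/-- The Christoffel symbols of the Levi-Civita connection in an orthonormal frame. -/
def koszul (F : Fin 5 → VField 5 M) (i j k : Fin 5) (x : M) : ℝ :=
  1 / 2 * (structConst F i j k x - structConst F j k i x + structConst F k i j x)

/-- Compatibility with the metric, expressed on an orthonormal frame, where inner products of frame
fields have zero derivative. -/
theorem koszul_skew (i j k : Fin 5) (x : M) : koszul F i k j x = - koszul F i j k x := by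
  unfold koszul
  rw [SmoothFrame.structConst_swap F i k j, SmoothFrame.structConst_swap F k j i,
    SmoothFrame.structConst_swap F j i k]
  ring

/-- Freedom from torsion, expressed on the frame. -/
theorem koszul_sub (i j k : Fin 5) (x : M) :
    koszul F i j k x - koszul F j i k x = structConst F i j k x := by
  unfold koszul
  rw [SmoothFrame.structConst_swap F j i k, SmoothFrame.structConst_swap F i k j,
    SmoothFrame.structConst_swap F k j i]
  ring

theorem isLeviCivitaOn_frameConn (hF : SmoothFrame F U) (hU : IsOpen U) :
    IsLeviCivitaOn (frameMetric F) U (frameConn F (koszul F)) where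
  isConnection := isConn_frameConn hF hU
  torsion_free V W hV hW x hx := by
    refine SmoothFrame.ext_coeff hF hx fun k => ?_
    simp only [torsion, coeff_sub, coeff_zero, coeff_nabla_frameConn hF hx,
      SmoothFrame.coeff_lie hF hU hx hV hW]
    rw [Finset.sum_comm (f := fun i j => koszul F i j k x * coeff F x (V x) j * coeff F x (W x) i)]
    have e : ∀ i j, coeff F x (V x) i * coeff F x (W x) j * structConst F i j k x =
        koszul F i j k x * coeff F x (W x) j * coeff F x (V x) i
        - koszul F j i k x * coeff F x (V x) i * coeff F x (W x) j := by
      intro i j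
      rw [← koszul_sub]
      ring
    simp only [e, Finset.sum_sub_distrib]
    ring
  metric V Y W hV hY hW x hx := by
    have sY := fun k => (SmoothFrame.smoothFun_coeff hF hU hY k).mdiffAt hU hx
    have sW := fun k => (SmoothFrame.smoothFun_coeff hF hU hW k).mdiffAt hU hx
    simp only [frameMetric, coeff_nabla_frameConn hF hx]
    rw [dir_sum (F := fun k y => coeff F y (Y y) k * coeff F y (W y) k)
      fun k => (sY k).mul (sW k)]
    simp only [dir_mul (sY _) (sW _)]
    have e1 : ∑ k, (∑ i, ∑ j, koszul F i j k x * coeff F x (Y x) j * coeff F x (V x) i)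
          * coeff F x (W x) k =
        ∑ k, ∑ j, ∑ i, koszul F i j k x * coeff F x (Y x) j * coeff F x (V x) i
          * coeff F x (W x) k := by
      refine Finset.sum_congr rfl fun k _ => ?_
      rw [Finset.sum_comm, Finset.sum_mul]
      exact Finset.sum_congr rfl fun j _ => Finset.sum_mul _ _ _
    have e2 : ∑ k, coeff F x (Y x) k *
          (∑ i, ∑ j, koszul F i j k x * coeff F x (W x) j * coeff F x (V x) i) =
        - ∑ k, ∑ j, ∑ i, koszul F i j k x * coeff F x (Y x) j * coeff F x (V x) i
          * coeff F x (W x) k := by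
      rw [Finset.sum_comm (f := fun k j => ∑ i, koszul F i j k x * coeff F x (Y x) j *
        coeff F x (V x) i * coeff F x (W x) k), ← Finset.sum_neg_distrib]
      refine Finset.sum_congr rfl fun k _ => ?_
      rw [Finset.sum_comm, Finset.mul_sum, ← Finset.sum_neg_distrib]
      refine Finset.sum_congr rfl fun j _ => ?_
      rw [Finset.mul_sum, ← Finset.sum_neg_distrib]
      refine Finset.sum_congr rfl fun i _ => ?_
      rw [koszul_skew]
      ring
    simp only [add_mul, mul_add, Finset.sum_add_distrib, e1, e2]
    ring

/-- The Christoffel symbols of any Levi-Civita connection of the frame metric. -/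
theorem IsLeviCivitaOn.coeff_nabla (hF : SmoothFrame F U) (hU : IsOpen U)
    (hD : IsLeviCivitaOn (frameMetric F) U D) (hx : x ∈ U) (i j k : Fin 5) :
    coeff F x (nabla D (F i) (F j) x) k = koszul F i j k x := by
  have s := hF.smooth
  have hT : ∀ i j k, coeff F x (nabla D (F i) (F j) x) k - coeff F x (nabla D (F j) (F i) x) k =
      structConst F i j k x := by
    intro i j k
    have h := congrArg (fun w => coeff F x w k) (hD.torsion_free _ _ (s i) (s j) x hx)
    simp only [torsion, coeff_sub, coeff_zero] at h
    exact sub_eq_zero.1 h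
  have hS : ∀ i j k, coeff F x (nabla D (F i) (F j) x) k + coeff F x (nabla D (F i) (F k) x) j
      = 0 := by
    intro i j k
    have h := hD.metric _ _ _ (s i) (s j) (s k) x hx
    rw [frameMetric_comm (F j x), frameMetric_frame_right hF hx, frameMetric_frame_right hF hx] at h
    rw [← h]
    refine dir_eq_zero_of_eqOn_const (c := if j = k then 1 else 0) hU hx fun y hy => ?_
    rw [frameMetric_frame_right hF hy, SmoothFrame.coeff_frame hF hy]
  unfold koszul
  -- The usual Koszul argument: the alternating sum of the torsion identities isolates one symbol,
  -- once the skewness relations remove the others.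
  linear_combination 1 / 2 * (hT i j k - hT j k i + hT k i j) + 1 / 2 * (hS i j k + hS j i k
    - hS k i j)

end Connections

/-! ### Existence and uniqueness of the canonical connection -/

section Canonical

variable {M : Type*} [TopologicalSpace M] [ChartedSpace (EuclideanSpace ℝ (Fin 5)) M]
  [IsManifold (𝓡 5) ∞ M]

variable {S : SubRiemannianStructure 5 M} {X : Fin 2 → VField 5 M} {U : Set M} {x : M}
  {D nab nab' : Conn 5 M}

/-- The connection form of the canonical connection: the coefficient of `X₂` in `∇_{F_a} X₁`, where
`F` is the adapted frame. -/
def connForm (X : Fin 2 → VField 5 M) (a : Fin 5) (x : M) : ℝ :=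
  1 / 2 * (structConst (adaptedFrame X) a 0 1 x - structConst (adaptedFrame X) a 1 0 x
    - ![structConst (adaptedFrame X) 0 1 0 x, structConst (adaptedFrame X) 0 1 1 x, 0, 0, 0] a)

/-- The value of the connection form on a vector field. -/
def connFormOn (X : Fin 2 → VField 5 M) (V : VField 5 M) (x : M) : ℝ :=
  ∑ a, coeff (adaptedFrame X) x (V x) a * connForm X a x

/-- The Christoffel symbols of the canonical connection in the adapted frame. -/
def christoffel (X : Fin 2 → VField 5 M) (a j k : Fin 5) (x : M) : ℝ :=
  connForm X a x * (!![0, 1, 0, 0, 0; -1, 0, 0, 0, 0; 0, 0, 0, 0, 0; 0, 0, 0, 0, 1;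
    0, 0, 0, -1, 0] : Matrix (Fin 5) (Fin 5) ℝ) j k

section Membership

theorem mem_E_iff (hX : S.IsOrthonormalFrameOn X U) (hF : SmoothFrame (adaptedFrame X) U)
    (hx : x ∈ U) {v : TangentSpace (𝓡 5) x} :
    v ∈ S.E x ↔ coeff (adaptedFrame X) x v 2 = 0 ∧ coeff (adaptedFrame X) x v 3 = 0 ∧
      coeff (adaptedFrame X) x v 4 = 0 := by
  have f0 : ∀ k, coeff (adaptedFrame X) x (X 0 x) k = _ := SmoothFrame.coeff_frame hF hx 0
  have f1 : ∀ k, coeff (adaptedFrame X) x (X 1 x) k = _ := SmoothFrame.coeff_frame hF hx 1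
  constructor
  · intro h
    rw [← hX.span_eq x hx] at h
    obtain ⟨c, rfl⟩ := (Submodule.mem_span_range_iff_exists_fun ℝ).1 h
    simp [coeff_add, coeff_smul, f0, f1]
  · rintro ⟨h2, h3, h4⟩
    rw [← SmoothFrame.sum_coeff hF hx v, Fin.sum_univ_five, h2, h3, h4]
    simp only [zero_smul, add_zero]
    exact (S.E x).add_mem ((S.E x).smul_mem _ (hX.mem hx 0)) ((S.E x).smul_mem _ (hX.mem hx 1))

theorem mem_TMm2_iff (hF : SmoothFrame (adaptedFrame X) U)
    (hx : x ∈ U) {v : TangentSpace (𝓡 5) x} :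
    v ∈ TMm2 X x ↔ coeff (adaptedFrame X) x v 0 = 0 ∧ coeff (adaptedFrame X) x v 1 = 0 ∧
      coeff (adaptedFrame X) x v 3 = 0 ∧ coeff (adaptedFrame X) x v 4 = 0 := by
  have f2 : ∀ k, coeff (adaptedFrame X) x (fieldZ X x) k = _ := SmoothFrame.coeff_frame hF hx 2
  constructor
  · intro h
    obtain ⟨c, rfl⟩ := Submodule.mem_span_singleton.1 h
    simp [coeff_smul, f2]
  · rintro ⟨h0, h1, h3, h4⟩
    rw [← SmoothFrame.sum_coeff hF hx v, Fin.sum_univ_five, h0, h1, h3, h4]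
    simp only [zero_smul, add_zero, zero_add]
    exact Submodule.smul_mem _ _ (Submodule.mem_span_singleton_self _)

theorem mem_TMm3_iff (hF : SmoothFrame (adaptedFrame X) U)
    (hx : x ∈ U) {v : TangentSpace (𝓡 5) x} :
    v ∈ TMm3 X x ↔ coeff (adaptedFrame X) x v 0 = 0 ∧ coeff (adaptedFrame X) x v 1 = 0 ∧
      coeff (adaptedFrame X) x v 2 = 0 := by
  have f3 : ∀ k, coeff (adaptedFrame X) x (fieldY X 0 x) k = _ := SmoothFrame.coeff_frame hF hx 3
  have f4 : ∀ k, coeff (adaptedFrame X) x (fieldY X 1 x) k = _ := SmoothFrame.coeff_frame hF hx 4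
  constructor
  · intro h
    obtain ⟨c, rfl⟩ := (Submodule.mem_span_range_iff_exists_fun ℝ).1 h
    simp [coeff_add, coeff_smul, f3, f4]
  · rintro ⟨h0, h1, h2⟩
    rw [← SmoothFrame.sum_coeff hF hx v, Fin.sum_univ_five, h0, h1, h2]
    simp only [zero_smul, zero_add]
    exact Submodule.add_mem _ (Submodule.smul_mem _ _ (Submodule.subset_span ⟨0, rfl⟩))
      (Submodule.smul_mem _ _ (Submodule.subset_span ⟨1, rfl⟩))

end Membership

section Rules

theorem gbar_X_right (hF : SmoothFrame (adaptedFrame X) U) (hx : x ∈ U)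
    (u : TangentSpace (𝓡 5) x) (k : Fin 2) :
    gbar X x u (X k x) = coeff (adaptedFrame X) x u (![0, 1] k) := by
  fin_cases k
  · exact frameMetric_frame_right hF hx u 0
  · exact frameMetric_frame_right hF hx u 1

theorem gbar_Y_right (hF : SmoothFrame (adaptedFrame X) U) (hx : x ∈ U)
    (u : TangentSpace (𝓡 5) x) (k : Fin 2) :
    gbar X x u (fieldY X k x) = coeff (adaptedFrame X) x u (![3, 4] k) := by
  fin_cases k
  · exact frameMetric_frame_right hF hx u 3
  · exact frameMetric_frame_right hF hx u 4

/-- The rule for `∇_{X_i}`. -/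
theorem gbar_leviCivita (hF : SmoothFrame (adaptedFrame X) U) (hU : IsOpen U)
    (hD : IsLeviCivitaOn (gbar X) U D) (hx : x ∈ U) (i j k : Fin 2) :
    gbar X x (nabla D (X i) (X j) x) (X k x) =
      christoffel X (![0, 1] i) (![0, 1] j) (![0, 1] k) x := by
  rw [gbar_X_right hF hx]
  have key : ∀ i j : Fin 2, nabla D (X i) (X j) x =
      nabla D (adaptedFrame X (![0, 1] i)) (adaptedFrame X (![0, 1] j)) x := by
    intro i j
    fin_cases i <;> fin_cases j <;> rfl
  rw [key, IsLeviCivitaOn.coeff_nabla hF hU hD hx]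
  have sw := SmoothFrame.structConst_swap (adaptedFrame X)
  have se := SmoothFrame.structConst_self (adaptedFrame X)
  -- For `a` equal to `0` or `1`, the Koszul symbol `(a, 0, 1)` contains the extra term `-c_{01}^a`.
  -- This is the origin of the correction vector in `connForm`.
  unfold koszul christoffel connForm
  fin_cases i <;> fin_cases j <;> fin_cases k <;> simp [se, sw 1 0] <;> ring

/-- The rule for `∇_{F_a}`, `F_a` being `Z` or one of the `Y_i`. -/
theorem gbar_lie_add_lieDerivForm (hF : SmoothFrame (adaptedFrame X) U) (hU : IsOpen U)
    (hx : x ∈ U) (a : Fin 5) (ha : a = 2 ∨ a = 3 ∨ a = 4) (j k : Fin 2) :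
    gbar X x (lie (adaptedFrame X a) (X j) x) (X k x)
      + 1 / 2 * lieDerivForm (gbar X) (adaptedFrame X a) (X j) (X k) x =
      christoffel X a (![0, 1] j) (![0, 1] k) x := by
  have key : ∀ j : Fin 2, X j = adaptedFrame X (![0, 1] j) := by
    intro j
    fin_cases j <;> rfl
  unfold lieDerivForm
  -- Orthonormality makes this function constant, so the Lie derivative of the metric consists of
  -- bracket terms only.
  have h0 : dir (adaptedFrame X a) (fun y => gbar X y (X j y) (X k y)) x = 0 := by
    refine dir_eq_zero_of_eqOn_const (c := if (![0, 1] j : Fin 5) = ![0, 1] k then 1 else 0) hU hx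
      fun y hy => ?_
    rw [gbar_X_right hF hy, key j, SmoothFrame.coeff_frame hF hy]
  have hcomm : gbar X x (X j x) (lie (adaptedFrame X a) (X k) x) =
      gbar X x (lie (adaptedFrame X a) (X k) x) (X j x) := frameMetric_comm _ _
  rw [h0, hcomm, gbar_X_right hF hx, gbar_X_right hF hx]
  have e : ∀ j k : Fin 2, coeff (adaptedFrame X) x (lie (adaptedFrame X a) (X j) x) (![0, 1] k) =
      structConst (adaptedFrame X) a (![0, 1] j) (![0, 1] k) x := by
    intro j k
    rw [key j]
    rfl
  rw [e, e]
  -- Half of the Lie derivative removes the symmetric part in `j, k` of the bracket coefficients,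
  -- and what is left is skew. For these `a` the correction in `connForm` is zero.
  unfold christoffel connForm
  rcases ha with rfl | rfl | rfl <;> fin_cases j <;> fin_cases k <;> simp <;> ring

end Rules

/-- The matrix in `christoffel` is block diagonal with a zero block for `Z`; this gives the parallel
subbundles and `∇Z = 0`. The other rules are the two computations above. -/
theorem isCanonicalConnectionOn_frameConn (hX : S.IsOrthonormalFrameOn X U)
    (hF : SmoothFrame (adaptedFrame X) U) (hU : IsOpen U) (hD : IsLeviCivitaOn (gbar X) U D) :
    IsCanonicalConnectionOn S X U D (frameConn (adaptedFrame X) (christoffel X)) := by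
  have hG := fun (y : M) (hy : y ∈ U) i j k =>
    coeff_nabla_frameConn_frame (Γ := christoffel X) hF hU hy i j k
  have dz : ∀ (V W : VField 5 M) (k : Fin 5) (y : M), y ∈ U →
      (∀ z ∈ U, coeff (adaptedFrame X) z (W z) k = 0) →
      dir V (fun z => coeff (adaptedFrame X) z (W z) k) y = 0 := fun V W k y hy h =>
    dir_eq_zero_of_eqOn_const hU hy h
  have eX : ∀ j : Fin 2, X j = adaptedFrame X (![0, 1] j) := by
    intro j
    fin_cases j <;> rfl
  have eY : ∀ j : Fin 2, fieldY X j = adaptedFrame X (![3, 4] j) := by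
    intro j
    fin_cases j <;> rfl
  have eZ : fieldZ X = adaptedFrame X 2 := rfl
  -- The same generator of rotations stands in the block of `E` and in the block of the `Y`-fields,
  -- so each rule for `Y` follows from the one for `X`.
  have blockY : ∀ a (j k : Fin 2) y, christoffel X a (![3, 4] j) (![3, 4] k) y =
      christoffel X a (![0, 1] j) (![0, 1] k) y := by
    intro a j k y
    fin_cases j <;> fin_cases k <;> simp [christoffel]
  refine ⟨isConn_frameConn hF hU, ?_, ?_, ?_, ?_, ?_, ?_, ?_, ?_, ?_, ?_⟩
  · intro V W hV hW hWE y hy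
    rw [mem_E_iff hX hF hy]
    have h : ∀ z ∈ U, _ := fun z hz => (mem_E_iff hX hF hz).1 (hWE z hz)
    have h2 := dz V W 2 y hy fun z hz => (h z hz).1
    have h3 := dz V W 3 y hy fun z hz => (h z hz).2.1
    have h4 := dz V W 4 y hy fun z hz => (h z hz).2.2
    have hy' := h y hy
    simp [coeff_nabla_frameConn hF hy, h2, h3, h4, Fin.sum_univ_five, christoffel, hy']
  · intro V W hV hW hWE y hy
    rw [mem_TMm2_iff hF hy]
    have h : ∀ z ∈ U, _ := fun z hz => (mem_TMm2_iff hF hz).1 (hWE z hz)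
    have h0 := dz V W 0 y hy fun z hz => (h z hz).1
    have h1 := dz V W 1 y hy fun z hz => (h z hz).2.1
    have h3 := dz V W 3 y hy fun z hz => (h z hz).2.2.1
    have h4 := dz V W 4 y hy fun z hz => (h z hz).2.2.2
    have hy' := h y hy
    simp [coeff_nabla_frameConn hF hy, h0, h1, h3, h4, Fin.sum_univ_five, christoffel, hy']
  · intro V W hV hW hWE y hy
    rw [mem_TMm3_iff hF hy]
    have h : ∀ z ∈ U, _ := fun z hz => (mem_TMm3_iff hF hz).1 (hWE z hz)
    have h0 := dz V W 0 y hy fun z hz => (h z hz).1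
    have h1 := dz V W 1 y hy fun z hz => (h z hz).2.1
    have h2 := dz V W 2 y hy fun z hz => (h z hz).2.2
    have hy' := h y hy
    simp [coeff_nabla_frameConn hF hy, h0, h1, h2, Fin.sum_univ_five, christoffel, hy']
  · intro V hV y hy
    refine SmoothFrame.ext_coeff hF hy fun k => ?_
    have h : ∀ k, ∀ z ∈ U, coeff (adaptedFrame X) z (fieldZ X z) k = if 2 = k then 1 else 0 :=
      fun k z hz => SmoothFrame.coeff_frame hF hz 2 k
    have hd : dir V (fun z => coeff (adaptedFrame X) z (fieldZ X z) k) y = 0 :=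
      dir_eq_zero_of_eqOn_const hU hy (h k)
    rw [coeff_nabla_frameConn hF hy, hd, coeff_zero]
    fin_cases k <;> simp [christoffel, h _ y hy]
  · intro i j k y hy
    rw [gbar_leviCivita hF hU hD hy, gbar_X_right hF hy]
    rw [eX i, eX j, hG y hy]
  · intro i j k y hy
    rw [gbar_leviCivita hF hU hD hy, gbar_Y_right hF hy]
    rw [eX i, eY j, hG y hy, blockY]
  · intro j k y hy
    rw [eZ, gbar_lie_add_lieDerivForm hF hU hy 2 (by simp), gbar_X_right hF hy]
    rw [eX j, hG y hy]
  · intro j k y hy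
    rw [eZ, gbar_lie_add_lieDerivForm hF hU hy 2 (by simp), gbar_Y_right hF hy]
    rw [eY j, hG y hy, blockY]
  · intro i j k y hy
    rw [eY i, gbar_lie_add_lieDerivForm hF hU hy _ (by fin_cases i <;> simp), gbar_X_right hF hy]
    rw [eX j, hG y hy]
  · intro i j k y hy
    rw [eY i, gbar_lie_add_lieDerivForm hF hU hy _ (by fin_cases i <;> simp), gbar_Y_right hF hy]
    rw [eY j, hG y hy, blockY]

/-- The rules determine the Christoffel symbols. -/
theorem IsCanonicalConnectionOn.coeff_nabla (hX : S.IsOrthonormalFrameOn X U)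
    (hF : SmoothFrame (adaptedFrame X) U) (hU : IsOpen U) (hD : IsLeviCivitaOn (gbar X) U D)
    (h : IsCanonicalConnectionOn S X U D nab) (hx : x ∈ U) (a j k : Fin 5) :
    coeff (adaptedFrame X) x (nabla nab (adaptedFrame X a) (adaptedFrame X j) x) k =
      christoffel X a j k x := by
  have eX : ∀ j : Fin 2, X j = adaptedFrame X (![0, 1] j) := by
    intro j
    fin_cases j <;> rfl
  have eY : ∀ j : Fin 2, fieldY X j = adaptedFrame X (![3, 4] j) := by
    intro j
    fin_cases j <;> rfl
  have eZ : fieldZ X = adaptedFrame X 2 := rfl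
  have blockY : ∀ a (j k : Fin 2) y, christoffel X a (![3, 4] j) (![3, 4] k) y =
      christoffel X a (![0, 1] j) (![0, 1] k) y := by
    intro a j k y
    fin_cases j <;> fin_cases k <;> simp [christoffel]
  -- The entries inside the two `2 × 2` blocks are prescribed by the rules. All other entries vanish
  -- by parallelism and `∇Z = 0`.
  let P : Fin 5 → Prop := fun a =>
    (∀ j k : Fin 2, coeff (adaptedFrame X) x
        (nabla nab (adaptedFrame X a) (adaptedFrame X (![0, 1] j)) x) (![0, 1] k) =
        christoffel X a (![0, 1] j) (![0, 1] k) x) ∧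
      (∀ j k : Fin 2, coeff (adaptedFrame X) x
        (nabla nab (adaptedFrame X a) (adaptedFrame X (![3, 4] j)) x) (![3, 4] k) =
        christoffel X a (![0, 1] j) (![0, 1] k) x)
  have block : P a := by
    have hXi : ∀ i : Fin 2, P (![0, 1] i) := by
      intro i
      refine ⟨fun j k => ?_, fun j k => ?_⟩
      · have e := h.nabla_X_X i j k x hx
        rw [gbar_leviCivita hF hU hD hx, gbar_X_right hF hx, eX i, eX j] at e
        exact e
      · have e := h.nabla_X_Y i j k x hx
        rw [gbar_leviCivita hF hU hD hx, gbar_Y_right hF hx, eX i, eY j] at e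
        exact e
    have hYi : ∀ i : Fin 2, P (![3, 4] i) := by
      intro i
      refine ⟨fun j k => ?_, fun j k => ?_⟩
      · have e := h.nabla_Y_X i j k x hx
        rw [eY i, gbar_lie_add_lieDerivForm hF hU hx _ (by fin_cases i <;> simp),
          gbar_X_right hF hx, eX j] at e
        exact e
      · have e := h.nabla_Y_Y i j k x hx
        rw [eY i, gbar_lie_add_lieDerivForm hF hU hx _ (by fin_cases i <;> simp),
          gbar_Y_right hF hx, eY j] at e
        exact e
    fin_cases a
    · exact hXi 0
    · exact hXi 1
    · refine ⟨fun j k => ?_, fun j k => ?_⟩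
      · have e := h.nabla_Z_X j k x hx
        rw [eZ, gbar_lie_add_lieDerivForm hF hU hx 2 (by simp), gbar_X_right hF hx, eX j] at e
        exact e
      · have e := h.nabla_Z_Y j k x hx
        rw [eZ, gbar_lie_add_lieDerivForm hF hU hx 2 (by simp), gbar_Y_right hF hx, eY j] at e
        exact e
    · exact hYi 0
    · exact hYi 1
  have pE : ∀ j : Fin 2, _ := fun j => (mem_E_iff hX hF hx).1
    (h.parallel_E _ _ (hF.smooth a) (hX.smooth j) (fun y hy => hX.mem hy j) x hx)
  have sY : ∀ j, SmoothOn (fieldY X j) U := by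
    intro j
    rw [eY]
    exact hF.smooth _
  have pY : ∀ j : Fin 2, _ := fun j => (mem_TMm3_iff hF hx).1
    (h.parallel_m3 _ _ (hF.smooth a) (sY j) (fun y hy => Submodule.subset_span ⟨j, rfl⟩) x hx)
  have pZ := h.nabla_Z _ (hF.smooth a) x hx
  have hE : ∀ j : Fin 2, ∀ k, coeff (adaptedFrame X) x
      (nabla nab (adaptedFrame X a) (adaptedFrame X (![0, 1] j)) x) k =
      christoffel X a (![0, 1] j) k x := by
    intro j k
    have p := pE j
    rw [eX j] at p
    fin_cases k
    · exact block.1 j 0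
    · exact block.1 j 1
    · refine p.1.trans ?_
      fin_cases j <;> simp [christoffel]
    · refine p.2.1.trans ?_
      fin_cases j <;> simp [christoffel]
    · refine p.2.2.trans ?_
      fin_cases j <;> simp [christoffel]
  have hY : ∀ j : Fin 2, ∀ k, coeff (adaptedFrame X) x
      (nabla nab (adaptedFrame X a) (adaptedFrame X (![3, 4] j)) x) k =
      christoffel X a (![3, 4] j) k x := by
    intro j k
    have p := pY j
    rw [eY j] at p
    fin_cases k
    · refine p.1.trans ?_
      fin_cases j <;> simp [christoffel]
    · refine p.2.1.trans ?_
      fin_cases j <;> simp [christoffel]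
    · refine p.2.2.trans ?_
      fin_cases j <;> simp [christoffel]
    · exact (block.2 j 0).trans (blockY a j 0 x).symm
    · exact (block.2 j 1).trans (blockY a j 1 x).symm
  fin_cases j
  · exact hE 0 k
  · exact hE 1 k
  · change coeff (adaptedFrame X) x (nabla nab (adaptedFrame X a) (fieldZ X) x) k = _
    rw [pZ, coeff_zero]
    fin_cases k <;> simp [christoffel]
  · exact hY 0 k
  · exact hY 1 k

theorem smoothFun_connForm (hF : SmoothFrame (adaptedFrame X) U) (hU : IsOpen U) (a : Fin 5) :
    SmoothFun (connForm X a) U := by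
  have s := SmoothFrame.smoothFun_structConst hF hU
  refine (SmoothFun.const (1 / 2)).mul (((s a 0 1).sub (s a 1 0)).sub ?_)
  fin_cases a
  exacts [s 0 1 0, s 0 1 1, SmoothFun.const 0, SmoothFun.const 0, SmoothFun.const 0]

/-- The canonical connection on the adapted frame. -/
theorem IsCanonicalConnectionOn.nabla_frame (hX : S.IsOrthonormalFrameOn X U)
    (hF : SmoothFrame (adaptedFrame X) U) (hU : IsOpen U) (hD : IsLeviCivitaOn (gbar X) U D)
    (h : IsCanonicalConnectionOn S X U D nab) (hx : x ∈ U) (V : VField 5 M) :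
    nabla nab V (X 0) x = connFormOn X V x • X 1 x ∧
    nabla nab V (X 1) x = -connFormOn X V x • X 0 x ∧
    nabla nab V (fieldZ X) x = 0 ∧
    nabla nab V (fieldY X 0) x = connFormOn X V x • fieldY X 1 x ∧
    nabla nab V (fieldY X 1) x = -connFormOn X V x • fieldY X 0 x := by
  have key : ∀ j, nabla nab V (adaptedFrame X j) x =
      connFormOn X V x • ![X 1 x, - X 0 x, 0, fieldY X 1 x, - fieldY X 0 x] j := by
    intro j
    rw [nabla_sum_left (SmoothFrame.sum_coeff hF hx (V x)).symm, connFormOn, Finset.sum_smul]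
    refine Finset.sum_congr rfl fun a _ => ?_
    rw [mul_smul]
    congr 1
    rw [← SmoothFrame.sum_coeff hF hx (nabla nab (adaptedFrame X a) (adaptedFrame X j) x)]
    simp only [h.coeff_nabla hX hF hU hD hx]
    have b0 : adaptedFrame X 0 x = X 0 x := rfl
    have b1 : adaptedFrame X 1 x = X 1 x := rfl
    have b3 : adaptedFrame X 3 x = fieldY X 0 x := rfl
    have b4 : adaptedFrame X 4 x = fieldY X 1 x := rfl
    fin_cases j <;> simp [Fin.sum_univ_five, christoffel, b0, b1, b3, b4]
  refine ⟨key 0, (key 1).trans (by simp), (key 2).trans (by simp), key 3, (key 4).trans (by simp)⟩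

/-- A connection on smooth fields is determined by its Christoffel symbols in a frame, and the rules
prescribe all of them. -/
theorem IsCanonicalConnectionOn.unique (hX : S.IsOrthonormalFrameOn X U)
    (hF : SmoothFrame (adaptedFrame X) U) (hU : IsOpen U) (hD : IsLeviCivitaOn (gbar X) U D)
    (h : IsCanonicalConnectionOn S X U D nab) (h' : IsCanonicalConnectionOn S X U D nab')
    (hx : x ∈ U) {V W : VField 5 M} (hW : SmoothOn W U) :
    nabla nab V W x = nabla nab' V W x := by
  rw [nabla_eq_sum hF h.isConnection hU hx hW, nabla_eq_sum hF h'.isConnection hU hx hW]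
  have e : ∀ i j, nabla nab (adaptedFrame X i) (adaptedFrame X j) x =
      nabla nab' (adaptedFrame X i) (adaptedFrame X j) x := fun i j =>
    SmoothFrame.ext_coeff hF hx fun k => by
      rw [h.coeff_nabla hX hF hU hD hx, h'.coeff_nabla hX hF hU hD hx]
  simp only [e]

end Canonical

/-! ### Pullback of vector fields by diffeomorphisms -/

section Pullback

variable {M : Type*} [TopologicalSpace M] [ChartedSpace (EuclideanSpace ℝ (Fin 5)) M]
  [IsManifold (𝓡 5) ∞ M]
  {N : Type*} [TopologicalSpace N] [ChartedSpace (EuclideanSpace ℝ (Fin 5)) N]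
  [IsManifold (𝓡 5) ∞ N]

/-- `Φ` is a diffeomorphism of its source onto its target. -/
structure IsDiffeo (Φ : OpenPartialHomeomorph M N) : Prop where
  smooth : ContMDiffOn (𝓡 5) (𝓡 5) ∞ Φ Φ.source
  smooth_symm : ContMDiffOn (𝓡 5) (𝓡 5) ∞ Φ.symm Φ.target

/-- The pullback of a vector field. -/
abbrev pull (Φ : M → N) (V : VField 5 N) : VField 5 M := mpullback (𝓡 5) (𝓡 5) Φ V

namespace IsDiffeo

variable {Φ : OpenPartialHomeomorph M N} {x : M} {V W : VField 5 N}

theorem contMDiffAt (h : IsDiffeo Φ) (hx : x ∈ Φ.source) :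
    ContMDiffAt (𝓡 5) (𝓡 5) ∞ Φ x :=
  h.smooth.contMDiffAt (Φ.open_source.mem_nhds hx)

theorem isInvertible (h : IsDiffeo Φ) (hx : x ∈ Φ.source) :
    (mfderiv (𝓡 5) (𝓡 5) Φ x).IsInvertible := by
  have hd : Φ.MDifferentiable (𝓡 5) (𝓡 5) :=
    ⟨h.smooth.mdifferentiableOn (by simp), h.smooth_symm.mdifferentiableOn (by simp)⟩
  exact ⟨hd.mfderiv hx, rfl⟩

theorem mfderiv_pull (h : IsDiffeo Φ) (hx : x ∈ Φ.source) :
    mfderiv (𝓡 5) (𝓡 5) Φ x (pull Φ V x) = V (Φ x) := by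
  exact (h.isInvertible hx).self_apply_inverse _

/-- The differential is injective. In this way a tangent vector is recognised as the value of a
pulled-back constant field. -/
theorem eq_pull (h : IsDiffeo Φ) (hx : x ∈ Φ.source) {v : TangentSpace (𝓡 5) x}
    (hv : mfderiv (𝓡 5) (𝓡 5) Φ x v = V (Φ x)) : v = pull Φ V x :=
  (h.isInvertible hx).injective (hv.trans (h.mfderiv_pull hx).symm)

theorem smoothOn_pull (h : IsDiffeo Φ) (hV : SmoothOn V Φ.target) :
    SmoothOn (pull Φ V) Φ.source := fun x hx =>
  (ContMDiffAt.mpullback_vectorField_preimage (n := ∞)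
    (hV.contMDiffAt Φ.open_target (Φ.map_source hx)) (h.contMDiffAt hx) (h.isInvertible hx)
    (by simp)).contMDiffWithinAt

theorem lie_pull (h : IsDiffeo Φ) (hx : x ∈ Φ.source) (hV : SmoothOn V Φ.target)
    (hW : SmoothOn W Φ.target) :
    lie (pull Φ V) (pull Φ W) x = pull Φ (lie V W) x :=
  (mpullback_mlieBracket (hV.mdiffAt Φ.open_target (Φ.map_source hx))
    (hW.mdiffAt Φ.open_target (Φ.map_source hx)) (h.contMDiffAt hx)
    (by simpa using ENat.LEInfty.out)).symm

theorem linearIndependent_pull {ι : Type*} {G : ι → VField 5 N} (h : IsDiffeo Φ)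
    (hx : x ∈ Φ.source) (hG : LinearIndependent ℝ fun i => G i (Φ x)) :
    LinearIndependent ℝ fun i => pull Φ (G i) x := by
  refine LinearIndependent.of_comp (mfderiv (𝓡 5) (𝓡 5) Φ x).toLinearMap ?_
  convert hG using 2 with i
  exact h.mfderiv_pull hx

theorem dir_pull_comp (h : IsDiffeo Φ) (hx : x ∈ Φ.source) {g : N → ℝ}
    (hg : MDifferentiableAt (𝓡 5) 𝓘(ℝ, ℝ) g (Φ x)) :
    dir (pull Φ V) (g ∘ Φ) x = dir V g (Φ x) := by
  have e := mfderiv_comp x hg ((h.contMDiffAt hx).mdifferentiableAt (by simp))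
  have e' := congrArg (fun L => L (pull Φ V x)) e
  refine e'.trans ?_
  change mfderiv (𝓡 5) 𝓘(ℝ, ℝ) g (Φ x) (mfderiv (𝓡 5) (𝓡 5) Φ x (pull Φ V x)) = _
  rw [h.mfderiv_pull hx]
  rfl

end IsDiffeo

end Pullback

/-! ### The Poincaré lemma for one-forms given on a frame -/

section Poincare

variable {M : Type*} [TopologicalSpace M] [ChartedSpace (EuclideanSpace ℝ (Fin 5)) M]
  [IsManifold (𝓡 5) ∞ M] {F : Fin 5 → VField 5 M} {f : Fin 5 → M → ℝ} {V : Set M} {x : M}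

theorem isDiffeo_chartAt (x₀ : M) : IsDiffeo (chartAt (EuclideanSpace ℝ (Fin 5)) x₀) :=
  ⟨contMDiffOn_chart, contMDiffOn_chart_symm⟩

/-- The one-form with values `f` on the frame `F`. -/
def formOn (F : Fin 5 → VField 5 M) (f : Fin 5 → M → ℝ) (A : VField 5 M) (x : M) : ℝ :=
  ∑ k, coeff F x (A x) k * f k x

/-- The one-form with values `f` on the frame `F` is closed. -/
def IsClosedFormOn (F : Fin 5 → VField 5 M) (f : Fin 5 → M → ℝ) (V : Set M) : Prop :=
  ∀ x ∈ V, ∀ a b, dir (F a) (f b) x - dir (F b) (f a) x = ∑ k, structConst F a b k x * f k x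

theorem smoothFun_formOn (hF : SmoothFrame F V) (hV : IsOpen V) (hf : ∀ k, SmoothFun (f k) V)
    {A : VField 5 M} (hA : SmoothOn A V) : SmoothFun (formOn F f A) V :=
  SmoothFun.sum fun k => (SmoothFrame.smoothFun_coeff hF hV hA k).mul (hf k)

theorem dir_eq_sum_frame (hF : SmoothFrame F V) (hx : x ∈ V) (A : VField 5 M) (g : M → ℝ) :
    dir A g x = ∑ i, coeff F x (A x) i * dir (F i) g x := by
  unfold dir
  conv_lhs => rw [← SmoothFrame.sum_coeff hF hx (A x)]
  simp

/-- The exterior derivative `A α(B) - B α(A) - α([A, B])` is linear over functions in `A` and `B`,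
so its vanishing on a frame is enough. -/
theorem IsClosedFormOn.dir_sub_dir (hF : SmoothFrame F V) (hV : IsOpen V)
    (hf : ∀ k, SmoothFun (f k) V) (h : IsClosedFormOn F f V) {A B : VField 5 M}
    (hA : SmoothOn A V) (hB : SmoothOn B V) (hx : x ∈ V) :
    dir A (formOn F f B) x - dir B (formOn F f A) x = formOn F f (lie A B) x := by
  have e : ∀ {A B : VField 5 M}, SmoothOn A V → SmoothOn B V → dir A (formOn F f B) x =
      ∑ k, (coeff F x (B x) k * ∑ i, coeff F x (A x) i * dir (F i) (f k) x
        + dir A (fun y => coeff F y (B y) k) x * f k x) := by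
    intro A B hA hB
    have hc := SmoothFrame.smoothFun_coeff hF hV hB
    unfold formOn
    rw [dir_sum (F := fun k y => coeff F y (B y) k * f k y)
      fun k => ((hc k).mul (hf k)).mdiffAt hV hx]
    refine Finset.sum_congr rfl fun k _ => ?_
    rw [dir_mul ((hc k).mdiffAt hV hx) ((hf k).mdiffAt hV hx), dir_eq_sum_frame hF hx A (f k)]
  rw [e hA hB, e hB hA]
  unfold formOn
  simp only [SmoothFrame.coeff_lie hF hV hx hA hB]
  have h' : ∀ a b, dir (F a) (f b) x = dir (F b) (f a) x + ∑ k, structConst F a b k x * f k x :=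
    fun a b => by rw [← h x hx a b]; ring
  have s1 : ∑ k, coeff F x (B x) k * ∑ i, coeff F x (A x) i * dir (F i) (f k) x =
      ∑ k, coeff F x (A x) k * ∑ i, coeff F x (B x) i * dir (F i) (f k) x +
      ∑ l, (∑ i, ∑ j, coeff F x (A x) i * coeff F x (B x) j * structConst F i j l x) * f l x := by
    have : ∀ k i, dir (F i) (f k) x = dir (F k) (f i) x + ∑ l, structConst F i k l x * f l x :=
      fun k i => h' i k
    calc _ = ∑ k, coeff F x (B x) k * ∑ i, coeff F x (A x) i *
          (dir (F k) (f i) x + ∑ l, structConst F i k l x * f l x) := by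
            refine Finset.sum_congr rfl fun k _ => ?_
            congr 1
            exact Finset.sum_congr rfl fun i _ => by rw [this k i]
      _ = _ := by
        simp only [mul_add, Finset.sum_add_distrib, Finset.mul_sum, Finset.sum_mul]
        congr 1
        · rw [Finset.sum_comm]
          exact Finset.sum_congr rfl fun i _ => Finset.sum_congr rfl fun j _ => by ring
        · rw [Finset.sum_comm]
          refine (Finset.sum_congr rfl fun i _ => ?_).trans Finset.sum_comm
          refine Finset.sum_comm.trans ?_
          exact Finset.sum_congr rfl fun l _ => Finset.sum_congr rfl fun k _ => by ring
  simp only [Finset.sum_add_distrib, Finset.sum_sub_distrib, add_mul, sub_mul]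
  rw [s1]
  ring

/-- The vector field on the model space with constant value `v`. -/
def constField (v : EuclideanSpace ℝ (Fin 5)) : VField 5 (EuclideanSpace ℝ (Fin 5)) := fun _ => v

theorem smoothOn_constField (v : EuclideanSpace ℝ (Fin 5)) (s : Set (EuclideanSpace ℝ (Fin 5))) :
    SmoothOn (constField v) s :=
  (contMDiffOn_vectorSpace_iff_contDiffOn (E := EuclideanSpace ℝ (Fin 5))).2 contDiffOn_const

theorem lie_constField (v w : EuclideanSpace ℝ (Fin 5)) :
    lie (constField v) (constField w) = 0 := by
  have h := mlieBracketWithin_eq_lieBracketWithin (𝕜 := ℝ) (E := EuclideanSpace ℝ (Fin 5))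
    (V := fun _ => v) (W := fun _ => w) (s := Set.univ)
  rw [lieBracketWithin_univ] at h
  refine ((mlieBracketWithin_univ (I := 𝓡 5) (V := constField v)
    (W := constField w)).symm.trans h).trans ?_
  funext z
  simp [lieBracket]
  rfl

theorem dir_constField (v z : EuclideanSpace ℝ (Fin 5)) (g : EuclideanSpace ℝ (Fin 5) → ℝ) :
    dir (constField v) g z = fderiv ℝ g z v := by
  have h := mfderiv_eq_fderiv (𝕜 := ℝ) (f := g) (x := z)
  exact congrArg (fun L : EuclideanSpace ℝ (Fin 5) →L[ℝ] ℝ => L v) h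

theorem eq_sum_single (u : EuclideanSpace ℝ (Fin 5)) :
    u = ∑ j, u j • (EuclideanSpace.single j (1 : ℝ) : EuclideanSpace ℝ (Fin 5)) := by
  ext i
  simp [Pi.single_apply]

theorem formOn_pull_constField (e : M → EuclideanSpace ℝ (Fin 5)) (u : EuclideanSpace ℝ (Fin 5)) :
    formOn F f (pull e (constField u)) x =
      ∑ j, u j * formOn F f (pull e (constField (EuclideanSpace.single j 1))) x := by
  have hu : pull e (constField u) x =
      ∑ j, u j • pull e (constField (EuclideanSpace.single j 1)) x := by
    change (mfderiv (𝓡 5) (𝓡 5) e x).inverse u =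
      ∑ j, u j • (mfderiv (𝓡 5) (𝓡 5) e x).inverse (EuclideanSpace.single j (1 : ℝ))
    conv_lhs => rw [eq_sum_single u]
    exact (map_sum _ _ _).trans (Finset.sum_congr rfl fun j _ => map_smul _ _ _)
  unfold formOn
  rw [hu]
  simp only [coeff_sum, coeff_smul, Finset.sum_mul, Finset.mul_sum]
  rw [Finset.sum_comm]
  exact Finset.sum_congr rfl fun i _ => Finset.sum_congr rfl fun j _ => by ring

/-- The Poincaré lemma: a closed one-form is locally exact. -/
theorem IsClosedFormOn.exists_primitive (hF : SmoothFrame F V) (hV : IsOpen V)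
    (hf : ∀ k, SmoothFun (f k) V) (h : IsClosedFormOn F f V) (hx : x ∈ V) :
    ∃ V' ⊆ V, IsOpen V' ∧ x ∈ V' ∧ ∃ g : M → ℝ, SmoothFun g V' ∧
      ∀ y ∈ V', ∀ a, dir (F a) g y = f a y := by
  let e := chartAt (EuclideanSpace ℝ (Fin 5)) x
  have he : IsDiffeo e := isDiffeo_chartAt x
  have hxe : x ∈ e.source := mem_chart_source _ x
  -- These are the coordinate fields of the chart `e`; they commute, being pulled back from constant
  -- fields.
  let P : EuclideanSpace ℝ (Fin 5) → VField 5 M := fun v => pull e (constField v)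
  have hPe : ∀ v, SmoothOn (P v) e.source := fun v => he.smoothOn_pull (smoothOn_constField v _)
  let W : Set M := e.source ∩ V
  have hW : IsOpen W := e.open_source.inter hV
  have hFW : SmoothFrame F W := IsLocalFrameOn.mono hF Set.inter_subset_right
  have hfW : ∀ k, SmoothFun (f k) W := fun k => (hf k).mono Set.inter_subset_right
  have hPW : ∀ v, SmoothOn (P v) W := fun v => (hPe v).mono Set.inter_subset_left
  have hcl : IsClosedFormOn F f W := fun y hy => h y hy.2
  let q : Fin 5 → M → ℝ := fun j => formOn F f (P (EuclideanSpace.single j 1))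
  have hq : ∀ j, SmoothFun (q j) W := fun j => smoothFun_formOn hFW hW hfW (hPW _)
  let T : Set (EuclideanSpace ℝ (Fin 5)) := e.target ∩ e.symm ⁻¹' W
  have hT : IsOpen T := e.symm.isOpen_inter_preimage hW
  have hTW : ∀ z ∈ T, e.symm z ∈ W := fun z hz => hz.2
  have hqT : ∀ j, ContDiffOn ℝ ∞ (q j ∘ e.symm) T := fun j =>
    (ContMDiffOn.comp (hq j) (he.smooth_symm.mono Set.inter_subset_left) hTW).contDiffOn
  have hdq : ∀ j u, ∀ z ∈ T, fderiv ℝ (q j ∘ e.symm) z u = dir (P u) (q j) (e.symm z) := by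
    intro j u z hz
    have hs : e.symm z ∈ e.source := e.map_target hz.1
    have hr : e (e.symm z) = z := e.right_inv hz.1
    have hd : MDifferentiableAt (𝓡 5) 𝓘(ℝ, ℝ) (q j ∘ e.symm) (e (e.symm z)) := by
      rw [hr]
      exact (((hqT j).contDiffAt (hT.mem_nhds hz)).differentiableAt (by simp)).mdifferentiableAt
    have h1 := he.dir_pull_comp (V := constField u) hs hd
    rw [dir_constField, hr] at h1
    rw [← h1]
    refine dir_congr_of_eqOn e.open_source hs fun y hy => ?_
    simp [e.left_inv hy]
  -- On commuting fields closedness says that the partial derivatives of the coordinate coefficients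
  -- `q` are symmetric.
  have hsymm : ∀ y ∈ W, ∀ i j, dir (P (EuclideanSpace.single i 1)) (q j) y =
      dir (P (EuclideanSpace.single j 1)) (q i) y := by
    intro y hy i j
    have h1 := hcl.dir_sub_dir hFW hW hfW (hPW (EuclideanSpace.single i 1))
      (hPW (EuclideanSpace.single j 1)) hy
    have h2 : lie (P (EuclideanSpace.single i 1)) (P (EuclideanSpace.single j 1)) y = 0 := by
      rw [he.lie_pull hy.1 (smoothOn_constField _ _) (smoothOn_constField _ _), lie_constField]
      simp [pull]
    have h3 : formOn F f (lie (P (EuclideanSpace.single i 1)) (P (EuclideanSpace.single j 1))) y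
        = 0 := by
      unfold formOn
      rw [h2]
      simp [coeff_zero]
    rw [h3] at h1
    exact sub_eq_zero.1 h1
  let α : EuclideanSpace ℝ (Fin 5) → EuclideanSpace ℝ (Fin 5) →L[ℝ] ℝ := fun z =>
    ∑ j, (q j ∘ e.symm) z • (EuclideanSpace.proj j : EuclideanSpace ℝ (Fin 5) →L[ℝ] ℝ)
  have hα : ContDiffOn ℝ ∞ α T := ContDiffOn.sum fun j _ => (hqT j).smul contDiffOn_const
  have hαd : ∀ z ∈ T, ∀ u v, fderiv ℝ α z u v =
      ∑ j, ∑ i, u i * v j * dir (P (EuclideanSpace.single i 1)) (q j) (e.symm z) := by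
    intro z hz u v
    have hd : ∀ j, DifferentiableAt ℝ (q j ∘ e.symm) z := fun j =>
      ((hqT j).contDiffAt (hT.mem_nhds hz)).differentiableAt (by simp)
    have h1 : HasFDerivAt α (∑ j, (fderiv ℝ (q j ∘ e.symm) z).smulRight
        (EuclideanSpace.proj j : EuclideanSpace ℝ (Fin 5) →L[ℝ] ℝ)) z :=
      HasFDerivAt.fun_sum fun j _ => (hd j).hasFDerivAt.smul_const
        (EuclideanSpace.proj j : EuclideanSpace ℝ (Fin 5) →L[ℝ] ℝ)
    rw [h1.fderiv]
    simp only [_root_.sum_apply, ContinuousLinearMap.smulRight_apply, _root_.smul_apply,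
      PiLp.proj_apply, smul_eq_mul]
    refine Finset.sum_congr rfl fun j _ => ?_
    conv_lhs => rw [eq_sum_single u]
    rw [map_sum, Finset.sum_mul]
    refine Finset.sum_congr rfl fun i _ => ?_
    rw [map_smul, hdq j _ z hz, smul_eq_mul]
    ring
  obtain ⟨r, hr, hball⟩ := Metric.isOpen_iff.1 hT (e x)
    ⟨e.map_source hxe, by simpa [e.left_inv hxe] using ⟨hxe, hx⟩⟩
  let B := Metric.ball (e x) r
  -- On a ball, which is convex, a differentiable one-form with symmetric derivative has a
  -- primitive.
  obtain ⟨p, hp⟩ := (convex_ball (e x) r).exists_forall_hasFDerivAt_of_fderiv_symmetric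
    Metric.isOpen_ball ((hα.mono hball).differentiableOn (by simp)) (by
      intro z hz u v
      rw [hαd z (hball hz), hαd z (hball hz), Finset.sum_comm]
      refine Finset.sum_congr rfl fun i _ => Finset.sum_congr rfl fun j _ => ?_
      rw [hsymm _ (hTW z (hball hz)) i j]
      ring)
  -- The primitive is smooth since its derivative is the smooth form `α`.
  have hpB : ContDiffOn ℝ ∞ p B := by
    rw [contDiffOn_infty_iff_fderiv_of_isOpen Metric.isOpen_ball]
    exact ⟨fun z hz => (hp z hz).differentiableAt.differentiableWithinAt,
      (hα.mono hball).congr fun z hz => (hp z hz).fderiv⟩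
  have hV' : ∀ y ∈ e.source ∩ e ⁻¹' B, y ∈ W := by
    intro y hy
    have := hTW _ (hball hy.2)
    rwa [e.left_inv hy.1] at this
  refine ⟨e.source ∩ e ⁻¹' B, fun y hy => (hV' y hy).2, e.isOpen_inter_preimage Metric.isOpen_ball,
    ⟨hxe, Metric.mem_ball_self hr⟩, p ∘ e, ?_, fun y hy a => ?_⟩
  · exact ContMDiffOn.comp hpB.contMDiffOn (he.smooth.mono Set.inter_subset_left)
      fun y hy => hy.2
  -- Derivatives and forms see only the value at `y`, so `F a` may be replaced by the coordinate
  -- field `P u` with the same value there.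
  · let u : EuclideanSpace ℝ (Fin 5) := mfderiv (𝓡 5) (𝓡 5) e y (F a y)
    have hu : F a y = P u y := he.eq_pull hy.1 rfl
    have h1 : dir (F a) (p ∘ e) y = dir (constField u) p (e y) :=
      (dir_field_congr hu).trans
        (he.dir_pull_comp hy.1 (hp _ hy.2).differentiableAt.mdifferentiableAt)
    have h2 : formOn F f (P u) y = formOn F f (F a) y := by
      unfold formOn
      rw [← hu]
    rw [h1, dir_constField, (hp _ hy.2).fderiv]
    have h3 : α (e y) u = formOn F f (P u) y := by
      rw [formOn_pull_constField e u]
      simp only [α, _root_.sum_apply, _root_.smul_apply, PiLp.proj_apply, smul_eq_mul,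
        Function.comp_apply, e.left_inv hy.1]
      exact Finset.sum_congr rfl fun j _ => mul_comm _ _
    rw [h3, h2]
    unfold formOn
    simp [SmoothFrame.coeff_frame hFW (hV' y hy)]

end Poincare

/-! ### Coordinates adapted to the Carnot bracket relations -/

section Developing

variable {M : Type*} [TopologicalSpace M] [ChartedSpace (EuclideanSpace ℝ (Fin 5)) M]
  [IsManifold (𝓡 5) ∞ M] {F : Fin 5 → VField 5 M} {V : Set M} {x : M}

/-- The inverse function theorem for maps to the model space. -/
theorem exists_isDiffeo {φ : M → EuclideanSpace ℝ (Fin 5)} (hV : IsOpen V) (hx : x ∈ V)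
    (hφ : ContMDiffOn (𝓡 5) (𝓡 5) ∞ φ V)
    (hinj : ∀ y ∈ V, Function.Injective (mfderiv (𝓡 5) (𝓡 5) φ y)) :
    ∃ Φ : OpenPartialHomeomorph M (EuclideanSpace ℝ (Fin 5)), x ∈ Φ.source ∧ Φ.source ⊆ V ∧
      IsDiffeo Φ ∧ ∀ y ∈ Φ.source, Φ y = φ y := by
  let e := chartAt (EuclideanSpace ℝ (Fin 5)) x
  have he : IsDiffeo e := isDiffeo_chartAt x
  have hed : e.MDifferentiable (𝓡 5) (𝓡 5) :=
    ⟨he.smooth.mdifferentiableOn (by simp), he.smooth_symm.mdifferentiableOn (by simp)⟩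
  have hxe : x ∈ e.source := mem_chart_source _ x
  let T : Set (EuclideanSpace ℝ (Fin 5)) := e.target ∩ e.symm ⁻¹' V
  have hT : IsOpen T := e.symm.isOpen_inter_preimage hV
  have hψ : ContDiffOn ℝ ∞ (φ ∘ e.symm) T :=
    (ContMDiffOn.comp hφ (he.smooth_symm.mono Set.inter_subset_left)
      fun z hz => hz.2).contDiffOn
  -- An injective endomorphism in finite dimension is invertible. This is proved at every point of
  -- `T`, since smoothness of the inverse is needed on the whole target.
  have hd : ∀ z ∈ T, ∃ L : EuclideanSpace ℝ (Fin 5) ≃L[ℝ] EuclideanSpace ℝ (Fin 5),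
      HasFDerivAt (φ ∘ e.symm) (L : EuclideanSpace ℝ (Fin 5) →L[ℝ] EuclideanSpace ℝ (Fin 5)) z := by
    intro z hz
    have h1 : mfderiv (𝓡 5) (𝓡 5) (φ ∘ e.symm) z = _ := mfderiv_comp z
      ((hφ.contMDiffAt (hV.mem_nhds hz.2)).mdifferentiableAt (by simp))
      (hed.mdifferentiableAt_symm hz.1)
    have h2 : fderiv ℝ (φ ∘ e.symm) z = mfderiv (𝓡 5) (𝓡 5) (φ ∘ e.symm) z :=
      mfderiv_eq_fderiv.symm
    have hi : Function.Injective (fderiv ℝ (φ ∘ e.symm) z) := by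
      rw [h2, h1]
      exact (hinj _ hz.2).comp (hed.symm.mfderiv_injective hz.1)
    refine ⟨(LinearEquiv.ofInjectiveEndo (fderiv ℝ (φ ∘ e.symm) z).toLinearMap
      hi).toContinuousLinearEquiv, ?_⟩
    have h3 := ((hψ.contDiffAt (hT.mem_nhds hz)).differentiableAt (by simp)).hasFDerivAt
    exact h3.congr_fderiv (ContinuousLinearMap.ext fun v => rfl)
  have hxT : e x ∈ T := ⟨e.map_source hxe, by simpa [e.left_inv hxe] using hx⟩
  obtain ⟨L, hL⟩ := hd _ hxT
  have hc := hψ.contDiffAt (hT.mem_nhds hxT)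
  -- Without the restriction to `T`, the source given by the inverse function theorem could contain
  -- points where the differential is not known to be invertible.
  let G := (hc.toOpenPartialHomeomorph (φ ∘ e.symm) hL (by simp)).restrOpen T hT
  have hG : ∀ z, G z = φ (e.symm z) := fun z => rfl
  have hGT : ∀ z ∈ G.source, z ∈ T := fun z hz => hz.2
  have hΦ : ∀ y ∈ (e.trans G).source, (e.trans G) y = φ y := by
    intro y hy
    rw [OpenPartialHomeomorph.trans_source] at hy
    change G (e y) = φ y
    rw [hG, e.left_inv hy.1]
  have hsub : (e.trans G).source ⊆ V := by
    intro y hy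
    rw [OpenPartialHomeomorph.trans_source] at hy
    have := (hGT _ hy.2).2
    simpa [e.left_inv hy.1] using this
  refine ⟨e.trans G, ?_, hsub, ⟨(hφ.mono hsub).congr hΦ, ?_⟩, hΦ⟩
  · rw [OpenPartialHomeomorph.trans_source]
    exact ⟨hxe, hc.mem_toOpenPartialHomeomorph_source hL (by simp), hxT⟩
  · intro z hz
    rw [OpenPartialHomeomorph.trans_target] at hz
    have hs : G.symm z ∈ T := hGT _ (G.map_target hz.1)
    obtain ⟨L', hL'⟩ := hd _ hs
    have h1 : ContDiffAt ℝ ∞ G.symm z :=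
      G.contDiffAt_symm hz.1 hL' (hψ.contDiffAt (hT.mem_nhds hs))
    have h2 : ContMDiffAt (𝓡 5) (𝓡 5) ∞ e.symm (G.symm z) :=
      he.smooth_symm.contMDiffAt (e.open_target.mem_nhds hs.1)
    exact (h2.comp z h1.contMDiffAt).contMDiffWithinAt

/-- The brackets of the basis `A₁, A₂, B, C₁, C₂` of the Lie algebra of the Carnot group, as
combinations of `v`. -/
def cartanBracket {A : Type*} [AddCommGroup A] (v : Fin 5 → A) (i j : Fin 5) : A :=
  (!![0, v 2, v 3, 0, 0; -v 2, 0, v 4, 0, 0; -v 3, -v 4, 0, 0, 0; 0, 0, 0, 0, 0; 0, 0, 0, 0, 0] :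
    Matrix (Fin 5) (Fin 5) A) i j

/-- The structure constants are `0` and `±1`, so additivity suffices. It is applied to a one-form at
a point and to the inverse of a differential. -/
theorem map_cartanBracket {A B : Type*} [AddCommGroup A] [AddCommGroup B] (f : A →+ B)
    (v : Fin 5 → A) (i j : Fin 5) :
    f (cartanBracket v i j) = cartanBracket (fun k => f (v k)) i j := by
  unfold cartanBracket
  fin_cases i <;> fin_cases j <;> simp

theorem cartanBracket_swap {A : Type*} [AddCommGroup A] (v : Fin 5 → A) (i j : Fin 5) :
    cartanBracket v i j = - cartanBracket v j i := by
  unfold cartanBracket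
  fin_cases i <;> fin_cases j <;> simp

/-- `F` satisfies the bracket relations of the Carnot group. -/
def IsCartanOn (F : Fin 5 → VField 5 M) (V : Set M) : Prop :=
  ∀ y ∈ V, ∀ a b, lie (F a) (F b) y = cartanBracket (fun k => F k y) a b

/-- The Poincaré lemma with the structure constants of the Carnot group inserted; closedness becomes
a finite table of identities. -/
theorem IsCartanOn.exists_primitive {f : Fin 5 → M → ℝ} (h : IsCartanOn F V)
    (hF : SmoothFrame F V) (hV : IsOpen V) (hx : x ∈ V) (hf : ∀ k, SmoothFun (f k) V)
    (hcl : ∀ y ∈ V, ∀ a b, dir (F a) (f b) y - dir (F b) (f a) y =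
      cartanBracket (fun k => f k y) a b) :
    ∃ V' ⊆ V, IsOpen V' ∧ x ∈ V' ∧ ∃ g : M → ℝ, SmoothFun g V' ∧
      ∀ y ∈ V', ∀ a, dir (F a) g y = f a y := by
  refine IsClosedFormOn.exists_primitive hF hV hf (fun y hy a b => ?_) hx
  rw [hcl y hy]
  unfold structConst
  rw [h y hy]
  let T : TangentSpace (𝓡 5) y →+ ℝ :=
    { toFun := fun v => ∑ k, coeff F y v k * f k y
      map_zero' := by simp [coeff_zero]
      map_add' := fun u v => by simp [coeff_add, add_mul, Finset.sum_add_distrib] }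
  refine Eq.trans ?_ (map_cartanBracket T (fun k => F k y) a b).symm
  congr 1
  funext k
  simp [T, SmoothFrame.coeff_frame hF hy]

/-- A frame that satisfies the bracket relations of the Carnot group comes locally from coordinates
in which it is the left-invariant frame. -/
theorem IsCartanOn.exists_coordinates (h : IsCartanOn F V) (hF : SmoothFrame F V) (hV : IsOpen V)
    (hx : x ∈ V) : ∃ V' ⊆ V, IsOpen V' ∧ x ∈ V' ∧ ∃ q : Fin 5 → M → ℝ,
      (∀ k, SmoothFun (q k) V') ∧ ∀ y ∈ V', ∀ a k, dir (F a) (q k) y =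
        CartanGroup.toMap (CartanGroup.leftField a) (WithLp.toLp 2 fun k => q k y) k := by
  have mF : ∀ {V' : Set M}, V' ⊆ V → SmoothFrame F V' := fun h' => IsLocalFrameOn.mono hF h'
  have mh : ∀ {V' : Set M}, V' ⊆ V → IsCartanOn F V' := fun h' y hy => h y (h' hy)
  -- The prescribed derivatives of the `k`-th coordinate are the `k`-th components of the
  -- left-invariant fields. They involve only `q0` and `q1`, so the system is triangular: each
  -- right-hand side is already known, and is closed by the equations solved before. The
  -- neighbourhood shrinks at each stage.
  obtain ⟨V0, s0, o0, x0, q0, sq0, d0⟩ := h.exists_primitive (f := ![fun _ => 1, fun _ => 0,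
    fun _ => 0, fun _ => 0, fun _ => 0]) hF hV hx
    (fun k => by fin_cases k <;> exact SmoothFun.const _)
    (fun y hy a b => by
      have hD : ∀ a b : Fin 5, dir (F a) ((![fun _ => 1, fun _ => 0,
        fun _ => 0, fun _ => 0, fun _ => 0] : Fin 5 → M → ℝ) b) y = 0 := by
        intro a b
        fin_cases b <;> exact dir_const _
      rw [hD, hD]
      fin_cases a <;> fin_cases b <;> simp [cartanBracket])
  obtain ⟨V1, s1, o1, x1, q1, sq1, d1⟩ := (mh s0).exists_primitive (f := ![fun _ => 0, fun _ => 1,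
    fun _ => 0, fun _ => 0, fun _ => 0]) (mF s0) o0 x0
    (fun k => by fin_cases k <;> exact SmoothFun.const _)
    (fun y hy a b => by
      have hD : ∀ a b : Fin 5, dir (F a) ((![fun _ => 0, fun _ => 1,
        fun _ => 0, fun _ => 0, fun _ => 0] : Fin 5 → M → ℝ) b) y = 0 := by
        intro a b
        fin_cases b <;> exact dir_const _
      rw [hD, hD]
      fin_cases a <;> fin_cases b <;> simp [cartanBracket])
  have sq0' : SmoothFun q0 V1 := ContMDiffOn.mono sq0 s1
  obtain ⟨V2, s2, o2, x2, q2, sq2, d2⟩ := (mh (s1.trans s0)).exists_primitive (f := ![fun _ => 0,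
    fun y => q0 y, fun _ => 1, fun _ => 0, fun _ => 0]) (mF (s1.trans s0)) o1 x1
    (fun k => by
      fin_cases k
      exacts [SmoothFun.const _, sq0', SmoothFun.const _, SmoothFun.const _, SmoothFun.const _])
    (fun y hy a b => by
      have hD : ∀ a b : Fin 5, dir (F a) ((![fun _ => 0, fun y => q0 y,
        fun _ => 1, fun _ => 0, fun _ => 0] : Fin 5 → M → ℝ) b) y =
          ![0, dir (F a) q0 y, 0, 0, 0] b := by
        intro a b
        fin_cases b
        exacts [dir_const _, rfl, dir_const _, dir_const _, dir_const _]
      rw [hD, hD, d0 y (s1 hy), d0 y (s1 hy)]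
      fin_cases a <;> fin_cases b <;> simp [cartanBracket])
  have s20 := s2.trans (s1.trans s0)
  have sq0'' : SmoothFun q0 V2 := ContMDiffOn.mono sq0' s2
  have sq1'' : SmoothFun q1 V2 := ContMDiffOn.mono sq1 s2
  obtain ⟨V3, s3, o3, x3, q3, sq3, d3⟩ := (mh s20).exists_primitive (f := ![fun _ => 0,
    fun y => q0 y * q0 y * (1 / 2), fun y => q0 y, fun _ => 1, fun _ => 0]) (mF s20) o2 x2
    (fun k => by
      fin_cases k
      exacts [SmoothFun.const _, (sq0''.mul sq0'').mul (SmoothFun.const _), sq0'',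
        SmoothFun.const _, SmoothFun.const _])
    (fun y hy a b => by
      have hD : ∀ a b : Fin 5, dir (F a) ((![fun _ => 0, fun y => q0 y * q0 y * (1 / 2),
        fun y => q0 y, fun _ => 1, fun _ => 0] : Fin 5 → M → ℝ) b) y =
          ![0, q0 y * dir (F a) q0 y, dir (F a) q0 y, 0, 0] b := by
        intro a b
        have m := sq0''.mdiffAt o2 hy
        fin_cases b
        · exact dir_const _
        · refine (dir_mul ((sq0''.mul sq0'').mdiffAt o2 hy)
            ((SmoothFun.const (U := V2) _).mdiffAt o2 hy)).trans ?_
          rw [dir_const, dir_mul m m]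
          simp
          ring
        exacts [rfl, dir_const _, dir_const _]
      rw [hD, hD, d0 y (s1 (s2 hy)), d0 y (s1 (s2 hy))]
      fin_cases a <;> fin_cases b <;> simp [cartanBracket])
  have s30 := s3.trans s20
  have sq0' : SmoothFun q0 V3 := ContMDiffOn.mono sq0'' s3
  have sq1' : SmoothFun q1 V3 := ContMDiffOn.mono sq1'' s3
  obtain ⟨V4, s4, o4, x4, q4, sq4, d4⟩ := (mh s30).exists_primitive (f := ![fun _ => 0,
    fun y => q0 y * q1 y, fun y => q1 y, fun _ => 0, fun _ => 1]) (mF s30) o3 x3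
    (fun k => by
      fin_cases k
      exacts [SmoothFun.const _, sq0'.mul sq1', sq1', SmoothFun.const _, SmoothFun.const _])
    (fun y hy a b => by
      have hD : ∀ a b : Fin 5, dir (F a) ((![fun _ => 0, fun y => q0 y * q1 y,
        fun y => q1 y, fun _ => 0, fun _ => 1] : Fin 5 → M → ℝ) b) y =
          ![0, q0 y * dir (F a) q1 y + dir (F a) q0 y * q1 y, dir (F a) q1 y, 0, 0] b := by
        intro a b
        fin_cases b
        exacts [dir_const _, dir_mul (sq0'.mdiffAt o3 hy) (sq1'.mdiffAt o3 hy), rfl, dir_const _,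
          dir_const _]
      rw [hD, hD, d0 y (s1 (s2 (s3 hy))), d0 y (s1 (s2 (s3 hy))), d1 y (s2 (s3 hy)),
        d1 y (s2 (s3 hy))]
      fin_cases a <;> fin_cases b <;> simp [cartanBracket])
  refine ⟨V4, s4.trans s30, o4, x4, ![q0, q1, q2, q3, q4], fun k => ?_, fun y hy a k => ?_⟩
  · fin_cases k
    exacts [ContMDiffOn.mono sq0' s4, ContMDiffOn.mono sq1' s4, ContMDiffOn.mono sq2 (s4.trans s3),
      ContMDiffOn.mono sq3 s4, sq4]
  · rw [CartanGroup.toMap_leftField]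
    fin_cases k
    · refine (d0 y (s1 (s2 (s3 (s4 hy)))) a).trans ?_
      fin_cases a <;> simp
    · refine (d1 y (s2 (s3 (s4 hy))) a).trans ?_
      fin_cases a <;> simp
    · refine (d2 y (s3 (s4 hy)) a).trans ?_
      fin_cases a <;> simp
    · refine (d3 y (s4 hy) a).trans ?_
      fin_cases a <;> simp
      ring
    · refine (d4 y hy a).trans ?_
      fin_cases a <;> simp

end Developing

/-! ### The left-invariant frame of the Carnot group -/

section CartanFrame

open CartanGroup

theorem CartanGroup.smoothOn_leftField (i : Fin 5) (s : Set CartanGroup) :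
    SmoothOn (leftField i) s :=
  smoothOn_iff.2 (contDiff_leftField i).contDiffOn

/-- The matrix of the fields in coordinates is triangular with ones on the diagonal. -/
theorem CartanGroup.linearIndependent_leftField (x : CartanGroup) :
    LinearIndependent ℝ fun i => leftField i x := by
  rw [Fintype.linearIndependent_iff]
  intro c hc
  have hc' : ∑ i, c i • toMap (leftField i) x = 0 := hc
  simp only [toMap_leftField, Fin.sum_univ_five, Matrix.cons_val] at hc'
  have h := fun k => congrArg (fun w : EuclideanSpace ℝ (Fin 5) => w k) hc'
  have h0 := h 0
  have h1 := h 1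
  have h2 := h 2
  have h3 := h 3
  have h4 := h 4
  simp at h0 h1 h2 h3 h4
  simp only [h1, zero_mul, zero_add] at h2
  simp only [h1, h2, zero_mul, zero_add] at h3 h4
  intro k
  fin_cases k
  exacts [h0, h1, h2, h3, h4]

theorem CartanGroup.isOrthonormalFrameOn_leftField :
    structure₀.IsOrthonormalFrameOn (fun i : Fin 2 => leftField (![0, 1] i)) Set.univ where
  smooth i := smoothOn_leftField _ _
  span_eq x _ := rfl
  orthonormal x _ i j u v hu hv := by
    refine (metric_apply x u v).trans ?_
    rw [hu, hv]
    exact inner₀_leftField x i j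

theorem CartanGroup.lie_leftField_eq (i j : Fin 5) (x : CartanGroup) :
    lie (leftField i) (leftField j) x = cartanBracket (fun k => leftField k x) i j := by
  obtain ⟨h01, h02, h12, h⟩ := lie_leftField
  have key : ∀ i j : Fin 5, i ≤ j →
      lie (leftField i) (leftField j) x = cartanBracket (fun k => leftField k x) i j := by
    intro i j hij
    have hs : ∀ i : Fin 5, lie (leftField i) (leftField i) x = 0 := fun i => by
      simp [mlieBracket_self]
    have h3 : ∀ i : Fin 5, lie (leftField i) (leftField 3) x = 0 := fun i => by rw [(h i).1]; rfl
    have h4 : ∀ i : Fin 5, lie (leftField i) (leftField 4) x = 0 := fun i => by rw [(h i).2]; rfl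
    fin_cases i <;> fin_cases j <;>
      first
      | exact absurd hij (by decide)
      | exact hs _
      | exact h3 _
      | exact h4 _
      | exact congrFun h01 x
      | exact congrFun h02 x
      | exact congrFun h12 x
  rcases le_total i j with hij | hij
  · exact key i j hij
  · rw [lie_swap, key j i hij, cartanBracket_swap _ i j]

end CartanFrame

/-! ### From the bracket relations to local isometries -/

section Developing

variable {M : Type*} [TopologicalSpace M] [ChartedSpace (EuclideanSpace ℝ (Fin 5)) M]
  [IsManifold (𝓡 5) ∞ M] {F : Fin 5 → VField 5 M} {V U : Set M} {x : M}
  {S : SubRiemannianStructure 5 M} {X X' : Fin 2 → VField 5 M}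

theorem contMDiffOn_toLp {q : Fin 5 → M → ℝ} (hq : ∀ k, SmoothFun (q k) V) :
    ContMDiffOn (𝓡 5) (𝓡 5) ∞ (fun y => (WithLp.toLp 2 fun k => q k y :
      EuclideanSpace ℝ (Fin 5))) V := by
  have h1 : ContMDiffOn (𝓡 5) 𝓘(ℝ, Fin 5 → ℝ) ∞ (fun y k => q k y) V :=
    contMDiffOn_pi_space.2 hq
  have h2 : ContMDiff 𝓘(ℝ, Fin 5 → ℝ) 𝓘(ℝ, EuclideanSpace ℝ (Fin 5)) ∞
      ((EuclideanSpace.equiv (Fin 5) ℝ).symm) :=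
    (EuclideanSpace.equiv (Fin 5) ℝ).symm.contDiff.contMDiff
  exact h2.comp_contMDiffOn h1

theorem mfderiv_toLp_apply {q : Fin 5 → M → ℝ} (hq : ∀ k, SmoothFun (q k) V) (hV : IsOpen V)
    (hx : x ∈ V) (A : VField 5 M) (k : Fin 5) :
    (EuclideanSpace.proj k : EuclideanSpace ℝ (Fin 5) →L[ℝ] ℝ) (mfderiv (𝓡 5) (𝓡 5)
      (fun y => (WithLp.toLp 2 fun k => q k y : EuclideanSpace ℝ (Fin 5))) x (A x)) =
      dir A (q k) x := by
  have hd := ((contMDiffOn_toLp hq).contMDiffAt (hV.mem_nhds hx)).mdifferentiableAt (by simp)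
  have h1 := (EuclideanSpace.proj k : EuclideanSpace ℝ (Fin 5) →L[ℝ] ℝ).hasMFDerivAt
    (x := (WithLp.toLp 2 fun k => q k x : EuclideanSpace ℝ (Fin 5)))
  have h2 := (h1.comp x hd.hasMFDerivAt).mfderiv
  have h3 := congrArg (fun L => L (A x)) h2
  exact h3.symm

/-- A frame that satisfies the bracket relations of the Carnot group is locally diffeomorphic to
the left-invariant frame. -/
theorem IsCartanOn.exists_isDiffeo (h : IsCartanOn F V) (hF : SmoothFrame F V) (hV : IsOpen V)
    (hx : x ∈ V) : ∃ Φ : OpenPartialHomeomorph M CartanGroup, x ∈ Φ.source ∧ Φ.source ⊆ V ∧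
      IsDiffeo Φ ∧ ∀ y ∈ Φ.source, ∀ a,
        mfderiv (𝓡 5) (𝓡 5) Φ y (F a y) = CartanGroup.leftField a (Φ y) := by
  obtain ⟨V', hV'V, hV', hxV', q, hq, hd⟩ := h.exists_coordinates hF hV hx
  set φ : M → EuclideanSpace ℝ (Fin 5) := fun y => WithLp.toLp 2 fun k => q k y with hφ
  have hφs : ContMDiffOn (𝓡 5) (𝓡 5) ∞ φ V' := contMDiffOn_toLp hq
  -- Compared component by component, this is the system solved by the coordinates. It also gives
  -- injectivity of the differential, because a frame goes to independent vectors.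
  have key : ∀ y ∈ V', ∀ a, (mfderiv (𝓡 5) (𝓡 5) φ y (F a y) : EuclideanSpace ℝ (Fin 5)) =
      CartanGroup.toMap (CartanGroup.leftField a) (φ y) := by
    intro y hy a
    refine PiLp.ext fun k => ?_
    exact (mfderiv_toLp_apply hq hV' hy (F a) k).trans (hd y hy a k)
  have hF' : SmoothFrame F V' := IsLocalFrameOn.mono hF hV'V
  obtain ⟨Φ, hxΦ, hΦV, hΦ, hΦφ⟩ := SubRiem.exists_isDiffeo hV' hxV' hφs (by
    intro y hy
    refine (injective_iff_map_eq_zero _).2 fun v hv => ?_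
    have h1 := SmoothFrame.sum_coeff hF' hy v
    rw [← h1, map_sum] at hv
    have h2 : ∑ a, coeff F y v a • CartanGroup.toMap (CartanGroup.leftField a) (φ y) = 0 := by
      refine Eq.trans (Finset.sum_congr rfl fun a _ => ?_) hv
      rw [← key y hy a]
      exact (map_smul (mfderiv (𝓡 5) (𝓡 5) φ y) _ _).symm
    have h3 : ∀ a, coeff F y v a = 0 := by
      let z : CartanGroup := φ y
      exact Fintype.linearIndependent_iff.1 (CartanGroup.linearIndependent_leftField z) _ h2
    rw [← h1]
    simp [h3])
  refine ⟨Φ, hxΦ, hΦV.trans hV'V, hΦ, fun y hy a => ?_⟩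
  have e1 : mfderiv (𝓡 5) (𝓡 5) Φ y = mfderiv (𝓡 5) (𝓡 5) φ y :=
    Filter.EventuallyEq.mfderiv_eq (eventually_of_mem (Φ.open_source.mem_nhds hy) hΦφ)
  have e2 := key y (hΦV hy) a
  rw [← hΦφ y hy] at e2
  refine Eq.trans ?_ e2
  exact congrArg (fun L : EuclideanSpace ℝ (Fin 5) →L[ℝ] EuclideanSpace ℝ (Fin 5) => L (F a y)) e1

namespace SubRiemannianStructure.IsOrthonormalFrameOn

/-- Reduces isometry statements to equality of coefficients in orthonormal frames. -/
theorem g_comb (hX : S.IsOrthonormalFrameOn X U) (hx : x ∈ U) {u v : S.E x} {a b : Fin 2 → ℝ}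
    (hu : (u : TangentSpace (𝓡 5) x) = ∑ i, a i • X i x)
    (hv : (v : TangentSpace (𝓡 5) x) = ∑ i, b i • X i x) : S.g x u v = ∑ i, a i * b i := by
  have e : ∀ {u : S.E x} {a : Fin 2 → ℝ}, (u : TangentSpace (𝓡 5) x) = ∑ i, a i • X i x →
      u = ∑ k, a k • ⟨X k x, hX.mem hx k⟩ := by
    intro u a hu
    apply Subtype.ext
    rw [hu]
    simp
  have o := fun i j => hX.orthonormal x hx i j ⟨X i x, hX.mem hx i⟩ ⟨X j x, hX.mem hx j⟩ rfl rfl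
  rw [e hu, e hv]
  simp only [map_sum, map_smul, LinearMap.sum_apply, LinearMap.smul_apply, o]
  simp
  ring

theorem rotate (hX : S.IsOrthonormalFrameOn X U) {O : Fin 2 → Fin 2 → M → ℝ}
    (hO : IsOrthogonalOn O U) (hX' : ∀ i, ∀ y ∈ U, X' i y = ∑ j, O i j y • X j y) :
    S.IsOrthonormalFrameOn X' U where
  smooth i := (SmoothOn.sum (F := fun j => O i j • X j)
    fun j => (hX.smooth j).smul (hO.smooth i j)).congr (hX' i)
  span_eq x hx := by
    rw [← hX.span_eq x hx]
    refine le_antisymm (Submodule.span_le.2 ?_) (Submodule.span_le.2 ?_)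
    · rintro _ ⟨i, rfl⟩
      change X' i x ∈ _
      rw [hX' i x hx]
      exact Submodule.sum_mem _ fun j _ => Submodule.smul_mem _ _ (Submodule.subset_span ⟨j, rfl⟩)
    · rintro _ ⟨j, rfl⟩
      have : X j x = ∑ i, O i j x • X' i x := by
        have c : ∀ k, ∑ i, O i j x * O i k x = _ := hO.col x hx j
        simp only [hX' _ x hx, Finset.smul_sum, smul_smul]
        rw [Finset.sum_comm]
        simp only [← Finset.sum_smul, c]
        simp
      change X j x ∈ _
      rw [this]
      exact Submodule.sum_mem _ fun j _ => Submodule.smul_mem _ _ (Submodule.subset_span ⟨j, rfl⟩)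
  orthonormal x hx i j u v hu hv := by
    rw [hX.g_comb hx (hu.trans (hX' i x hx)) (hv.trans (hX' j x hx)), hO.row x hx]

end SubRiemannianStructure.IsOrthonormalFrameOn

/-- A diffeomorphism that maps an orthonormal frame to the left-invariant one is an isometry. -/
theorem isometry_of_mfderiv {Φ : OpenPartialHomeomorph M CartanGroup}
    (hX : S.IsOrthonormalFrameOn X U) (hx : x ∈ U)
    (hΦ : ∀ i, mfderiv (𝓡 5) (𝓡 5) Φ x (X i x) = CartanGroup.leftField (![0, 1] i) (Φ x)) :
    (S.E x).map (mfderiv (𝓡 5) (𝓡 5) Φ x).toLinearMap = CartanGroup.structure₀.E (Φ x) ∧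
      ∀ (u v : S.E x) (u' v' : CartanGroup.structure₀.E (Φ x)),
        (u' : TangentSpace (𝓡 5) (Φ x)) = mfderiv (𝓡 5) (𝓡 5) Φ x u →
        (v' : TangentSpace (𝓡 5) (Φ x)) = mfderiv (𝓡 5) (𝓡 5) Φ x v →
          CartanGroup.structure₀.g (Φ x) u' v' = S.g x u v := by
  constructor
  · rw [← hX.span_eq x hx, Submodule.map_span,
      ← CartanGroup.isOrthonormalFrameOn_leftField.span_eq (Φ x) trivial, ← Set.range_comp]
    congr 2
    funext i
    exact hΦ i
  · intro u v u' v' hu' hv'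
    have ex : ∀ u : S.E x, ∃ a : Fin 2 → ℝ, ∑ i, a i • X i x = (u : TangentSpace (𝓡 5) x) := by
      intro u
      exact (Submodule.mem_span_range_iff_exists_fun ℝ).1 (by rw [hX.span_eq x hx]; exact u.2)
    obtain ⟨a, ha⟩ := ex u
    obtain ⟨b, hb⟩ := ex v
    have e : ∀ a : Fin 2 → ℝ, mfderiv (𝓡 5) (𝓡 5) Φ x (∑ i, a i • X i x) =
        ∑ i, a i • CartanGroup.leftField (![0, 1] i) (Φ x) := by
      intro a
      rw [map_sum]
      exact Finset.sum_congr rfl fun i _ => by rw [map_smul, hΦ]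
    rw [← ha, e] at hu'
    rw [← hb, e] at hv'
    rw [hX.g_comb hx ha.symm hb.symm,
      CartanGroup.isOrthonormalFrameOn_leftField.g_comb trivial hu' hv']

/-- The pullback of the left-invariant orthonormal frame by an isometry is an orthonormal frame. -/
theorem isOrthonormalFrameOn_pull {Φ : OpenPartialHomeomorph M CartanGroup} (hd : IsDiffeo Φ)
    (hΦ : ∀ x ∈ Φ.source,
      (S.E x).map (mfderiv (𝓡 5) (𝓡 5) Φ x).toLinearMap = CartanGroup.structure₀.E (Φ x) ∧
      ∀ (u v : S.E x) (u' v' : CartanGroup.structure₀.E (Φ x)),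
        (u' : TangentSpace (𝓡 5) (Φ x)) = mfderiv (𝓡 5) (𝓡 5) Φ x u →
        (v' : TangentSpace (𝓡 5) (Φ x)) = mfderiv (𝓡 5) (𝓡 5) Φ x v →
          CartanGroup.structure₀.g (Φ x) u' v' = S.g x u v) :
    S.IsOrthonormalFrameOn (fun i : Fin 2 => pull Φ (CartanGroup.leftField (![0, 1] i)))
      Φ.source where
  smooth i := hd.smoothOn_pull (CartanGroup.smoothOn_leftField _ _)
  span_eq x hx := by
    refine Submodule.map_injective_of_injective (f := (mfderiv (𝓡 5) (𝓡 5) Φ x).toLinearMap)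
      (hd.isInvertible hx).injective ?_
    rw [(hΦ x hx).1, Submodule.map_span, ← Set.range_comp,
      ← CartanGroup.isOrthonormalFrameOn_leftField.span_eq (Φ x) trivial]
    congr 2
    funext i
    exact hd.mfderiv_pull hx
  orthonormal x hx i j u v hu hv := by
    have m := fun i => CartanGroup.isOrthonormalFrameOn_leftField.mem (Set.mem_univ (Φ x)) i
    rw [← (hΦ x hx).2 u v ⟨_, m i⟩ ⟨_, m j⟩
      (by rw [hu]; exact (hd.mfderiv_pull (V := CartanGroup.leftField (![0, 1] i)) hx).symm)
      (by rw [hv]; exact (hd.mfderiv_pull (V := CartanGroup.leftField (![0, 1] j)) hx).symm)]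
    exact CartanGroup.isOrthonormalFrameOn_leftField.orthonormal (Φ x) trivial i j _ _ rfl rfl

end Developing

/-! ### Tensoriality of the torsion and the model torsion -/

section Torsion

variable {M : Type*} [TopologicalSpace M] [ChartedSpace (EuclideanSpace ℝ (Fin 5)) M]
  [IsManifold (𝓡 5) ∞ M] {F F' : Fin 5 → VField 5 M} {U : Set M} {x : M} {D : Conn 5 M}

/-- The Lie bracket of combinations of vector fields. -/
theorem lie_comb_comb {G : Fin 5 → VField 5 M} {a b : Fin 5 → M → ℝ} (hU : IsOpen U) (hx : x ∈ U)
    (ha : ∀ j, SmoothFun (a j) U) (hb : ∀ j, SmoothFun (b j) U) (hG : ∀ j, SmoothOn (G j) U) :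
    lie (fun y => ∑ i, a i y • G i y) (fun y => ∑ j, b j y • G j y) x =
      ∑ i, ∑ j, (a i x * b j x) • lie (G i) (G j) x
      + ∑ j, (dir (fun y => ∑ i, a i y • G i y) (b j) x
        - dir (fun y => ∑ i, b i y • G i y) (a j) x) • G j x := by
  have e : ∀ j, dir (fun y => ∑ i, b i y • G i y) (a j) x = ∑ i, b i x * dir (G i) (a j) x :=
    fun j => by simp [dir]
  rw [lie_comb_right hU hx hb hG]
  simp only [lie_comb_left hU hx ha hG, e, sub_smul, Finset.sum_add_distrib,
    Finset.sum_sub_distrib, smul_sub, Finset.smul_sum, Finset.sum_smul, smul_smul]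
  rw [Finset.sum_comm (f := fun i j => (a i x * b j x) • lie (G i) (G j) x),
    Finset.sum_comm (f := fun j i => (b i x * dir (G i) (a j) x) • G j x)]
  simp only [mul_comm (a _ x) (b _ x)]
  abel

/-- The derivatives of the coefficients produced by the two covariant derivatives are exactly those
produced by the bracket. -/
theorem torsion_comb_comb {G : Fin 5 → VField 5 M} {a b : Fin 5 → M → ℝ} (hD : IsConn D U)
    (hU : IsOpen U) (hx : x ∈ U)
    (ha : ∀ j, SmoothFun (a j) U) (hb : ∀ j, SmoothFun (b j) U) (hG : ∀ j, SmoothOn (G j) U) :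
    torsion D (fun y => ∑ i, a i y • G i y) (fun y => ∑ j, b j y • G j y) x =
      ∑ i, ∑ j, (a i x * b j x) • torsion D (G i) (G j) x := by
  unfold torsion
  rw [lie_comb_comb hU hx ha hb hG, nabla_comb hD hU hx hb hG, nabla_comb hD hU hx ha hG]
  have e : ∀ (c : Fin 5 → M → ℝ) (W : VField 5 M), nabla D (fun y => ∑ i, c i y • G i y) W x =
      ∑ i, c i x • nabla D (G i) W x := fun c W => nabla_sum_left rfl
  simp only [e, smul_sub, sub_smul, Finset.sum_add_distrib, Finset.sum_sub_distrib,
    Finset.smul_sum, smul_smul]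
  rw [Finset.sum_comm (f := fun i j => (a i x * b j x) • nabla D (G i) (G j) x)]
  simp only [mul_comm (a _ x) (b _ x)]
  abel

theorem torsion_congr (hD : IsConn D U) (hU : IsOpen U) (hx : x ∈ U) {V V' W W' : VField 5 M}
    (hV : SmoothOn V U) (hW : SmoothOn W U) (hV' : ∀ y ∈ U, V' y = V y)
    (hW' : ∀ y ∈ U, W' y = W y) : torsion D V' W' x = torsion D V W x := by
  unfold torsion
  rw [nabla_congr_right hD hU hx hW hW', nabla_congr_right hD hU hx hV hV',
    nabla_congr_left (hV' x hx), nabla_congr_left (hW' x hx), lie_congr_of_eqOn hU hx hV' hW']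

theorem torsion_swap (V W : VField 5 M) : torsion D V W x = - torsion D W V x := by
  unfold torsion
  rw [lie_swap (X := V)]
  abel

/-- The model torsion in terms of the bracket relations of the Carnot group. -/
theorem hasModelTorsionOn_iff {X : Fin 2 → VField 5 M} :
    HasModelTorsionOn X U D ↔ ∀ x ∈ U, ∀ a b, torsion D (adaptedFrame X a) (adaptedFrame X b) x =
      - cartanBracket (fun k => adaptedFrame X k x) a b := by
  constructor
  · intro h x hx
    have self : ∀ V : VField 5 M, torsion D V V x = 0 := fun V => by
      simp [torsion, mlieBracket_self]
    have key : ∀ a b : Fin 5, a ≤ b → torsion D (adaptedFrame X a) (adaptedFrame X b) x =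
        - cartanBracket (fun k => adaptedFrame X k x) a b := by
      intro a b hab
      have hXX := (torsion_swap (D := D) (x := x) (X 0) (X 1)).trans (congrArg _ (h.X_X x hx))
      have hXZ := fun j => (torsion_swap (D := D) (x := x) (X j) (fieldZ X)).trans
        (congrArg _ (h.Z_X j x hx))
      have n0 : (0 : TangentSpace (𝓡 5) x) = -0 := neg_zero.symm
      fin_cases a <;> fin_cases b
      exacts [(self _).trans n0, hXX, hXZ 0,
        (h.X_Y 0 0 x hx).trans n0, (h.X_Y 0 1 x hx).trans n0,
        absurd hab (by decide), (self _).trans n0, hXZ 1,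
        (h.X_Y 1 0 x hx).trans n0, (h.X_Y 1 1 x hx).trans n0,
        absurd hab (by decide), absurd hab (by decide), (self _).trans n0,
        (h.Z_Y 0 x hx).trans n0, (h.Z_Y 1 x hx).trans n0,
        absurd hab (by decide), absurd hab (by decide), absurd hab (by decide),
        (self _).trans n0, (h.Y_Y x hx).trans n0,
        absurd hab (by decide), absurd hab (by decide), absurd hab (by decide),
        absurd hab (by decide), (self _).trans n0]
    intro a b
    rcases le_total a b with hab | hab
    · exact key a b hab
    · rw [torsion_swap, key b a hab, cartanBracket_swap _ a b]
  · intro h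
    refine ⟨fun x hx => (h x hx 1 0).trans (neg_neg _), fun j x hx => ?_, fun i j x hx => ?_,
      fun j x hx => ?_, fun x hx => (h x hx 3 4).trans neg_zero⟩
    · fin_cases j
      exacts [(h x hx 2 0).trans (neg_neg _), (h x hx 2 1).trans (neg_neg _)]
    · fin_cases i <;> fin_cases j
      exacts [(h x hx 0 3).trans neg_zero, (h x hx 0 4).trans neg_zero,
        (h x hx 1 3).trans neg_zero, (h x hx 1 4).trans neg_zero]
    · fin_cases j
      exacts [(h x hx 2 3).trans neg_zero, (h x hx 2 4).trans neg_zero]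

end Torsion

/-! ### Rotations as automorphisms of the Carnot Lie algebra -/

section Block

variable {M : Type*} [TopologicalSpace M] [ChartedSpace (EuclideanSpace ℝ (Fin 5)) M]
  [IsManifold (𝓡 5) ∞ M] {U V : Set M} {x : M} {O : Fin 2 → Fin 2 → M → ℝ}

/-- The automorphism of the Lie algebra of the Carnot group that extends the linear map `O` of
`span {A₁, A₂}`, as a matrix of functions. -/
def blockMat (O : Fin 2 → Fin 2 → M → ℝ) (a b : Fin 5) : M → ℝ :=
  (!![O 0 0, O 0 1, fun _ => 0, fun _ => 0, fun _ => 0;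
    O 1 0, O 1 1, fun _ => 0, fun _ => 0, fun _ => 0;
    fun _ => 0, fun _ => 0, det₂ O, fun _ => 0, fun _ => 0;
    fun _ => 0, fun _ => 0, fun _ => 0, fun y => det₂ O y * O 0 0 y, fun y => det₂ O y * O 0 1 y;
    fun _ => 0, fun _ => 0, fun _ => 0, fun y => det₂ O y * O 1 0 y, fun y => det₂ O y * O 1 1 y] :
    Matrix (Fin 5) (Fin 5) (M → ℝ)) a b

theorem blockMat_apply (O : Fin 2 → Fin 2 → M → ℝ) (a b : Fin 5) (x : M) : blockMat O a b x =
    (!![O 0 0 x, O 0 1 x, 0, 0, 0; O 1 0 x, O 1 1 x, 0, 0, 0; 0, 0, det₂ O x, 0, 0;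
      0, 0, 0, det₂ O x * O 0 0 x, det₂ O x * O 0 1 x;
      0, 0, 0, det₂ O x * O 1 0 x, det₂ O x * O 1 1 x] : Matrix (Fin 5) (Fin 5) ℝ) a b := by
  fin_cases a <;> fin_cases b <;> rfl

theorem smoothFun_blockMat (hO : IsOrthogonalOn O U) (a b : Fin 5) :
    SmoothFun (blockMat O a b) U := by
  have s := hO.smooth
  have d := hO.smooth_det
  have z : SmoothFun (fun _ : M => (0 : ℝ)) U := SmoothFun.const 0
  fin_cases a <;> fin_cases b <;>
    first
    | exact z
    | exact s _ _
    | exact d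
    | exact d.mul (s _ _)

/-- Since the determinant is locally constant, only the entries of `O` are differentiated. -/
theorem dir_blockMat (hO : IsOrthogonalOn O U) (hU : IsOpen U) (hx : x ∈ U) (A : VField 5 M)
    (a b : Fin 5) : dir A (blockMat O a b) x =
    (!![dir A (O 0 0) x, dir A (O 0 1) x, 0, 0, 0; dir A (O 1 0) x, dir A (O 1 1) x, 0, 0, 0;
      0, 0, 0, 0, 0;
      0, 0, 0, det₂ O x * dir A (O 0 0) x, det₂ O x * dir A (O 0 1) x;
      0, 0, 0, det₂ O x * dir A (O 1 0) x, det₂ O x * dir A (O 1 1) x] :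
        Matrix (Fin 5) (Fin 5) ℝ) a b := by
  have z : dir A (fun _ => 0) x = 0 := dir_const 0
  have d : dir A (det₂ O) x = 0 := hO.dir_det hU hx A
  have m : ∀ i j, dir A (fun y => det₂ O y * O i j y) x = det₂ O x * dir A (O i j) x := by
    intro i j
    rw [dir_mul (hO.smooth_det.mdiffAt hU hx) ((hO.smooth i j).mdiffAt hU hx), d]
    ring
  fin_cases a <;> fin_cases b
  exacts [rfl, rfl, z, z, z, rfl, rfl, z, z, z, z, z, d, z, z, z, z, z, m 0 0, m 0 1,
    z, z, z, m 1 0, m 1 1]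

/-- `blockMat O` preserves the bracket relations of the Carnot group. -/
theorem cartanBracket_blockMat {A : Type*} [AddCommGroup A] [Module ℝ A] (v : Fin 5 → A)
    (a b : Fin 5) : ∑ i, ∑ j, (blockMat O a i x * blockMat O b j x) • cartanBracket v i j =
      cartanBracket (fun k => ∑ l, blockMat O k l x • v l) a b := by
  simp only [blockMat_apply, cartanBracket, Fin.sum_univ_five]
  fin_cases a <;> fin_cases b <;> simp [det₂] <;> module

/-- The transpose. -/
def transpose₂ (O : Fin 2 → Fin 2 → M → ℝ) : Fin 2 → Fin 2 → M → ℝ := fun i j => O j i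

theorem det₂_transpose₂ : det₂ (transpose₂ O) x = det₂ O x := by
  simp only [det₂, transpose₂]
  ring

theorem isOrthogonalOn_transpose₂ (hO : IsOrthogonalOn O U) : IsOrthogonalOn (transpose₂ O) U :=
  ⟨fun i j => hO.smooth j i, hO.col, hO.row⟩

theorem blockMat_transpose₂_mul (hO : IsOrthogonalOn O U) (hx : x ∈ U) (a b : Fin 5) :
    ∑ j, blockMat (transpose₂ O) a j x * blockMat O j b x = if a = b then 1 else 0 := by
  have d := hO.det_mul_self hx
  have c00 := hO.col x hx 0 0
  have c01 := hO.col x hx 0 1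
  have c11 := hO.col x hx 1 1
  simp only [Fin.sum_univ_two, if_true, Fin.zero_eq_one_iff, OfNat.ofNat_ne_one, if_false]
    at c00 c01 c11
  simp only [blockMat_apply, Fin.sum_univ_five, det₂_transpose₂, transpose₂]
  fin_cases a <;> fin_cases b <;> simp
  · linear_combination c00
  · linear_combination c01
  · linear_combination c01
  · linear_combination c11
  · linear_combination d
  · linear_combination c00 + (O 0 0 x * O 0 0 x + O 1 0 x * O 1 0 x) * d
  · linear_combination c01 + (O 0 0 x * O 0 1 x + O 1 0 x * O 1 1 x) * d
  · linear_combination c01 + (O 0 0 x * O 0 1 x + O 1 0 x * O 1 1 x) * d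
  · linear_combination c11 + (O 0 1 x * O 0 1 x + O 1 1 x * O 1 1 x) * d

/-- A frame is recovered from its image under `blockMat O`. -/
theorem eq_sum_blockMat_transpose₂ (hO : IsOrthogonalOn O U) (hx : x ∈ U) {A : Type*}
    [AddCommGroup A] [Module ℝ A] {v v' : Fin 5 → A} (h : ∀ a, v' a = ∑ b, blockMat O a b x • v b)
    (a : Fin 5) : v a = ∑ b, blockMat (transpose₂ O) a b x • v' b := by
  simp only [h, Finset.smul_sum, smul_smul]
  rw [Finset.sum_comm]
  simp only [← Finset.sum_smul, blockMat_transpose₂_mul hO hx]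
  simp

end Block

/-! ### Parallel rotated frames and the flat case -/

section Rotated

variable {M : Type*} [TopologicalSpace M] [ChartedSpace (EuclideanSpace ℝ (Fin 5)) M]
  [IsManifold (𝓡 5) ∞ M] {S : SubRiemannianStructure 5 M} {X : Fin 2 → VField 5 M}
  {U V : Set M} {x : M} {D nab : Conn 5 M} {O : Fin 2 → Fin 2 → M → ℝ}

/-- The frame obtained from the adapted frame by `blockMat O`. -/
def rotFrame (O : Fin 2 → Fin 2 → M → ℝ) (X : Fin 2 → VField 5 M) (a : Fin 5) : VField 5 M :=
  fun y => ∑ b, blockMat O a b y • adaptedFrame X b y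

theorem smoothFrame_rotFrame (hF : SmoothFrame (adaptedFrame X) V) (hO : IsOrthogonalOn O V) :
    SmoothFrame (rotFrame O X) V := by
  refine SmoothFrame.of_span (fun a => SmoothOn.sum
    (F := fun b => blockMat O a b • adaptedFrame X b) fun b =>
      (hF.smooth b).smul (smoothFun_blockMat hO a b)) fun y hy => ?_
  refine (hF.generating hy).trans (Submodule.span_le.2 ?_)
  rintro _ ⟨a, rfl⟩
  change adaptedFrame X a y ∈ _
  rw [eq_sum_blockMat_transpose₂ hO hy (v := fun a => adaptedFrame X a y)
    (v' := fun a => rotFrame O X a y) (fun _ => rfl) a]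
  exact Submodule.sum_mem _ fun b _ => Submodule.smul_mem _ _ (Submodule.subset_span ⟨b, rfl⟩)

theorem rotFrame_horizontal (O : Fin 2 → Fin 2 → M → ℝ) (X : Fin 2 → VField 5 M) (i : Fin 2)
    (y : M) : rotFrame O X (![0, 1] i) y = ∑ j, O i j y • X j y := by
  have b0 : adaptedFrame X 0 y = X 0 y := rfl
  have b1 : adaptedFrame X 1 y = X 1 y := rfl
  unfold rotFrame
  simp only [blockMat_apply, Fin.sum_univ_five, Fin.sum_univ_two]
  fin_cases i <;> simp [b0, b1]

/-- The rotated frame is parallel if the rotation solves the equation of parallel transport. -/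
theorem IsCanonicalConnectionOn.nabla_rotFrame (hX : S.IsOrthonormalFrameOn X U)
    (hF : SmoothFrame (adaptedFrame X) U) (hU : IsOpen U) (hD : IsLeviCivitaOn (gbar X) U D)
    (h : IsCanonicalConnectionOn S X U D nab) (hV : IsOpen V) (hVU : V ⊆ U)
    (hO : IsOrthogonalOn O V) (hx : x ∈ V) (A : VField 5 M)
    (hd : ∀ i, dir A (O i 0) x = connFormOn X A x * O i 1 x ∧
      dir A (O i 1) x = - (connFormOn X A x * O i 0 x)) (a : Fin 5) :
    nabla nab A (rotFrame O X a) x = 0 := by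
  unfold rotFrame
  rw [nabla_comb (h.isConnection.mono hVU) hV hx (smoothFun_blockMat hO a)
    fun b => (hF.smooth b).mono hVU]
  obtain ⟨n0, n1, n2, n3, n4⟩ := h.nabla_frame hX hF hU hD (hVU hx) A
  have b0 : adaptedFrame X 0 = X 0 := rfl
  have b1 : adaptedFrame X 1 = X 1 := rfl
  have b2 : adaptedFrame X 2 = fieldZ X := rfl
  have b3 : adaptedFrame X 3 = fieldY X 0 := rfl
  have b4 : adaptedFrame X 4 = fieldY X 1 := rfl
  -- The `Y`-rows solve the same equation as the horizontal rows, multiplied by the locally constant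
  -- determinant; the `Z`-row has zero derivative.
  simp only [Fin.sum_univ_five, dir_blockMat hO hV hx, blockMat_apply, b0, b1, b2, b3, b4, n0, n1,
    n2, n3, n4, (hd _).1, (hd _).2]
  fin_cases a <;> simp <;> module

theorem connFormOn_frame (hF : SmoothFrame (adaptedFrame X) U) (hx : x ∈ U) (a : Fin 5) :
    connFormOn X (adaptedFrame X a) x = connForm X a x := by
  simp [connFormOn, SmoothFrame.coeff_frame hF hx]

theorem nabla_smul (hD : IsConn D U) (hU : IsOpen U) (hx : x ∈ U) {f : M → ℝ} {A Y : VField 5 M}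
    (hf : SmoothFun f U) (hY : SmoothOn Y U) :
    nabla D A (f • Y) x = dir A f x • Y x + f x • nabla D A Y x := by
  have h := nabla_comb (V := A) (s := {()}) (b := fun _ => f) (G := fun _ => Y) hD hU hx
    (fun _ => hf) fun _ => hY
  simp only [Finset.sum_singleton] at h
  exact h

/-- The connection form of a flat canonical connection is closed. -/
theorem IsCanonicalConnectionOn.isClosedFormOn_connForm (hX : S.IsOrthonormalFrameOn X U)
    (hF : SmoothFrame (adaptedFrame X) U) (hU : IsOpen U) (hD : IsLeviCivitaOn (gbar X) U D)
    (h : IsCanonicalConnectionOn S X U D nab) (hR : CurvatureVanishesOn nab U) :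
    IsClosedFormOn (adaptedFrame X) (connForm X) U := by
  intro x hx a b
  have hw := smoothFun_connForm hF hU
  -- The term quadratic in the connection form is symmetric in `a, b` and drops out of the
  -- curvature. The `X 1`-component of the curvature applied to `X 0` is therefore the exterior
  -- derivative of the form.
  have second : ∀ a b, nabla nab (adaptedFrame X a) (nabla nab (adaptedFrame X b) (X 0)) x =
      dir (adaptedFrame X a) (connForm X b) x • X 1 x
        - (connForm X b x * connForm X a x) • X 0 x := by
    intro a b
    have e : ∀ y ∈ U, nabla nab (adaptedFrame X b) (X 0) y = (connForm X b • X 1) y := by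
      intro y hy
      rw [(h.nabla_frame hX hF hU hD hy _).1, connFormOn_frame hF hy]
      rfl
    rw [nabla_congr_right h.isConnection hU hx ((hX.smooth 1).smul (hw b)) e,
      nabla_smul h.isConnection hU hx (hw b) (hX.smooth 1),
      (h.nabla_frame hX hF hU hD hx _).2.1, connFormOn_frame hF hx]
    module
  have hc := hR _ _ _ (hF.smooth a) (hF.smooth b) (hX.smooth 0) x hx
  unfold curvature at hc
  rw [second a b, second b a, (h.nabla_frame hX hF hU hD hx _).1] at hc
  have h1 := congrArg (fun v => coeff (adaptedFrame X) x v 1) hc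
  have f0 : coeff (adaptedFrame X) x (X 0 x) 1 = _ := SmoothFrame.coeff_frame hF hx 0 1
  have f1 : coeff (adaptedFrame X) x (X 1 x) 1 = _ := SmoothFrame.coeff_frame hF hx 1 1
  simp only [coeff_sub, coeff_smul, coeff_zero, f0, f1] at h1
  have e : connFormOn X (lie (adaptedFrame X a) (adaptedFrame X b)) x =
      ∑ k, structConst (adaptedFrame X) a b k x * connForm X k x := rfl
  rw [e] at h1
  simp at h1
  linear_combination h1

theorem dir_comp {g : ℝ → ℝ} {g' : ℝ} {f : M → ℝ} (hf : MDifferentiableAt (𝓡 5) 𝓘(ℝ, ℝ) f x)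
    (hg : HasDerivAt g g' (f x)) (A : VField 5 M) :
    dir A (fun y => g (f y)) x = g' * dir A f x := by
  have h1 := (hg.hasFDerivAt.hasMFDerivAt.comp x hf.hasMFDerivAt).mfderiv
  have h2 := congrArg (fun L => L (A x)) h1
  exact h2.trans (mul_comm (dir A f x) g')

/-- The rotation by the angle `θ`. -/
def rotation (θ : M → ℝ) (i j : Fin 2) : M → ℝ :=
  (!![fun y => Real.cos (θ y), fun y => - Real.sin (θ y);
    fun y => Real.sin (θ y), fun y => Real.cos (θ y)] : Matrix (Fin 2) (Fin 2) (M → ℝ)) i j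

theorem isOrthogonalOn_rotation {θ : M → ℝ} (hθ : SmoothFun θ V) :
    IsOrthogonalOn (rotation θ) V := by
  have hc : SmoothFun (fun y => Real.cos (θ y)) V :=
    Real.contDiff_cos.contMDiff.comp_contMDiffOn hθ
  have hs : SmoothFun (fun y => Real.sin (θ y)) V :=
    Real.contDiff_sin.contMDiff.comp_contMDiffOn hθ
  refine IsOrthogonalOn.of_row (fun i j => ?_) fun x hx i j => ?_
  · fin_cases i <;> fin_cases j
    exacts [hc, hs.neg, hs, hc]
  · have := Real.sin_sq_add_cos_sq (θ x)
    rw [Fin.sum_univ_two]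
    fin_cases i <;> fin_cases j <;> simp [rotation] <;>
      first | linear_combination this | ring

theorem dir_rotation {θ : M → ℝ} (hθ : MDifferentiableAt (𝓡 5) 𝓘(ℝ, ℝ) θ x) (A : VField 5 M)
    (i : Fin 2) : dir A (rotation θ i 0) x = dir A θ x * rotation θ i 1 x ∧
      dir A (rotation θ i 1) x = - (dir A θ x * rotation θ i 0 x) := by
  have hc := dir_comp hθ (Real.hasDerivAt_cos (θ x)) A
  have hs := dir_comp hθ (Real.hasDerivAt_sin (θ x)) A
  have hn : dir A (fun y => - Real.sin (θ y)) x = - (Real.cos (θ x) * dir A θ x) := by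
    rw [dir_neg, hs]
  fin_cases i
  · refine ⟨hc.trans ?_, hn.trans ?_⟩ <;> simp [rotation] <;> ring
  · refine ⟨hs.trans ?_, hc.trans ?_⟩ <;> simp [rotation] <;> ring

/-- In a parallel frame the bracket is the negative of the torsion. -/
theorem lie_eq_neg_torsion {A B : VField 5 M} (hA : nabla D B A x = 0) (hB : nabla D A B x = 0) :
    lie A B x = - torsion D A B x := by
  simp [torsion, hA, hB]

/-- If the canonical connection is flat with the model torsion, then `U` is locally isometric to
the Carnot group. -/
theorem IsCanonicalConnectionOn.locallyIsometricOn (hX : S.IsOrthonormalFrameOn X U)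
    (hF : SmoothFrame (adaptedFrame X) U) (hU : IsOpen U) (hD : IsLeviCivitaOn (gbar X) U D)
    (h : IsCanonicalConnectionOn S X U D nab) (hR : CurvatureVanishesOn nab U)
    (hT : HasModelTorsionOn X U nab) : S.LocallyIsometricOn U CartanGroup.structure₀ := by
  intro x₀ hx₀
  -- `θ` is a primitive of the connection form; rotation by this angle solves the equation of
  -- parallel transport.
  obtain ⟨V, hVU, hV, hxV, θ, hθ, hdθ⟩ :=
    (h.isClosedFormOn_connForm hX hF hU hD hR).exists_primitive hF hU (smoothFun_connForm hF hU) hx₀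
  have hFV : SmoothFrame (adaptedFrame X) V := IsLocalFrameOn.mono hF hVU
  have hO := isOrthogonalOn_rotation hθ
  have hpar : ∀ y ∈ V, ∀ A a, nabla nab A (rotFrame (rotation θ) X a) y = 0 := by
    intro y hy A a
    refine h.nabla_rotFrame hX hF hU hD hV hVU hO hy A (fun i => ?_) a
    have e : dir A θ y = connFormOn X A y := by
      rw [dir_eq_sum_frame hFV hy A θ]
      exact Finset.sum_congr rfl fun a _ => by rw [hdθ y hy a]
    rw [← e]
    exact dir_rotation (hθ.mdiffAt hV hy) A i
  -- The bracket in the parallel frame is minus the torsion. The latter is a tensor, and its model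
  -- form is preserved by `blockMat`.
  have hC : IsCartanOn (rotFrame (rotation θ) X) V := by
    intro y hy a b
    rw [lie_eq_neg_torsion (hpar y hy _ a) (hpar y hy _ b)]
    unfold rotFrame
    rw [torsion_comb_comb (h.isConnection.mono hVU) hV hy (smoothFun_blockMat hO a)
      (smoothFun_blockMat hO b) hFV.smooth, ← cartanBracket_blockMat]
    simp only [hasModelTorsionOn_iff.1 hT y (hVU hy), smul_neg, Finset.sum_neg_distrib, neg_neg]
  obtain ⟨Φ, hxΦ, hΦV, hΦ, hdΦ⟩ := hC.exists_isDiffeo (smoothFrame_rotFrame hFV hO) hV hxV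
  have hX' := (hX.mono hVU).rotate hO fun i y _ => rotFrame_horizontal (rotation θ) X i y
  exact ⟨Φ, hxΦ, hΦV.trans hVU, hΦ.smooth, hΦ.smooth_symm, fun y hy =>
    isometry_of_mfderiv hX' (hΦV hy) fun i => hdΦ y hy _⟩

end Rotated

/-! ### Local isometry implies flatness and the model torsion -/

section Flat

variable {M : Type*} [TopologicalSpace M] [ChartedSpace (EuclideanSpace ℝ (Fin 5)) M]
  [IsManifold (𝓡 5) ∞ M] {S : SubRiemannianStructure 5 M} {X : Fin 2 → VField 5 M}
  {U V : Set M} {x : M} {D nab : Conn 5 M} {O : Fin 2 → Fin 2 → M → ℝ}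

theorem isCartanOn_pull {Φ : OpenPartialHomeomorph M CartanGroup} (hd : IsDiffeo Φ) :
    IsCartanOn (fun a => pull Φ (CartanGroup.leftField a)) Φ.source := by
  intro y hy a b
  rw [hd.lie_pull hy (CartanGroup.smoothOn_leftField _ _) (CartanGroup.smoothOn_leftField _ _)]
  change (mfderiv (𝓡 5) (𝓡 5) Φ y).inverse _ = _
  rw [CartanGroup.lie_leftField_eq]
  exact map_cartanBracket (mfderiv (𝓡 5) (𝓡 5) Φ y).inverse.toLinearMap.toAddMonoidHom _ a b

/-- Near each point of a manifold that is locally isometric to the Carnot group, the adapted frame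
is a rotation of a frame with the bracket relations of the group. -/
theorem exists_isCartanOn_rotFrame (hS : S.HasGrowthVector [2, 3, 5])
    (hX : S.IsOrthonormalFrameOn X U) (hiso : S.LocallyIsometricOn U CartanGroup.structure₀)
    (hx : x ∈ U) : ∃ V ⊆ U, IsOpen V ∧ x ∈ V ∧ ∃ O : Fin 2 → Fin 2 → M → ℝ, IsOrthogonalOn O V ∧
      IsCartanOn (rotFrame O X) V := by
  obtain ⟨Φ, hxΦ, hΦU, hΦ, hΦs, hΦi⟩ := hiso x hx
  have hd : IsDiffeo Φ := ⟨hΦ, hΦs⟩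
  have hV := Φ.open_source
  have hX' := isOrthonormalFrameOn_pull hd hΦi
  have hC := isCartanOn_pull hd
  set F' : Fin 5 → VField 5 M := fun a => pull Φ (CartanGroup.leftField a) with hF'
  set X' : Fin 2 → VField 5 M := fun i => pull Φ (CartanGroup.leftField (![0, 1] i)) with hX'def
  have hF'f : SmoothFrame F' Φ.source := SmoothFrame.of_linearIndependent
    (fun a => hd.smoothOn_pull (CartanGroup.smoothOn_leftField _ _))
    fun y hy => hd.linearIndependent_pull hy (CartanGroup.linearIndependent_leftField _)
  -- The Carnot relations satisfy the adapted conditions exactly, not only modulo `E`, with zero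
  -- matrices for `[X_i, Y_j]`.
  have had : IsAdaptedOn S.E X' (F' 2) (fun i => F' (![3, 4] i)) Φ.source := by
    refine ⟨?_, hX'.span_eq, fun y hy => congrArg _ (hC y hy 0 1), fun y hy i => ?_,
      fun y hy i => ⟨fun _ _ => 0, fun j => ?_, by simp⟩⟩
    · convert hF'f using 1
      funext a
      fin_cases a <;> rfl
    · fin_cases i
      exacts [congrArg _ (hC y hy 0 2), congrArg _ (hC y hy 1 2)]
    · have e : lie (X' i) (F' (![3, 4] j)) y = 0 := by
        fin_cases i <;> fin_cases j
        exacts [hC y hy 0 3, hC y hy 0 4, hC y hy 1 3, hC y hy 1 4]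
      rw [e]
      simp [-Submodule.mkQ_apply]
  have huniq := (hX'.isAdaptedOn hV hS).unique hV had
  obtain ⟨O, hO, hOX, hOZ, hOY⟩ :=
    SubRiemannianStructure.IsOrthonormalFrameOn.exists_orthogonal_adapted hS (hX.mono hΦU) hX' hV
  -- By uniqueness the last three pulled-back fields are `Z`, `Y₁`, `Y₂` of the basis `X'`, and
  -- these are rotations of those of `X`.
  have key : ∀ a, ∀ y ∈ Φ.source, rotFrame O X a y = F' a y := by
    intro a y hy
    have b0 : adaptedFrame X 0 y = X 0 y := rfl
    have b1 : adaptedFrame X 1 y = X 1 y := rfl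
    have b2 : adaptedFrame X 2 y = fieldZ X y := rfl
    have b3 : adaptedFrame X 3 y = fieldY X 0 y := rfl
    have b4 : adaptedFrame X 4 y = fieldY X 1 y := rfl
    have e0 : F' 0 y = _ := hOX 0 y hy
    have e1 : F' 1 y = _ := hOX 1 y hy
    have e2 : F' 2 y = _ := (huniq y hy).1.trans (hOZ y hy)
    have e3 : F' 3 y = _ := ((huniq y hy).2 0).trans (hOY 0 y hy)
    have e4 : F' 4 y = _ := ((huniq y hy).2 1).trans (hOY 1 y hy)
    unfold rotFrame
    simp only [blockMat_apply, Fin.sum_univ_five, b0, b1, b2, b3, b4]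
    fin_cases a
    · refine Eq.trans ?_ e0.symm
      simp
    · refine Eq.trans ?_ e1.symm
      simp
    · refine Eq.trans ?_ e2.symm
      simp
    · refine Eq.trans ?_ e3.symm
      simp
    · refine Eq.trans ?_ e4.symm
      simp
  refine ⟨Φ.source, hΦU, hV, hxΦ, O, hO, fun y hy a b => ?_⟩
  rw [lie_congr_of_eqOn hV hy (key a) (key b), hC y hy a b]
  simp only [key _ y hy]

/-- The adapted frame in terms of a rotation of it. -/
theorem adaptedFrame_eq_sum (hO : IsOrthogonalOn O V) (hx : x ∈ V) (a : Fin 5) :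
    adaptedFrame X a x = ∑ b, blockMat (transpose₂ O) a b x • rotFrame O X b x :=
  eq_sum_blockMat_transpose₂ hO hx (v := fun a => adaptedFrame X a x)
    (v' := fun a => rotFrame O X a x) (fun _ => rfl) a

/-- The adapted frame is the transposed rotation of a Carnot frame. Its brackets split into the
Carnot relations, which the rotation preserves, and derivatives of the rotation written back in the
adapted frame. -/
theorem structConst_adaptedFrame (hF : SmoothFrame (adaptedFrame X) V) (hV : IsOpen V)
    (hO : IsOrthogonalOn O V) (hC : IsCartanOn (rotFrame O X) V) (hx : x ∈ V) (a b k : Fin 5) :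
    structConst (adaptedFrame X) a b k x =
      coeff (adaptedFrame X) x (cartanBracket (fun l => adaptedFrame X l x) a b) k
      + ∑ j, (dir (adaptedFrame X a) (blockMat (transpose₂ O) b j) x
        - dir (adaptedFrame X b) (blockMat (transpose₂ O) a j) x) * blockMat O j k x := by
  have hO' := isOrthogonalOn_transpose₂ hO
  have hF' := smoothFrame_rotFrame hF hO
  have e := fun a y (hy : y ∈ V) => adaptedFrame_eq_sum (X := X) hO hy a
  have h1 := lie_congr_of_eqOn hV hx (e a) (e b)
  rw [lie_comb_comb hV hx (smoothFun_blockMat hO' a) (smoothFun_blockMat hO' b) hF'.smooth] at h1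
  simp only [hC x hx, cartanBracket_blockMat, ← e _ x hx] at h1
  have d : ∀ a (f : M → ℝ), dir (fun y => ∑ i, blockMat (transpose₂ O) a i y • rotFrame O X i y) f x
      = dir (adaptedFrame X a) f x := fun a f => dir_field_congr (e a x hx).symm
  simp only [d] at h1
  unfold structConst
  rw [h1, coeff_add, coeff_sum]
  simp only [coeff_smul]
  congr 1
  refine Finset.sum_congr rfl fun j _ => ?_
  unfold rotFrame
  rw [SmoothFrame.coeff_comb hF hx]

/-- The Carnot brackets have no horizontal component, so only the derivatives of `O` contribute.
Differentiating the orthonormality of the columns makes `Oᵀ dO` skew, which leaves one entry. -/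
theorem connForm_eq (hF : SmoothFrame (adaptedFrame X) V) (hV : IsOpen V)
    (hO : IsOrthogonalOn O V) (hC : IsCartanOn (rotFrame O X) V) (hx : x ∈ V) (a : Fin 5) :
    connForm X a x = ∑ j, dir (adaptedFrame X a) (O j 0) x * O j 1 x := by
  have hO' := isOrthogonalOn_transpose₂ hO
  have hc := fun A => hO.dir_col hV hx A
  have f : ∀ i k, coeff (adaptedFrame X) x (adaptedFrame X i x) k = if i = k then 1 else 0 :=
    SmoothFrame.coeff_frame hF hx
  have c01 := fun a => hc (adaptedFrame X a) 0 1
  have c00 := fun a => hc (adaptedFrame X a) 0 0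
  have c11 := fun a => hc (adaptedFrame X a) 1 1
  simp only [Fin.sum_univ_two] at c00 c01 c11
  unfold connForm
  simp only [structConst_adaptedFrame hF hV hO hC hx, dir_blockMat hO' hV hx, blockMat_apply,
    Fin.sum_univ_five, Fin.sum_univ_two, cartanBracket, transpose₂]
  fin_cases a
  all_goals simp [f, coeff_zero, coeff_neg]
  · linear_combination 1 / 2 * c00 1 - c01 0
  · linear_combination -1 / 2 * c11 0
  · linear_combination -1 / 2 * c01 2
  · linear_combination -1 / 2 * c01 3
  · linear_combination -1 / 2 * c01 4

/-- A rotation to a frame with the bracket relations of the Carnot group solves the equation of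
parallel transport. -/
theorem dir_eq_connFormOn_mul (hF : SmoothFrame (adaptedFrame X) V) (hV : IsOpen V)
    (hO : IsOrthogonalOn O V) (hC : IsCartanOn (rotFrame O X) V) (hx : x ∈ V) (A : VField 5 M)
    (i : Fin 2) : dir A (O i 0) x = connFormOn X A x * O i 1 x ∧
      dir A (O i 1) x = - (connFormOn X A x * O i 0 x) := by
  have w : connFormOn X A x = dir A (O 0 0) x * O 0 1 x + dir A (O 1 0) x * O 1 1 x := by
    unfold connFormOn
    simp only [connForm_eq hF hV hO hC hx, Fin.sum_univ_two]
    rw [dir_eq_sum_frame hF hx A (O 0 0), dir_eq_sum_frame hF hx A (O 1 0), Finset.sum_mul,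
      Finset.sum_mul, ← Finset.sum_add_distrib]
    exact Finset.sum_congr rfl fun a _ => by ring
  -- Row orthonormality replaces `O j 1 * O i 1` by `δ_ij - O j 0 * O i 0`, and the remaining sum
  -- over `j` is a derivative of a column norm, hence zero. The second equation uses in addition the
  -- derivative of the inner product of the two columns.
  have c00 := hO.dir_col hV hx A 0 0
  have c01 := hO.dir_col hV hx A 0 1
  have c11 := hO.dir_col hV hx A 1 1
  have r00 := hO.row x hx 0 0
  have r01 := hO.row x hx 0 1
  have r11 := hO.row x hx 1 1
  simp only [Fin.sum_univ_two, if_true, Fin.zero_eq_one_iff, OfNat.ofNat_ne_one, if_false]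
    at c00 c01 c11 r00 r01 r11
  rw [w]
  fin_cases i
  · refine ⟨?_, ?_⟩ <;> simp only [Fin.mk_zero, Fin.isValue]
    · linear_combination - dir A (O 0 0) x * r00 - dir A (O 1 0) x * r01 + 1 / 2 * O 0 0 x * c00
    · linear_combination - dir A (O 0 1) x * r00 - dir A (O 1 1) x * r01 + 1 / 2 * O 0 1 x * c11
        + O 0 0 x * c01
  · refine ⟨?_, ?_⟩ <;> simp only [Fin.mk_one, Fin.isValue]
    · linear_combination - dir A (O 0 0) x * r01 - dir A (O 1 0) x * r11 + 1 / 2 * O 1 0 x * c00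
    · linear_combination - dir A (O 0 1) x * r01 - dir A (O 1 1) x * r11 + 1 / 2 * O 1 1 x * c11
        + O 1 0 x * c01

/-- A connection with a parallel frame is flat. -/
theorem curvature_eq_zero_of_parallel {F : Fin 5 → VField 5 M} (hF : SmoothFrame F V)
    (hV : IsOpen V) (hD : IsConn D V) (hpar : ∀ y ∈ V, ∀ A a, nabla D A (F a) y = 0)
    (hx : x ∈ V) {A B W : VField 5 M} (hA : SmoothOn A V) (hB : SmoothOn B V)
    (hW : SmoothOn W V) : curvature D A B W x = 0 := by
  have comb : ∀ {b : Fin 5 → M → ℝ}, (∀ j, SmoothFun (b j) V) → ∀ {W : VField 5 M},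
      (∀ y ∈ V, W y = ∑ j, b j y • F j y) → ∀ A, ∀ y ∈ V,
      nabla D A W y = ∑ j, dir A (b j) y • F j y := by
    intro b hb W hWb A y hy
    have hs : SmoothOn (fun y => ∑ j, b j y • F j y) V :=
      SmoothOn.sum (F := fun j => b j • F j) fun j => (hF.smooth j).smul (hb j)
    rw [nabla_congr_right hD hV hy hs hWb, nabla_comb hD hV hy hb hF.smooth]
    simp [hpar y hy]
  have hb := SmoothFrame.smoothFun_coeff hF hV hW
  have hWb : ∀ y ∈ V, W y = ∑ j, coeff F y (W y) j • F j y := fun y hy =>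
    (SmoothFrame.sum_coeff hF hy _).symm
  have n := fun A => comb hb hWb A
  -- With a parallel frame, `∇` only differentiates coefficients, so the curvature reduces to the
  -- commutator formula `dir_lie` for functions.
  unfold curvature
  rw [comb (fun j => (hb j).dir hV hB) (n B) A x hx, comb (fun j => (hb j).dir hV hA) (n A) B x hx,
    n _ x hx]
  simp only [dir_lie hV hx hA hB (hF.smooth 0) (SmoothFrame.ne_zero hF hx 0) (hb _), sub_smul,
    Finset.sum_sub_distrib]
  abel

/-- If `U` is locally isometric to the Carnot group, then the canonical connection is flat with the
model torsion. -/
theorem IsCanonicalConnectionOn.flat_of_locallyIsometricOn (hS : S.HasGrowthVector [2, 3, 5])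
    (hX : S.IsOrthonormalFrameOn X U) (hU : IsOpen U) (hD : IsLeviCivitaOn (gbar X) U D)
    (h : IsCanonicalConnectionOn S X U D nab)
    (hiso : S.LocallyIsometricOn U CartanGroup.structure₀) :
    CurvatureVanishesOn nab U ∧ HasModelTorsionOn X U nab := by
  have hF := hX.smoothFrame_adaptedFrame hU hS
  have hpar : ∀ {V : Set M} {O : Fin 2 → Fin 2 → M → ℝ}, V ⊆ U → IsOpen V → IsOrthogonalOn O V →
      IsCartanOn (rotFrame O X) V → ∀ y ∈ V, ∀ A a, nabla nab A (rotFrame O X a) y = 0 :=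
    fun hVU hV hO hC y hy A a => h.nabla_rotFrame hX hF hU hD hV hVU hO hy A
      (dir_eq_connFormOn_mul (IsLocalFrameOn.mono hF hVU) hV hO hC hy A) a
  refine ⟨fun A B W hA hB hW x hx => ?_, hasModelTorsionOn_iff.2 fun x hx a b => ?_⟩
  · obtain ⟨V, hVU, hV, hxV, O, hO, hC⟩ := exists_isCartanOn_rotFrame hS hX hiso hx
    exact curvature_eq_zero_of_parallel (smoothFrame_rotFrame (IsLocalFrameOn.mono hF hVU) hO) hV
      (h.isConnection.mono hVU) (hpar hVU hV hO hC) hxV (hA.mono hVU) (hB.mono hVU) (hW.mono hVU)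
  · obtain ⟨V, hVU, hV, hxV, O, hO, hC⟩ := exists_isCartanOn_rotFrame hS hX hiso hx
    have hp := hpar hVU hV hO hC
    have hO' := isOrthogonalOn_transpose₂ hO
    have hF' := smoothFrame_rotFrame (IsLocalFrameOn.mono hF hVU) hO
    have e := fun a y (hy : y ∈ V) => adaptedFrame_eq_sum (X := X) hO hy a
    have hs : ∀ a, SmoothOn (fun y => ∑ b, blockMat (transpose₂ O) a b y • rotFrame O X b y) V :=
      fun a => SmoothOn.sum (F := fun b => blockMat (transpose₂ O) a b • rotFrame O X b)
        fun b => (hF'.smooth b).smul (smoothFun_blockMat hO' a b)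
    -- The torsion is known on the parallel Carnot frame; being a tensor, it is carried to the
    -- adapted frame by the transposed rotation, which preserves the bracket table.
    rw [torsion_congr (h.isConnection.mono hVU) hV hxV (hs a) (hs b) (e a) (e b),
      torsion_comb_comb (h.isConnection.mono hVU) hV hxV (smoothFun_blockMat hO' a)
        (smoothFun_blockMat hO' b) hF'.smooth]
    have t : ∀ i j, torsion nab (rotFrame O X i) (rotFrame O X j) x =
        - cartanBracket (fun k => rotFrame O X k x) i j := by
      intro i j
      rw [← hC x hxV, lie_eq_neg_torsion (hp x hxV _ i) (hp x hxV _ j), neg_neg]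
    simp only [t, smul_neg, Finset.sum_neg_distrib, cartanBracket_blockMat, ← e _ x hxV]

end Flat

end SubRiem

end

open scoped Manifold ContDiff in
open SubRiem in
theorem mainTheorem3 {M : Type*} [TopologicalSpace M] [T2Space M]
    [ChartedSpace (EuclideanSpace ℝ (Fin 5)) M] [IsManifold (𝓡 5) ∞ M]
    (S : SubRiemannianStructure 5 M) (hS : S.HasGrowthVector [2, 3, 5])
    (U : Set M) (hU : IsOpen U) (X : Fin 2 → VField 5 M) (hX : S.IsOrthonormalFrameOn X U) :
    -- `X₁, …, X₅` and `X₁, X₂, Z, Y₁, Y₂` are smooth local frames of the tangent bundle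
    IsLocalFrameOn (𝓡 5) (EuclideanSpace ℝ (Fin 5)) ∞ (bracketFrame X) U ∧
    IsLocalFrameOn (𝓡 5) (EuclideanSpace ℝ (Fin 5)) ∞ (adaptedFrame X) U ∧
    -- independence of the choice of the orthonormal basis
    (∀ (U' : Set M) (X' : Fin 2 → VField 5 M), IsOpen U' → S.IsOrthonormalFrameOn X' U' →
      ∀ x ∈ U ∩ U', gbar X x = gbar X' x ∧ TMm2 X x = TMm2 X' x ∧ TMm3 X x = TMm3 X' x) ∧
    -- the Levi-Civita connection `D` of `ḡ` exists, the rules determine a connection `∇`,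
    -- and `∇` detects local flatness
    (∃ D : Conn 5 M, IsLeviCivitaOn (gbar X) U D) ∧
    ∀ D : Conn 5 M, IsLeviCivitaOn (gbar X) U D →
      (∃ nab : Conn 5 M, IsCanonicalConnectionOn S X U D nab) ∧
      (∀ nab nab' : Conn 5 M, IsCanonicalConnectionOn S X U D nab →
        IsCanonicalConnectionOn S X U D nab' → ∀ V W : VField 5 M, SmoothOn V U → SmoothOn W U →
          ∀ x ∈ U, nabla nab V W x = nabla nab' V W x) ∧
      ∀ nab : Conn 5 M, IsCanonicalConnectionOn S X U D nab →
        (S.LocallyIsometricOn U CartanGroup.structure₀ ↔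
          CurvatureVanishesOn nab U ∧ HasModelTorsionOn X U nab) := by
  have hF := hX.smoothFrame_adaptedFrame hU hS
  refine ⟨hX.smoothFrame_bracketFrame hU hS, hF, fun U' X' hU' hX' x hx => ?_,
    ⟨_, isLeviCivitaOn_frameConn hF hU⟩, fun D hD =>
    ⟨⟨_, isCanonicalConnectionOn_frameConn hX hF hU hD⟩,
      fun nab nab' h h' V W _ hW x hx => h.unique hX hF hU hD h' hx hW,
      fun nab h => ⟨fun hiso => h.flat_of_locallyIsometricOn hS hX hU hD hiso,
        fun hflat => h.locallyIsometricOn hX hF hU hD hflat.1 hflat.2⟩⟩⟩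
  exact SubRiemannianStructure.IsOrthonormalFrameOn.gbar_eq hS (hX.mono Set.inter_subset_left)
    (hX'.mono Set.inter_subset_right) (hU.inter hU') hx
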